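/- Let $\ell(x)$ be the length of $x\in\mathbb N$ in binary ($\ell(0)=0$), and let $\ell_2=\ell\circ\ell$. Let $\mathsf{sg}:\mathbb Z\to\mathbb Z$ be given by $\mathsf{sg}(z)=1$ if $z>0$ and $\mathsf{sg}(z)=0$ otherwise. A $\mathsf{sg}$-polynomial expression is an expression built from variables and integer constants with $+$, $-$, $\times$, $\div 2$ (integer division by $2$, rounding down) and $\mathsf{sg}$. A function $F:\mathbb N^k\to\mathbb N$ is in $\mathbf{FTC}^0$ if it is computed by a $\mathbf{Dlogtime}$-uniform family $(C_n)_{n\in\mathbb N}$ of Boolean circuits with unbounded fan-in $\wedge,\vee$ gates, $\neg$ gates and unbounded fan-in majority gates, of size polynomial in $n$ and of constant depth, where $C_n$ computes (in binary) $F(x_1,\dots,x_k)$ for all $x_1,\dots,x_k$ of binary length at most $n$. Uniformity means that Turing machines with a random access tape holding $1^n$ decide, in time $O(\log n)$ and with node names and indices given in binary, the types of the nodes, the edges, and the input and output nodes of $C_n$. A function $F:\mathbb N^k\to\mathbb Z$ is in $\mathbf{FTC}^0$ if both $|F|$ and the indicator function of $F<0$ are. Let $p\in\mathbb N$, let $g:\mathbb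 N^p\to\mathbb N$ and $h:\mathbb N^{p+1}\to\mathbb N$ be in $\mathbf{FTC}^0$, and let $B$ be a $\mathsf{sg}$-polynomial expression in the terms $x$, $\mathbf y=(y_1,\dots,y_p)$, $h(x,\mathbf y)$ and $f(x,\mathbf y)$ in which $f(x,\mathbf y)$ occurs only under the scope of the sign function. Let $f:\mathbb N^{p+1}\to\mathbb Z$ be the solution of the initial value problem $$f(0,\mathbf y)=g(\mathbf y),\qquad \frac{\partial f(x,\mathbf y)}{\partial \ell_2}=B\big(x,\mathbf y,h(x,\mathbf y),f(x,\mathbf y)\big),$$ that is, $f(x+1,\mathbf y)=f(x,\mathbf y)+\big(\ell_2(x+1)-\ell_2(x)\big)\cdot B\big(x,\mathbf y,h(x,\mathbf y),f(x,\mathbf y)\big)$ for all $x\in\mathbb N$ and $\mathbf y\in\mathbb N^p$. Then $f$ is in $\mathbf{FTC}^0$. (In particular, if $f$ takes values in $\mathbb N$, then it is in $\mathbf{FTC}^0$ as a function $\mathbb N^{p+1}\to\mathbb N$.) -/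

import Mathlib

/-! ### Circuits with unbounded fan-in `∧`, `∨`, `¬` and majority gates -/

/-- The Boolean operations that label the inner nodes of a circuit. -/
inductive GateOp
  | and | or | not | maj

/-- The label of a node in a circuit whose input is a `k`-tuple of `n`-bit numbers: either the
`i`-th bit (least significant bit first) of the `j`-th number, or a Boolean operation. -/
inductive GateKind (k n : ℕ)
  | input (j : Fin k) (i : Fin n)
  | op (t : GateOp)

/-- A Boolean circuit reading a `k`-tuple of `n`-bit numbers. The inner nodes and input nodes are
named `0, …, size - 1`, and `preds a` is the set of predecessors of the node `a`. There are
`numOut` output nodes; the `i`-th one is fed by the node `out i` and yields the `i`-th bit (least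
significant bit first) of the output. -/
structure Circuit (k n : ℕ) where
  size : ℕ
  kind : Fin size → GateKind k n
  preds : Fin size → Finset (Fin size)
  numOut : ℕ
  out : Fin numOut → Fin size
  acyclic : WellFounded fun b a : Fin size => b ∈ preds a
  input_fanIn : ∀ a j i, kind a = GateKind.input j i → preds a = ∅
  not_fanIn : ∀ a, kind a = GateKind.op GateOp.not → (preds a).card = 1

namespace Circuit

variable {k n : ℕ}

/-- The total number of nodes, output nodes included. -/
def numNodes (C : Circuit k n) : ℕ := C.size + C.numOut

/-- Every directed path in the circuit has at most `d` edges. -/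
def DepthLE (C : Circuit k n) (d : ℕ) : Prop :=
  ∀ (m : ℕ) (path : Fin (m + 1) → Fin C.size),
    (∀ i : Fin m, path i.castSucc ∈ C.preds (path i.succ)) → m ≤ d

/-- The truth value of each node on the input `x`. A majority gate has value `true` if more than
half of its predecessors have value `true`. -/
def eval (C : Circuit k n) (x : Fin k → ℕ) : Fin C.size → Bool :=
  C.acyclic.fix fun a val =>
    match C.kind a with
    | .input j i => (x j).testBit i
    | .op .and => decide (∀ b, ∀ hb : b ∈ C.preds a, val b hb = true)
    | .op .or => decide (∃ b, ∃ hb : b ∈ C.preds a, val b hb = true)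
    | .op .not => decide (∀ b, ∀ hb : b ∈ C.preds a, val b hb = false)
    | .op .maj =>
        decide ((C.preds a).card <
          2 * ((C.preds a).attach.filter fun b => val b.1 b.2 = true).card)

theorem eval_eq (C : Circuit k n) (x : Fin k → ℕ) (a : Fin C.size) :
    C.eval x a =
      match C.kind a with
      | .input j i => (x j).testBit i
      | .op .and => decide (∀ b ∈ C.preds a, C.eval x b = true)
      | .op .or => decide (∃ b ∈ C.preds a, C.eval x b = true)
      | .op .not => decide (∀ b ∈ C.preds a, C.eval x b = false)
      | .op .maj =>
          decide ((C.preds a).card < 2 * ((C.preds a).filter fun b => C.eval x b = true).card) := by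
  have hcard : ((C.preds a).attach.filter fun b => C.eval x b.1 = true).card =
      ((C.preds a).filter fun b => C.eval x b = true).card := by
    rw [Finset.filter_attach (fun b => C.eval x b = true), Finset.card_map, Finset.card_attach]
  rw [← hcard]
  unfold eval
  rw [WellFounded.fix_eq]
  cases C.kind a with
  | input j i => rfl
  | op t => cases t <;> simp

/-- The number whose binary digits are the values of the output nodes. -/
def output (C : Circuit k n) (x : Fin k → ℕ) : ℕ :=
  ∑ i : Fin C.numOut, if C.eval x (C.out i) then 2 ^ (i : ℕ) else 0

end Circuit

/-! ### Turing machines with a random access tape, and logarithmic time -/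

/-- A deterministic multitape Turing machine with a read-only random access tape. Besides the
random access tape it has an address tape (`none`), two tapes for its binary arguments
(`some (Sum.inl false)` and `some (Sum.inl true)`) and `numWork` further work tapes, all of them
two-way infinite. In one step it sees its state, whether the cell of the random access tape at the
current address holds a `1` (the other cells are blank), and the symbols under the heads; it then
either halts (`none`) or changes state, writes one symbol on each tape and moves each head by at
most one cell. -/
structure RandomAccessTM where
  State : Type
  Symbol : Type
  finiteState : Finite State
  finiteSymbol : Finite Symbol
  numWork : ℕ
  start : State
  accepting : Set State
  blank : Symbol
  bit : Bool → Symbol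
  bit_injective : Function.Injective bit
  bit_ne_blank : ∀ b, bit b ≠ blank
  trans : State → Bool → (Option (Bool ⊕ Fin numWork) → Symbol) →
    Option (State × (Option (Bool ⊕ Fin numWork) → Symbol × SignType))

namespace RandomAccessTM

/-- The index set of the read-write tapes. -/
abbrev Tape (M : RandomAccessTM) : Type := Option (Bool ⊕ Fin M.numWork)

/-- A configuration: the state, the head positions and the tape contents. -/
structure Cfg (M : RandomAccessTM) where
  state : M.State
  head : M.Tape → ℤ
  cell : M.Tape → ℤ → M.Symbol

variable (M : RandomAccessTM)

/-- The tape that holds `a` in binary in the cells `0, 1, 2, …`, least significant bit first, without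
leading zeros, and that is blank elsewhere. -/
def binaryTape (a : ℕ) (z : ℤ) : M.Symbol :=
  if 0 ≤ z ∧ z.toNat < Nat.size a then M.bit (a.testBit z.toNat) else M.blank

/-- The initial configuration for the arguments `a` and `b`: they are on the two argument tapes, all
other tapes are blank, and all heads are at cell `0`. -/
def init (a b : ℕ) : M.Cfg where
  state := M.start
  head := fun _ => 0
  cell := fun τ =>
    match τ with
    | some (Sum.inl false) => M.binaryTape a
    | some (Sum.inl true) => M.binaryTape b
    | _ => fun _ => M.blank

open Classical in
/-- The number whose binary digits, least significant digit first, are in the cells `0, 1, 2, …` of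
the address tape (cells that do not hold the symbol for `1` count as the digit `0`). -/
noncomputable def address (c : M.Cfg) : ℕ :=
  ∑ᶠ i : ℕ, if c.cell none (i : ℤ) = M.bit true then 2 ^ i else 0

/-- The transition that applies to a configuration when the random access tape holds `1 ^ n`, in its
cells `0, …, n - 1`. -/
noncomputable def next (n : ℕ) (c : M.Cfg) :
    Option (M.State × (M.Tape → M.Symbol × SignType)) :=
  M.trans c.state (decide (M.address c < n)) fun τ => c.cell τ (c.head τ)

/-- One step with `1 ^ n` on the random access tape; a halted configuration does not change. -/
noncomputable def step (n : ℕ) (c : M.Cfg) : M.Cfg :=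
  match M.next n c with
  | none => c
  | some (q, act) =>
    { state := q
      head := fun τ => c.head τ + ((act τ).2 : ℤ)
      cell := fun τ => Function.update (c.cell τ) (c.head τ) (act τ).1 }

end RandomAccessTM

/-- `DLogTime R`: some deterministic Turing machine with a random access tape decides, given `1 ^ n` on
the random access tape and `a` and `b` in binary, whether `R n a b` holds, in `O(log n)` steps. -/
def DLogTime (R : ℕ → ℕ → ℕ → Prop) : Prop :=
  ∃ (M : RandomAccessTM) (c : ℕ), ∀ n a b : ℕ,
    let final := (M.step n)^[c * (Nat.size n + 1)] (M.init a b)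
    M.next n final = none ∧ (final.state ∈ M.accepting ↔ R n a b)

/-! ### The function class `FTC⁰` -/

/-- `Dlogtime`-uniformity: the labels of the nodes, the edges and the output nodes of the `n`-th
circuit of the family can be decided in deterministic logarithmic time. -/
structure DLogTimeUniform {k : ℕ} (C : ∀ n, Circuit k n) : Prop where
  op : ∀ t : GateOp, DLogTime fun n a _ =>
    ∃ ha : a < (C n).size, (C n).kind ⟨a, ha⟩ = GateKind.op t
  input : ∀ j : Fin k, DLogTime fun n a i =>
    ∃ (ha : a < (C n).size) (hi : i < n), (C n).kind ⟨a, ha⟩ = GateKind.input j ⟨i, hi⟩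
  edge : DLogTime fun n a b =>
    ∃ (ha : a < (C n).size) (hb : b < (C n).size), (⟨b, hb⟩ : Fin (C n).size) ∈ (C n).preds ⟨a, ha⟩
  out : DLogTime fun n i a => ∃ hi : i < (C n).numOut, ((C n).out ⟨i, hi⟩ : ℕ) = a

/-- `F : ℕᵏ → ℕ` is in `FTC⁰`: it is computed by a `Dlogtime`-uniform family of polynomial size and
constant depth circuits with majority gates. The `n`-th circuit is correct on all tuples of numbers of
binary length at most `n`. -/
def InFTC0 {k : ℕ} (F : (Fin k → ℕ) → ℕ) : Prop :=
  ∃ C : ∀ n, Circuit k n,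
    DLogTimeUniform C ∧
    (∃ p : Polynomial ℕ, ∀ n, (C n).numNodes ≤ p.eval n) ∧
    (∃ d : ℕ, ∀ n, (C n).DepthLE d) ∧
    ∀ (n : ℕ) (x : Fin k → ℕ), (∀ j, Nat.size (x j) ≤ n) → (C n).output x = F x

/-- An integer valued function is in `FTC⁰` if its sign and its absolute value are. -/
def IntInFTC0 {k : ℕ} (F : (Fin k → ℕ) → ℤ) : Prop :=
  InFTC0 (fun v => (F v).natAbs) ∧ InFTC0 (fun v => if F v < 0 then 1 else 0)

/-- For a function with values in `ℕ` nothing is lost. -/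
theorem IntInFTC0.inFTC0 {k : ℕ} {F : (Fin k → ℕ) → ℕ} (hF : IntInFTC0 fun v => (F v : ℤ)) :
    InFTC0 F := by
  simpa using hF.1

/-! ### Sign-polynomial expressions -/

/-- `sg`-polynomial expressions over a set `X` of variables, with integer constants. -/
inductive SgPoly (X : Type)
  | var (v : X)
  | const (c : ℤ)
  | add (P Q : SgPoly X)
  | sub (P Q : SgPoly X)
  | mul (P Q : SgPoly X)
  | half (P : SgPoly X)
  | sg (P : SgPoly X)

/-- The sign function, with value `1` on positive integers and `0` otherwise. -/
def sgFun (z : ℤ) : ℤ := if 0 < z then 1 else 0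

namespace SgPoly

variable {X : Type}

/-- The value of an expression; `half` is integer division by `2`, rounding down. -/
def eval (ρ : X → ℤ) : SgPoly X → ℤ
  | var v => ρ v
  | const c => c
  | add P Q => P.eval ρ + Q.eval ρ
  | sub P Q => P.eval ρ - Q.eval ρ
  | mul P Q => P.eval ρ * Q.eval ρ
  | half P => P.eval ρ / 2
  | sg P => sgFun (P.eval ρ)

/-- Every occurrence of the variable `v` is under the scope of a sign function. -/
def OnlyUnderSg (v : X) : SgPoly X → Prop
  | var w => w ≠ v
  | const _ => True
  | add P Q => P.OnlyUnderSg v ∧ Q.OnlyUnderSg v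
  | sub P Q => P.OnlyUnderSg v ∧ Q.OnlyUnderSg v
  | mul P Q => P.OnlyUnderSg v ∧ Q.OnlyUnderSg v
  | half P => P.OnlyUnderSg v
  | sg _ => True

end SgPoly

/-- The terms that may occur on the right-hand side of the equation: `x`, `y₁, …, yₚ`, `h(x, y)` and
`f(x, y)`. -/
inductive ODEVar (p : ℕ)
  | x
  | y (j : Fin p)
  | h
  | f

/-- The values of these terms. -/
def ODEVar.val {p : ℕ} (x : ℕ) (y : Fin p → ℕ) (hv : ℕ) (fv : ℤ) : ODEVar p → ℤ
  | .x => x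
  | .y j => y j
  | .h => hv
  | .f => fv

/-! ### Differential equations along `ℓ₂` -/

/-- `ℓ₂ = ℓ ∘ ℓ`, where `ℓ(x)` is the length of `x` in binary and `ℓ(0) = 0`. -/
def ell2 (x : ℕ) : ℕ := Nat.size (Nat.size x)

/-- `f` solves the initial value problem `f(0, y) = g(y)`, `∂f(x, y)/∂ℓ₂ = B(x, y, h(x, y), f(x, y))`;
the derivative along `ℓ₂` stands for
`f(x + 1, y) = f(x, y) + (ℓ₂(x + 1) - ℓ₂(x)) · B(x, y, h(x, y), f(x, y))`. -/
def SolvesEll2ODE {p : ℕ} (g : (Fin p → ℕ) → ℕ) (h : (Fin (p + 1) → ℕ) → ℕ)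
    (B : SgPoly (ODEVar p)) (f : (Fin (p + 1) → ℕ) → ℤ) : Prop :=
  ∀ y : Fin p → ℕ,
    f (Matrix.vecCons 0 y) = g y ∧
    ∀ x : ℕ,
      f (Matrix.vecCons (x + 1) y) =
        f (Matrix.vecCons x y) + ((ell2 (x + 1) : ℤ) - (ell2 x : ℤ)) *
          B.eval (ODEVar.val x y (h (Matrix.vecCons x y)) (f (Matrix.vecCons x y)))

/-! The function `ell2` increases only from `jump m = 2 ^ (2 ^ m - 1) - 1` to its successor, so the
equation telescopes: `f(a, y)` is `g(y)` plus the sum over `m < ell2 a` of the values of `B` at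
`jump m` (`SolvesEll2ODE.eq_sum`). If `n` bounds the lengths of the inputs, there are only `O(log
n)` summands. Since `f` occurs in `B` under `sg` only, a summand depends on the earlier values of
`f` only through the signs of the arguments of the outermost sign functions, whose number `s`
depends on `B` alone.

All these signs together are the bits of one number `z < 2 ^ (s * ell2 a)`, and this bound is
polynomial in `n` (`defN_numGuesses`). For a given `z`, every partial sum becomes an explicit
iterated sum `guessVal` in which `f` does not occur, so it can be tested for all jumps in parallel
whether the guessed signs are the signs that they produce (`GuessOk`). The true signs pass the test
(`exists_guessOk`), and by induction along the jumps every `z` that passes yields the value of `f`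
(`GuessOk.guessVal_eq_f`). So a bit of `|f|`, or the sign of `f`, is found by an existential
quantifier over polynomially many `z`.

It remains to see that `FTC⁰` admits these operations. For this the class is described by formulas:
`Base` contains the predicates built from input bits and `DLogTime` relations by negation and
majority quantification over pairs of numbers polynomial in `n`. Majority yields comparison of
cardinalities, hence counting (`DefN.ncard`), hence the arithmetic of small numbers; carry lookahead
and block summation then give sums, iterated sums and products of large numbers (`DefB.add`,
`DefB.sum`, `DefB.mul`). A function with definable bits is in `FTC⁰` (`DefB.inFTC0`); conversely a
circuit family of constant depth is evaluated by a formula, which gives composition with `g` and `h`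
(`InFTC0.defB`).

Uniformity is obtained for all formulas at once. A formula is compiled into a straight-line program,
and a node of the circuit is named by an instruction (the tag) together with the values of the
variables, bitwise interleaved (the tracks). A finite transducer reading two such names in lockstep
can compare the tracks, isolate those that are needed and look up the instruction. `DLogTime.scan`
turns any such transducer, followed by a call of one of finitely many machines, into a logarithmic
time machine. -/

/-! ### Scanning two arguments bit by bit -/

/-- Append an emitted bit at the low end of a number. -/
def emitBit : Option Bool → ℕ → ℕ
  | none, x => x
  | some b, x => Nat.bit b x

/-- Read the lowest `m` bits of `a` and `b` in lockstep, most significant first, with a finite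
transducer that emits the bits of two numbers. -/
def bitScan {Q : Type} (tr : Q → Bool → Bool → Q × Option Bool × Option Bool) (a b : ℕ) :
    ℕ → Q × ℕ × ℕ → Q × ℕ × ℕ
  | 0, s => s
  | m + 1, (q, x, y) =>
    let r := tr q (a.testBit m) (b.testBit m)
    bitScan tr a b m (r.1, emitBit r.2.1 x, emitBit r.2.2 y)

/-- The number of blocks in the names of the nodes of the `n`-th circuit. -/
def blk (n : ℕ) : ℕ := Nat.clog 2 n + 1

/-! ### A machine that scans its arguments and then calls another machine -/

namespace ScanMachine

/-- The data of a scanning machine: a transducer and a family of machines, one of which is started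
on the emitted numbers. -/
structure Data where
  ι : Type
  finι : Finite ι
  M : ι → RandomAccessTM
  Q : Type
  finQ : Finite Q
  q0 : Q
  tr : Q → Bool → Bool → Q × Option Bool × Option Bool
  out : Q → ι
  K : ℕ
  hK : 2 ≤ K
  extra : ℕ
  useB : Bool
  work : ℕ
  hwork : ∀ i, (M i).numWork + 2 ≤ work

attribute [instance] Data.finι Data.finQ

variable (D : Data)

/-- The states of the scanning machine. -/
abbrev St : Type :=
  Fin D.K ⊕ Fin (D.extra + 1) ⊕ (D.Q × Bool × Bool) ⊕ (Σ i, (D.M i).State)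

/-- The symbols of the scanning machine. -/
abbrev Sym : Type := ∀ i, (D.M i).Symbol

/-- The tapes of the scanning machine. -/
abbrev Tp : Type := Option (Bool ⊕ Fin D.work)

/-- Symbols are tuples with one entry for each machine that may be called. Digits and blanks are
formed in all entries at once, because the machine to be called is known only when the scan is over.
-/
def blank : Sym D := fun i => (D.M i).blank

def bit (b : Bool) : Sym D := fun i => (D.M i).bit b

theorem bit_injective : Function.Injective (bit D) := fun _ _ h =>
  -- The index `D.out D.q0` serves only as a witness that there is some machine to look at.
  (D.M (D.out D.q0)).bit_injective (congrFun h _)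

theorem bit_ne_blank (b : Bool) : bit D b ≠ blank D := fun h =>
  (D.M (D.out D.q0)).bit_ne_blank b (congrFun h _)

variable {D}

open Classical in
/-- The symbol of the scanning machine that stands for a symbol of the `i`-th machine. -/
noncomputable def lift (i : D.ι) (s : (D.M i).Symbol) : Sym D :=
  if s = (D.M i).bit true then bit D true
  else if s = (D.M i).bit false then bit D false
  else Function.update (blank D) i s

theorem lift_bit (i : D.ι) (b : Bool) : lift i ((D.M i).bit b) = bit D b := by
  cases b
  · rw [lift, if_neg (fun h => by simpa using (D.M i).bit_injective h), if_pos rfl]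
  · rw [lift, if_pos rfl]

open Classical in
theorem lift_blank (i : D.ι) : lift i (D.M i).blank = blank D := by
  rw [lift, if_neg ((D.M i).bit_ne_blank _).symm, if_neg ((D.M i).bit_ne_blank _).symm]
  exact Function.update_eq_self i (blank D)

open Classical in
theorem lift_apply (i : D.ι) (s : (D.M i).Symbol) : lift i s i = s := by
  unfold lift
  split_ifs with h h
  · rw [h]; rfl
  · rw [h]; rfl
  · simp

/-- Addresses count exactly the cells that hold the digit `1`; the equivalence keeps the address
unchanged under simulation. -/
theorem lift_eq_bit_iff (i : D.ι) (s : (D.M i).Symbol) (b : Bool) :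
    lift i s = bit D b ↔ s = (D.M i).bit b := by
  constructor
  · intro h
    rw [← lift_apply i s, h]; rfl
  · rintro rfl
    exact lift_bit i b

/-- The first two work tapes. -/
def workTape (D : Data) (b : Bool) : Fin D.work :=
  ⟨b.toNat, by have := D.hwork (D.out D.q0); have := Bool.toNat_lt b; omega⟩

/-- The tape of the scanning machine that plays the role of a tape of the `i`-th machine. -/
def emb (i : D.ι) : (D.M i).Tape → Tp D
  | none => none
  | some (Sum.inl b) => some (Sum.inr (workTape D b))
  | some (Sum.inr w) => some (Sum.inr ⟨w + 2, by have := D.hwork i; omega⟩)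

theorem emb_injective (i : D.ι) : Function.Injective (emb i) := by
  rintro (_ | _ | v) (_ | _ | w) h
  · rfl
  · simp [emb] at h
  · simp [emb] at h
  · simp [emb] at h
  · rename_i a b
    cases a <;> cases b <;> simp [emb, workTape] at h ⊢
  · rename_i a
    cases a <;> simp [emb, workTape] at h
  · simp [emb] at h
  · rename_i a
    cases a <;> simp [emb, workTape] at h
  · simpa [emb, Fin.ext_iff] using h

/-- Replace a blank by the digit `0`. -/
noncomputable def norm (s : Sym D) : Sym D :=
  open Classical in if s = blank D then bit D false else s

/-- The action on an output tape when a bit may be emitted; the flag tells whether the tape already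
holds a digit. -/
def emitAct (f : Bool) (e : Option Bool) (s : Sym D) : Sym D × SignType :=
  match e with
  | none => (s, 0)
  | some b => if f || b then (bit D b, -1) else (s, 0)

open Classical in
/-- The transition function of the scanning machine. -/
noncomputable def trans (D : Data) : St D → Bool → (Tp D → Sym D) →
    Option (St D × (Tp D → Sym D × SignType))
  -- Blocks of `K` steps: the first step of block `k` writes a `1` into address cell `k`, above
  -- zeros, so that the address is `2 ^ k`; the last step reads off whether `2 ^ k < n` and turns
  -- the `1` into a `0`. These are different steps because `2 ≤ K`. Meanwhile each step pads one
  -- more cell of the arguments.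
  | Sum.inl j, r, s =>
    some
      (if h : j + 1 < D.K then Sum.inl ⟨j + 1, h⟩
        else if r then Sum.inl ⟨0, by have := D.hK; omega⟩
        else Sum.inr (Sum.inl (Fin.last _)),
      fun t => match t with
        | none => if (j : ℕ) = 0 then (bit D true, 0)
            else if j + 1 < D.K then (s none, 0)
            else (bit D false, if r then 1 else 0)
        | some (Sum.inl c) => (norm (s (some (Sum.inl c))), 1)
        | some (Sum.inr w) => (s (some (Sum.inr w)), 0))
  | Sum.inr (Sum.inl ⟨j + 1, h⟩), _, s =>
    some (Sum.inr (Sum.inl ⟨j, by omega⟩), fun t => match t with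
        | none => (s none, 0)
        | some (Sum.inl c) => (norm (s (some (Sum.inl c))), 1)
        | some (Sum.inr w) => (s (some (Sum.inr w)), 0))
  | Sum.inr (Sum.inl ⟨0, _⟩), _, s =>
    -- The heads are on the first cell beyond the padding. A digit there means that the argument is
    -- too long, and the machine halts without accepting.
    if s (some (Sum.inl false)) = blank D ∧
        (D.useB = true → s (some (Sum.inl true)) = blank D) then
      some (Sum.inr (Sum.inr (Sum.inl (D.q0, false, false))), fun t => match t with
        | none => (s none, 0)
        | some (Sum.inl c) => (s (some (Sum.inl c)), -1)
        | some (Sum.inr w) => (s (some (Sum.inr w)), 0))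
    else none
  | Sum.inr (Sum.inr (Sum.inl (q, fx, fy))), _, s =>
    -- On the way back a blank is met only at cell `-1`: the scan is complete and the machine
    -- selected by the transducer is started.
    if s (some (Sum.inl false)) = blank D then
      some (Sum.inr (Sum.inr (Sum.inr ⟨D.out q, (D.M (D.out q)).start⟩)), fun t => match t with
        | none => (s none, 1)
        | some (Sum.inl c) => (s (some (Sum.inl c)), 0)
        | some (Sum.inr w) => (s (some (Sum.inr w)),
            if w = workTape D false ∨ w = workTape D true then 1 else 0))
    else
      let z := D.tr q (decide (s (some (Sum.inl false)) = bit D true))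
        (decide (s (some (Sum.inl true)) = bit D true))
      some (Sum.inr (Sum.inr (Sum.inl (z.1, fx || (z.2.1 == some true), fy || (z.2.2 == some true)))),
        fun t => match t with
        -- The zeros left on the address tape are erased, since the called machine expects a blank
        -- tape; the head waits at cell `-1` and is moved to `0` at the start of the call.
        | none => if s none = blank D then (blank D, 0) else (blank D, -1)
        | some (Sum.inl c) => (s (some (Sum.inl c)), -1)
        | some (Sum.inr w) =>
          if w = workTape D false then emitAct fx z.2.1 (s (some (Sum.inr w)))
          else if w = workTape D true then emitAct fy z.2.2 (s (some (Sum.inr w)))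
          else (s (some (Sum.inr w)), 0))
  | Sum.inr (Sum.inr (Sum.inr ⟨i, q⟩)), r, s =>
    ((D.M i).trans q r fun t => s (emb i t) i).map fun z =>
      (Sum.inr (Sum.inr (Sum.inr ⟨i, z.1⟩)),
        Function.extend (emb i) (fun t => (lift i (z.2 t).1, (z.2 t).2)) fun t => (s t, 0))

/-- The scanning machine. -/
noncomputable abbrev machine (D : Data) : RandomAccessTM where
  State := St D
  Symbol := Sym D
  finiteState := by
    have := fun i => (D.M i).finiteState
    infer_instance
  finiteSymbol := by
    have := fun i => (D.M i).finiteSymbol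
    infer_instance
  numWork := D.work
  start := Sum.inl ⟨0, by have := D.hK; omega⟩
  accepting := {q | ∃ i s, q = Sum.inr (Sum.inr (Sum.inr ⟨i, s⟩)) ∧ s ∈ (D.M i).accepting}
  blank := blank D
  bit := bit D
  bit_injective := bit_injective D
  bit_ne_blank := bit_ne_blank D
  trans := trans D


theorem mem_accepting (q : St D) : q ∈ (machine D).accepting ↔
    ∃ i s, q = Sum.inr (Sum.inr (Sum.inr ⟨i, s⟩)) ∧ s ∈ (D.M i).accepting := Iff.rfl

/-! ### Simulation of the called machine -/

theorem step_of_next_none {M : RandomAccessTM} {n : ℕ} {c : M.Cfg} (h : M.next n c = none) :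
    M.step n c = c := by
  simp [RandomAccessTM.step, h]

theorem iterate_step_of_next_none {M : RandomAccessTM} {n : ℕ} {c : M.Cfg} (h : M.next n c = none)
    (t : ℕ) : (M.step n)^[t] c = c :=
  Function.iterate_fixed (step_of_next_none h) t

/-- The configuration `c'` of the scanning machine represents the configuration `c` of the `i`-th
machine, with the tape `t` shifted by `off t` cells. -/
structure Sim (i : D.ι) (off : (D.M i).Tape → ℤ) (c : (D.M i).Cfg) (c' : (machine D).Cfg) : Prop where
  state : c'.state = Sum.inr (Sum.inr (Sum.inr ⟨i, c.state⟩))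
  head : ∀ t, c'.head (emb i t) = c.head t + off t
  cell : ∀ t z, c'.cell (emb i t) (z + off t) = lift i (c.cell t z)

/-- A machine sees only what is under its heads, so shifting a tape does no harm. The address tape
is the exception, as its absolute positions give the address; hence the condition `off none = 0`. -/
theorem Sim.next {i : D.ι} {off : (D.M i).Tape → ℤ} {c : (D.M i).Cfg} {c' : (machine D).Cfg}
    (h : Sim i off c c') (h0 : off none = 0) (n : ℕ) :
    (machine D).next n c' = ((D.M i).next n c).map fun z =>
      (Sum.inr (Sum.inr (Sum.inr ⟨i, z.1⟩)),
        Function.extend (emb i) (fun t => (lift i (z.2 t).1, (z.2 t).2))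
          fun t => (c'.cell t (c'.head t), 0)) := by
  have hadd : (machine D).address c' = (D.M i).address c := by
    unfold RandomAccessTM.address
    refine finsum_congr fun k => ?_
    have h1 : c'.cell none k = lift i (c.cell none k) := by
      have := h.cell none k
      rwa [h0, add_zero] at this
    rw [h1]
    have h2 := lift_eq_bit_iff i (c.cell none k) true
    by_cases h3 : c.cell none k = (D.M i).bit true
    · rw [if_pos h3, if_pos (h2.2 h3)]
    · rw [if_neg h3, if_neg (fun h4 => h3 (h2.1 h4))]
  have hread : ∀ t, c'.cell (emb i t) (c'.head (emb i t)) = lift i (c.cell t (c.head t)) := by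
    intro t
    rw [h.head, h.cell]
  unfold RandomAccessTM.next
  rw [hadd, h.state]
  simp only [trans, hread, lift_apply]

theorem Sim.step {i : D.ι} {off : (D.M i).Tape → ℤ} {c : (D.M i).Cfg} {c' : (machine D).Cfg}
    (h : Sim i off c c') (h0 : off none = 0) (n : ℕ) :
    Sim i off ((D.M i).step n c) ((machine D).step n c') := by
  have h1 := h.next h0 n
  rcases h2 : (D.M i).next n c with _ | ⟨q, act⟩
  · rw [h2] at h1
    rw [step_of_next_none h2, step_of_next_none h1]
    exact h
  · rw [h2, Option.map_some] at h1
    refine ⟨?_, ?_, ?_⟩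
    · simp [RandomAccessTM.step, h1, h2]
    · intro t
      simp only [RandomAccessTM.step, h1, h2, (emb_injective i).extend_apply, h.head]
      ring
    · intro t z
      simp only [RandomAccessTM.step, h1, h2, (emb_injective i).extend_apply, h.head]
      by_cases hz : z = c.head t
      · subst hz
        simp
      · rw [Function.update_of_ne hz, Function.update_of_ne (by omega), h.cell]

theorem Sim.iterate {i : D.ι} {off : (D.M i).Tape → ℤ} (h0 : off none = 0) (n t : ℕ) :
    ∀ {c : (D.M i).Cfg} {c' : (machine D).Cfg}, Sim i off c c' →
    Sim i off (((D.M i).step n)^[t] c) (((machine D).step n)^[t] c') := by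
  induction t with
  | zero => intro c c' h; exact h
  | succ t ih => intro c c' h; exact ih (h.step h0 n)

/-! ### Single steps of the scanning machine -/

theorem cfg_ext {M : RandomAccessTM} {c c' : M.Cfg} (h1 : c.state = c'.state)
    (h2 : ∀ t, c.head t = c'.head t) (h3 : ∀ t, c.cell t = c'.cell t) : c = c' := by
  obtain ⟨s, h, f⟩ := c
  obtain ⟨s', h', f'⟩ := c'
  obtain rfl : s = s' := h1
  obtain rfl : h = h' := funext h2
  obtain rfl : f = f' := funext h3
  rfl

/-- The tape that holds `a` in binary, padded with zeros to length at least `l`. -/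
def padded (a l : ℕ) (z : ℤ) : Sym D :=
  if 0 ≤ z ∧ z.toNat < max l (Nat.size a) then bit D (a.testBit z.toNat) else blank D

/-- The tape with zeros in the cells `0, …, k - 1`. -/
def trail (k z : ℤ) : Sym D := if 0 ≤ z ∧ z < k then bit D false else blank D

/-- The configurations in which the arguments are read. -/
noncomputable def conf (s : St D) (p : ℤ) (A : ℤ → Sym D) (m : ℤ) (a b l x y : ℕ) :
    (machine D).Cfg where
  state := s
  head := fun t => match t with
    | none => p
    | some (Sum.inl _) => m
    | some (Sum.inr w) => if w = workTape D false then -(Nat.size x : ℤ)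
        else if w = workTape D true then -(Nat.size y : ℤ) else 0
  cell := fun t => match t with
    | none => A
    | some (Sum.inl c) => padded (if c then b else a) l
    | some (Sum.inr w) =>
        if w = workTape D false then fun z => (machine D).binaryTape x (z + Nat.size x - 1)
        else if w = workTape D true then fun z => (machine D).binaryTape y (z + Nat.size y - 1)
        else fun _ => blank D

theorem step_conf {n : ℕ} {c c' : (machine D).Cfg} {q : St D} {act : Tp D → Sym D × SignType}
    (h : (machine D).next n c = some (q, act)) (h1 : q = c'.state)
    (h2 : ∀ t, c.head t + ((act t).2 : ℤ) = c'.head t)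
    (h3 : ∀ t, Function.update (c.cell t) (c.head t) (act t).1 = c'.cell t) :
    (machine D).step n c = c' := by
  apply cfg_ext
  · simp [RandomAccessTM.step, h, h1]
  · intro t
    simp only [RandomAccessTM.step, h, h2]
  · intro t
    simp only [RandomAccessTM.step, h, h3]

theorem update_norm_padded (a l : ℕ) :
    Function.update (padded (D := D) a l) (l : ℤ) (norm (padded a l (l : ℤ))) =
      padded a (l + 1) := by
  funext z
  by_cases hz : z = l
  · subst hz
    rw [Function.update_self]
    by_cases hl : l < Nat.size a
    · rw [padded, if_pos (by simp [hl]), norm, if_neg (bit_ne_blank D _), padded, if_pos (by simp)]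
    · rw [padded, if_neg (by simp [hl]), norm, if_pos rfl, padded, if_pos (by simp)]
      have : a < 2 ^ l := Nat.size_le.1 (by omega)
      simp [Nat.testBit_lt_two_pow this]
  · rw [Function.update_of_ne hz]
    unfold padded
    congr 1
    simp only [eq_iff_iff]
    omega

theorem init_eq_conf (a b : ℕ) :
    (machine D).init a b = conf (Sum.inl ⟨0, by have := D.hK; omega⟩) 0 (trail 0) 0 a b 0 0 0 := by
  apply cfg_ext
  · rfl
  · rintro (_ | c | w)
    · rfl
    · rfl
    · simp [RandomAccessTM.init, conf]
  · rintro (_ | c | w)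
    · funext z
      have : ¬ (0 ≤ z ∧ z < 0) := by omega
      simp only [RandomAccessTM.init, conf, trail, if_neg this]
    · funext z
      cases c <;> simp [RandomAccessTM.init, conf, padded, RandomAccessTM.binaryTape]
    · funext z
      simp only [RandomAccessTM.init, conf]
      split_ifs <;> simp [RandomAccessTM.binaryTape]

theorem step_block_first {n : ℕ} {j : Fin D.K} (hj : (j : ℕ) = 0) (k : ℤ) (a b l : ℕ) :
    (machine D).step n (conf (Sum.inl j) k (trail k) l a b l 0 0) =
      conf (Sum.inl ⟨1, D.hK⟩) k (Function.update (trail k) k (bit D true)) (l + 1 : ℕ) a b (l + 1)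
        0 0 := by
  have hK := D.hK
  refine step_conf rfl ?_ ?_ ?_
  · simp only [conf, hj]
    rw [dif_pos (by omega)]
  · rintro (_ | c | w)
    · simp [conf, hj]
    · simp [conf]
    · simp [conf]
  · rintro (_ | c | w)
    · simp [conf, hj]
    · exact update_norm_padded _ _
    · simp [conf]

theorem step_block_middle {n : ℕ} {j : Fin D.K} (hj : (j : ℕ) ≠ 0) (hj' : (j : ℕ) + 1 < D.K) (k : ℤ)
    (A : ℤ → Sym D) (a b l : ℕ) :
    (machine D).step n (conf (Sum.inl j) k A l a b l 0 0) =
      conf (Sum.inl ⟨j + 1, hj'⟩) k A (l + 1 : ℕ) a b (l + 1) 0 0 := by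
  refine step_conf rfl ?_ ?_ ?_
  · simp only [conf]
    rw [dif_pos hj']
  · rintro (_ | c | w)
    · simp [conf, hj, hj']
    · simp [conf]
    · simp [conf]
  · rintro (_ | c | w)
    · simp [conf, hj, hj']
    · exact update_norm_padded _ _
    · simp [conf]

theorem address_conf (s : St D) (k : ℕ) (p m : ℤ) (a b l x y : ℕ) :
    (machine D).address (conf s p (Function.update (trail k) k (bit D true)) m a b l x y) =
      2 ^ k := by
  unfold RandomAccessTM.address
  rw [finsum_eq_single _ k]
  · simp [conf]
  · intro i hi
    rw [if_neg]
    have : (i : ℤ) ≠ k := by exact_mod_cast hi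
    simp only [conf, Function.update_of_ne this, trail]
    split_ifs
    · exact fun h => by simpa using bit_injective D h
    · exact (bit_ne_blank D _).symm

theorem update_trail (k : ℕ) :
    Function.update (Function.update (trail (D := D) k) k (bit D true)) (k : ℤ) (bit D false) =
      trail (k + 1 : ℤ) := by
  funext z
  by_cases hz : z = k
  · subst hz
    simp [trail]
  · rw [Function.update_of_ne hz, Function.update_of_ne hz]
    unfold trail
    congr 1
    simp only [eq_iff_iff]
    omega

theorem step_block_last {n : ℕ} {j : Fin D.K} (hj : (j : ℕ) + 1 = D.K) (k : ℕ)
    (a b l : ℕ) :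
    (machine D).step n (conf (Sum.inl j) k (Function.update (trail k) k (bit D true)) l a b l 0 0) =
      if 2 ^ k < n then
        conf (Sum.inl ⟨0, by omega⟩) (k + 1 : ℕ) (trail (k + 1 : ℕ)) (l + 1 : ℕ) a b (l + 1) 0 0
      else conf (Sum.inr (Sum.inl (Fin.last _))) k (trail (k + 1)) (l + 1 : ℕ) a b (l + 1) 0 0 := by
  have hK := D.hK
  have hj0 : (j : ℕ) ≠ 0 := by omega
  have hr := address_conf (D := D) (Sum.inl j) k k l a b l 0 0
  split_ifs with hn
  all_goals
    refine step_conf rfl ?_ ?_ ?_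
    · rw [hr]
      simp only [conf]
      rw [dif_neg (by omega)]
      simp [hn]
    · rintro (_ | c | w)
      · simp only [conf, hj]
        rw [if_neg hj0, if_neg (by omega)]
        try rw [← conf, hr]
        simp [hn]
      · simp [conf]
      · simp [conf]
    · rintro (_ | c | w)
      · simp only [conf, hj]
        rw [if_neg hj0, if_neg (by omega)]
        simpa using update_trail k
      · exact update_norm_padded _ _
      · simp [conf]

theorem step_extra {n : ℕ} {j : ℕ} (hj : j + 1 < D.extra + 1) (k : ℤ)
    (A : ℤ → Sym D) (a b l : ℕ) :
    (machine D).step n (conf (Sum.inr (Sum.inl ⟨j + 1, hj⟩)) k A l a b l 0 0) =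
      conf (Sum.inr (Sum.inl ⟨j, by omega⟩)) k A (l + 1 : ℕ) a b (l + 1) 0 0 := by
  refine step_conf rfl ?_ ?_ ?_
  · rfl
  · rintro (_ | c | w)
    · simp [conf]
    · simp [conf]
    · simp [conf]
  · rintro (_ | c | w)
    · simp [conf]
    · exact update_norm_padded _ _
    · simp [conf]

/-- Cell `l` lies just beyond the padding, so only a digit of `a` itself can occupy it. This is the
test that rejects arguments that are too long. -/
theorem padded_eq_blank_iff (a l : ℕ) : padded (D := D) a l l = blank D ↔ a < 2 ^ l := by
  rw [← Nat.size_le, padded]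
  split_ifs with h
  · simp only [bit_ne_blank, false_iff]
    omega
  · simp only [true_iff]
    omega

theorem next_check_none {n : ℕ} (k : ℤ) (A : ℤ → Sym D) (a b l : ℕ)
    (h : ¬ (a < 2 ^ l ∧ (D.useB = true → b < 2 ^ l))) :
    (machine D).next n (conf (Sum.inr (Sum.inl 0)) k A l a b l 0 0) = none := by
  refine if_neg ?_
  simpa [conf, padded_eq_blank_iff] using h

theorem step_check {n : ℕ} (k : ℤ) (A : ℤ → Sym D) (a b l : ℕ)
    (h : a < 2 ^ l ∧ (D.useB = true → b < 2 ^ l)) :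
    (machine D).step n (conf (Sum.inr (Sum.inl 0)) k A l a b l 0 0) =
      conf (Sum.inr (Sum.inr (Sum.inl (D.q0, false, false)))) k A (l - 1) a b l 0 0 := by
  refine step_conf (if_pos ?_) ?_ ?_ ?_
  · simpa [conf, padded_eq_blank_iff] using h
  · rfl
  · rintro (_ | c | w)
    · simp [conf]
    · simp [conf, sub_eq_add_neg]
    · simp [conf]
  · rintro (_ | c | w)
    · simp [conf]
    · simp [conf]
    · simp [conf]

theorem padded_of_lt {a l m : ℕ} (h : m < l) : padded (D := D) a l m = bit D (a.testBit m) := by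
  rw [padded, if_pos (by simp [h])]
  simp

/-- A `0` emitted while the number is still `0` is a leading zero and adds no digit. The machine
suppresses it accordingly, with the help of a flag. -/
theorem size_emitBit (e : Option Bool) (x : ℕ) :
    Nat.size (emitBit e x) = Nat.size x + if e.isSome ∧ (x ≠ 0 ∨ e = some true) then 1 else 0 := by
  rcases e with _ | b
  · simp [emitBit]
  · by_cases h : Nat.bit b x = 0
    · have h1 := h
      rw [Nat.bit_eq_zero_iff] at h1
      obtain ⟨rfl, rfl⟩ := h1
      simp [emitBit]
    · rw [emitBit, Nat.size_bit h]
      have h1 := h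
      rw [Nat.bit_eq_zero_iff] at h1
      rw [if_pos]
      refine ⟨rfl, ?_⟩
      by_cases hx : x = 0
      · right
        simpa [hx] using h1
      · exact Or.inl hx

theorem emitAct_head (e : Option Bool) (x : ℕ) (s : Sym D) :
    -(Nat.size x : ℤ) + ((emitAct (decide (x ≠ 0)) e s).2 : ℤ) = -(Nat.size (emitBit e x) : ℤ) := by
  rw [size_emitBit]
  rcases e with _ | b
  · simp [emitAct]
  · by_cases h : x = 0 <;> cases b <;> simp [emitAct, h]
    all_goals ring

/-- Bits arrive most significant first and are written from right to left. Hence the tape, read to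
the right from the neighbour of the head, always shows the emitted number least significant digit
first, which is the required input format up to a shift. -/
theorem emitAct_cell (e : Option Bool) (x : ℕ) :
    Function.update (fun z : ℤ => (machine D).binaryTape x (z + Nat.size x - 1)) (-(Nat.size x : ℤ))
      (emitAct (decide (x ≠ 0)) e ((machine D).binaryTape x (-(Nat.size x : ℤ) + Nat.size x - 1))).1 =
      fun z : ℤ => (machine D).binaryTape (emitBit e x) (z + Nat.size (emitBit e x) - 1) := by
  by_cases he : e.isSome ∧ (x ≠ 0 ∨ e = some true)
  · have hs := size_emitBit e x
    rw [if_pos he] at hs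
    obtain ⟨he, h1⟩ := he
    obtain ⟨b, rfl⟩ := Option.isSome_iff_exists.1 he
    have h2 : emitAct (D := D) (decide (x ≠ 0)) (some b)
        ((machine D).binaryTape x (-(Nat.size x : ℤ) + Nat.size x - 1)) = (bit D b, -1) := by
      rw [emitAct, if_pos]
      simpa using h1
    rw [h2]
    funext z
    rw [hs]
    by_cases hz : z = -(Nat.size x : ℤ)
    · subst hz
      rw [Function.update_self, RandomAccessTM.binaryTape, if_pos]
      · simp [emitBit]
      · rw [hs]
        push_cast
        omega
    · rw [Function.update_of_ne hz]
      simp only [RandomAccessTM.binaryTape, hs]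
      by_cases hz2 : 0 ≤ z + Nat.size x - 1 ∧ (z + Nat.size x - 1).toNat < Nat.size x
      · rw [if_pos hz2, if_pos (by push_cast; omega)]
        have : (z + (Nat.size x + 1 : ℕ) - 1).toNat = (z + Nat.size x - 1).toNat + 1 := by
          push_cast; omega
        rw [this, emitBit, Nat.testBit_bit_succ]
      · rw [if_neg hz2, if_neg (by push_cast; omega)]
  · have h1 : emitBit e x = x := by
      rcases e with _ | b
      · rfl
      · cases b
        · have : x = 0 := by simpa using he
          simp [emitBit, this]
        · simp at he
    have h2 : ∀ s : Sym D, emitAct (decide (x ≠ 0)) e s = (s, 0) := by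
      intro s
      rcases e with _ | b
      · rfl
      · rw [emitAct, if_neg]
        simpa using he
    rw [h2, h1]
    exact Function.update_eq_self _ _

theorem emit_flag (e : Option Bool) (x : ℕ) :
    (decide (x ≠ 0) || (e == some true)) = decide (emitBit e x ≠ 0) := by
  rcases e with _ | b
  · by_cases h : x = 0 <;> simp [emitBit, h]
  · cases b <;> by_cases h : x = 0 <;> simp [emitBit, h]

theorem trail_eq_blank_iff (k : ℤ) : trail (D := D) (k + 1) k = blank D ↔ k < 0 := by
  unfold trail
  split_ifs with h
  · simp only [bit_ne_blank, false_iff]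
    omega
  · simp only [true_iff]
    omega

theorem workTape_ne : workTape D true ≠ workTape D false := by
  simp [workTape]

theorem step_back {n : ℕ} (q : D.Q) (p : ℤ) (hp : -1 ≤ p) (m a b l x y : ℕ) (hm : m < l) :
    (machine D).step n (conf (Sum.inr (Sum.inr (Sum.inl (q, decide (x ≠ 0), decide (y ≠ 0)))))
        p (trail (p + 1)) m a b l x y) =
      conf (Sum.inr (Sum.inr (Sum.inl ((D.tr q (a.testBit m) (b.testBit m)).1,
          decide (emitBit (D.tr q (a.testBit m) (b.testBit m)).2.1 x ≠ 0),
          decide (emitBit (D.tr q (a.testBit m) (b.testBit m)).2.2 y ≠ 0)))))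
        (max (p - 1) (-1)) (trail (max (p - 1) (-1) + 1)) (m - 1) a b l
        (emitBit (D.tr q (a.testBit m) (b.testBit m)).2.1 x)
        (emitBit (D.tr q (a.testBit m) (b.testBit m)).2.2 y) := by
  classical
  have hbit : ∀ c : ℕ, decide (padded (D := D) c l m = bit D true) = c.testBit m := by
    intro c
    rw [padded_of_lt hm]
    cases c.testBit m
    · simp [(bit_injective D).eq_iff]
    · simp
  have hne := (workTape_ne (D := D))
  refine step_conf (if_neg ?_) ?_ ?_ ?_
  · simp [conf, padded_of_lt hm, bit_ne_blank]
  · simp only [conf, hbit, emit_flag]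
    simp
  · rintro (_ | c | w)
    · simp only [conf, trail_eq_blank_iff]
      split_ifs <;> simp <;> omega
    · simp [conf, sub_eq_add_neg]
    · by_cases h1 : w = workTape D false
      · subst h1
        simp only [conf, if_true, hbit, if_false, Bool.false_eq_true, emitAct_head]
      · by_cases h2 : w = workTape D true
        · subst h2
          simp only [conf, hne, if_true, hbit, if_false, Bool.false_eq_true, emitAct_head]
        · simp [conf, h1, h2]
  · rintro (_ | c | w)
    · simp only [conf, trail_eq_blank_iff]
      funext z
      by_cases hz : z = p
      · subst hz
        rw [Function.update_self]
        split_ifs <;> rw [trail, if_neg (by omega)]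
      · rw [Function.update_of_ne hz]
        unfold trail
        congr 1
        simp only [eq_iff_iff]
        omega
    · simp [conf]
    · by_cases h1 : w = workTape D false
      · subst h1
        simp only [conf, if_true, hbit, if_false, Bool.false_eq_true, emitAct_cell]
      · by_cases h2 : w = workTape D true
        · subst h2
          simp only [conf, hne, if_true, hbit, if_false, Bool.false_eq_true, emitAct_cell]
        · simp [conf, h1, h2]

/-- The shift of the tapes of the machine that is started after the scan. -/
def shift (i : D.ι) (x y : ℕ) : (D.M i).Tape → ℤ
  | some (Sum.inl false) => 1 - Nat.size x
  | some (Sum.inl true) => 1 - Nat.size y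
  | _ => 0

theorem sim_step_start {n : ℕ} (q : D.Q) (fx fy : Bool) (a b l x y : ℕ) :
    Sim (D.out q) (shift (D.out q) x y) ((D.M (D.out q)).init x y)
      ((machine D).step n (conf (Sum.inr (Sum.inr (Sum.inl (q, fx, fy)))) (-1) (trail 0) (-1) a b l
        x y)) := by
  have hne := (workTape_ne (D := D))
  have hnext : (machine D).next n (conf (Sum.inr (Sum.inr (Sum.inl (q, fx, fy)))) (-1) (trail 0) (-1)
      a b l x y) = some _ := if_pos (by simp [conf, padded])
  have hbin : ∀ x : ℕ, ∀ z : ℤ, (machine D).binaryTape x z =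
      lift (D.out q) ((D.M (D.out q)).binaryTape x z) := by
    intro x z
    unfold RandomAccessTM.binaryTape
    split_ifs
    · rw [lift_bit]
    · rw [lift_blank]
  refine ⟨?_, ?_, ?_⟩
  · simp only [RandomAccessTM.step, hnext]
    rfl
  · intro t
    simp only [RandomAccessTM.step, hnext]
    rcases t with _ | c | w
    · simp [emb, conf, shift, RandomAccessTM.init]
    · cases c
      · simp [emb, conf, shift, RandomAccessTM.init]
        ring
      · simp [emb, conf, shift, hne, RandomAccessTM.init]
        ring
    · simp [emb, conf, shift, RandomAccessTM.init, workTape]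
  · intro t z
    have hcell : ∀ t, ((machine D).step n (conf (Sum.inr (Sum.inr (Sum.inl (q, fx, fy)))) (-1)
        (trail 0) (-1) a b l x y)).cell t = (conf (Sum.inr (Sum.inr (Sum.inl (q, fx, fy)))) (-1)
        (trail 0) (-1) a b l x y).cell t := by
      intro t
      simp only [RandomAccessTM.step, hnext]
      rcases t with _ | _ | _ <;> exact Function.update_eq_self _ _
    rw [hcell]
    rcases t with _ | c | w
    · have : ¬ (0 ≤ z ∧ z < 0) := by omega
      simp only [emb, conf, shift, RandomAccessTM.init, lift_blank, trail, add_zero, if_neg this]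
    · cases c
      · simp only [emb, conf, shift, RandomAccessTM.init, ← hbin, if_true]
        congr 1
        ring
      · simp only [emb, conf, shift, hne, RandomAccessTM.init, ← hbin, if_true, if_false]
        congr 1
        ring
    · simp [emb, conf, shift, RandomAccessTM.init, workTape, lift_blank]

/-! ### The phases of a run and their running time -/

theorem iterate_block (n : ℕ) (k a b l : ℕ) (h0 : 0 < D.K) :
    ((machine D).step n)^[D.K] (conf (Sum.inl ⟨0, h0⟩) k (trail k) l a b l 0 0) =
      if 2 ^ k < n then
        conf (Sum.inl ⟨0, h0⟩) (k + 1 : ℕ) (trail (k + 1 : ℕ)) (l + D.K : ℕ) a b (l + D.K) 0 0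
      else conf (Sum.inr (Sum.inl (Fin.last _))) k (trail (k + 1)) (l + D.K : ℕ) a b (l + D.K)
        0 0 := by
  have hK := D.hK
  have key : ∀ j : ℕ, ∀ hj : j + 1 < D.K,
      ((machine D).step n)^[j + 1] (conf (Sum.inl ⟨0, h0⟩) k (trail k) l a b l 0 0) =
        conf (Sum.inl ⟨j + 1, hj⟩) k (Function.update (trail k) k (bit D true)) (l + (j + 1) : ℕ)
          a b (l + (j + 1)) 0 0 := by
    intro j
    induction j with
    | zero =>
      intro hj
      exact step_block_first rfl _ _ _ _
    | succ j ih =>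
      intro hj
      rw [Function.iterate_succ_apply', ih (by omega), step_block_middle (by simp) hj]
      rfl
  obtain ⟨j, hj⟩ : ∃ j, D.K = j + 2 := ⟨D.K - 2, by omega⟩
  have h1 := key j (by omega)
  have h2 : ((machine D).step n)^[D.K] (conf (Sum.inl ⟨0, h0⟩) k (trail k) l a b l 0 0) =
      (machine D).step n (((machine D).step n)^[j + 1]
        (conf (Sum.inl ⟨0, h0⟩) k (trail k) l a b l 0 0)) := by
    rw [← Function.iterate_succ_apply' ((machine D).step n)]
    exact congrArg (fun t => ((machine D).step n)^[t] _) hj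
  have h3 : l + D.K = l + (j + 1) + 1 := by omega
  rw [h2, h1, step_block_last (by simp [hj]), h3]

/-- Block `k` is followed by another one exactly if `2 ^ k < n`, that is, `k < Nat.clog 2 n`. So
`blk n` blocks are run, which measures out `D.K * blk n` cells without any arithmetic. -/
theorem iterate_blocks (n a b : ℕ) (h0 : 0 < D.K) (d : ℕ) : ∀ k l : ℕ, k + d = Nat.clog 2 n →
    ((machine D).step n)^[D.K * (d + 1)] (conf (Sum.inl ⟨0, h0⟩) k (trail k) l a b l 0 0) =
      conf (Sum.inr (Sum.inl (Fin.last _))) (Nat.clog 2 n) (trail (Nat.clog 2 n + 1))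
        (l + D.K * (d + 1) : ℕ) a b (l + D.K * (d + 1)) 0 0 := by
  induction d with
  | zero =>
    intro k l hk
    rw [zero_add, mul_one, iterate_block, if_neg, ← hk]
    · rfl
    · rw [← Nat.lt_clog_iff_pow_lt one_lt_two]
      omega
  | succ d ih =>
    intro k l hk
    rw [Nat.mul_succ, Function.iterate_add_apply, iterate_block, if_pos, ih _ _ (by omega)]
    · rw [add_assoc, add_comm D.K]
    · rw [← Nat.lt_clog_iff_pow_lt one_lt_two]
      omega

theorem iterate_extra (n a b : ℕ) (k : ℤ) (A : ℤ → Sym D) (j : ℕ) : ∀ (hj : j < D.extra + 1) (l : ℕ),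
    ((machine D).step n)^[j] (conf (Sum.inr (Sum.inl ⟨j, hj⟩)) k A l a b l 0 0) =
      conf (Sum.inr (Sum.inl 0)) k A (l + j : ℕ) a b (l + j) 0 0 := by
  induction j with
  | zero => intro hj l; rfl
  | succ j ih =>
    intro hj l
    rw [Function.iterate_succ_apply, step_extra, ih]
    rw [add_assoc, add_comm 1]

theorem iterate_back (n a b l : ℕ) (m : ℕ) : ∀ (q : D.Q) (p : ℤ) (x y : ℕ), -1 ≤ p → m ≤ l →
    ((machine D).step n)^[m] (conf (Sum.inr (Sum.inr (Sum.inl (q, decide (x ≠ 0), decide (y ≠ 0)))))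
        p (trail (p + 1)) (m - 1) a b l x y) =
      conf (Sum.inr (Sum.inr (Sum.inl ((bitScan D.tr a b m (q, x, y)).1,
        decide ((bitScan D.tr a b m (q, x, y)).2.1 ≠ 0),
        decide ((bitScan D.tr a b m (q, x, y)).2.2 ≠ 0)))))
        (max (p - m) (-1)) (trail (max (p - m) (-1) + 1)) (-1) a b l
        (bitScan D.tr a b m (q, x, y)).2.1 (bitScan D.tr a b m (q, x, y)).2.2 := by
  induction m with
  | zero =>
    intro q p x y hp _
    have : max (p - (0 : ℕ)) (-1) = p := by simp [hp]
    rw [this]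
    simp only [bitScan, Nat.cast_zero, zero_sub]
    rfl
  | succ m ih =>
    intro q p x y hp hm
    have h1 : ((m + 1 : ℕ) : ℤ) - 1 = m := by push_cast; ring
    have h2 : max (max (p - 1) (-1) - m) (-1) = max (p - (m + 1 : ℕ)) (-1) := by push_cast; omega
    rw [Function.iterate_succ_apply, h1, step_back q p hp m a b l x y (by omega),
      ih _ _ _ _ (le_max_right _ _) (by omega), h2]
    rfl

/-- With `L = D.K * blk n + D.extra`, the run takes `L` steps for padding, one for turning round,
`L` for reading back, one for starting the call and `c * (Nat.size n + 1)` for the call; `L ≤ (D.K +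
D.extra) * (Nat.size n + 1)` gives the time bound. Halted configurations are fixed, so surplus steps
are harmless. -/
theorem machine_decides (S : D.ι → ℕ → ℕ → ℕ → Prop) (c : ℕ)
    (hS : ∀ i n a b, (D.M i).next n (((D.M i).step n)^[c * (Nat.size n + 1)] ((D.M i).init a b)) = none ∧
      ((((D.M i).step n)^[c * (Nat.size n + 1)] ((D.M i).init a b)).state ∈ (D.M i).accepting ↔
        S i n a b)) (n a b : ℕ) :
    let final := ((machine D).step n)^[(2 * (D.K + D.extra) + 2 + c) * (Nat.size n + 1)]
      ((machine D).init a b)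
    let r := bitScan D.tr a b (D.K * blk n + D.extra) (D.q0, 0, 0)
    (machine D).next n final = none ∧ (final.state ∈ (machine D).accepting ↔
      a < 2 ^ (D.K * blk n + D.extra) ∧ (D.useB = true → b < 2 ^ (D.K * blk n + D.extra)) ∧
        S (D.out r.1) n r.2.1 r.2.2) := by
  intro final r
  set L := D.K * blk n + D.extra with hL
  have h0 : 0 < D.K := by have := D.hK; omega
  have hblk : blk n ≤ Nat.size n + 1 := by
    unfold blk
    have : Nat.clog 2 n ≤ Nat.size n := Nat.clog_le_of_le_pow (Nat.lt_size_self n).le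
    omega
  have hblk1 : 1 ≤ blk n := by unfold blk; omega
  have hLle : L ≤ (D.K + D.extra) * (Nat.size n + 1) := by
    calc L ≤ (D.K + D.extra) * blk n := by rw [hL]; nlinarith
      _ ≤ _ := Nat.mul_le_mul_left _ hblk
  have hphase : ((machine D).step n)^[L] ((machine D).init a b) =
      conf (Sum.inr (Sum.inl 0)) (Nat.clog 2 n) (trail (Nat.clog 2 n + 1)) L a b L 0 0 := by
    have h1 := iterate_blocks n a b h0 (Nat.clog 2 n) 0 0 (zero_add _)
    have h2 := iterate_extra n a b (Nat.clog 2 n) (trail (D := D) (Nat.clog 2 n + 1)) D.extra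
      (by omega) (0 + D.K * (Nat.clog 2 n + 1))
    rw [hL, add_comm, Function.iterate_add_apply, init_eq_conf]
    unfold blk
    erw [h1, h2]
    have h3 : 0 + D.K * (Nat.clog 2 n + 1) + D.extra = D.extra + D.K * (Nat.clog 2 n + 1) := by ring
    rw [h3]
  have hT : ∀ t c', ((machine D).step n)^[t] ((machine D).init a b) = c' →
      (machine D).next n c' = none → t ≤ (2 * (D.K + D.extra) + 2 + c) * (Nat.size n + 1) →
      final = c' := by
    intro t c' h1 h2 h3
    obtain ⟨s, hs⟩ := Nat.exists_eq_add_of_le h3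
    change ((machine D).step n)^[_] _ = _
    rw [hs, add_comm, Function.iterate_add_apply, h1, iterate_step_of_next_none h2]
  by_cases hab : a < 2 ^ L ∧ (D.useB = true → b < 2 ^ L)
  · have hcheck : ((machine D).step n)^[L + 1] ((machine D).init a b) =
        conf (Sum.inr (Sum.inr (Sum.inl (D.q0, false, false)))) (Nat.clog 2 n)
          (trail (Nat.clog 2 n + 1)) (L - 1) a b L 0 0 := by
      rw [Function.iterate_succ_apply', hphase, step_check _ _ _ _ _ hab]
    have hback : ((machine D).step n)^[L + (L + 1)] ((machine D).init a b) =
        conf (Sum.inr (Sum.inr (Sum.inl (r.1, decide (r.2.1 ≠ 0), decide (r.2.2 ≠ 0)))))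
          (-1) (trail 0) (-1) a b L r.2.1 r.2.2 := by
      have h1 := iterate_back n a b L L D.q0 (Nat.clog 2 n) 0 0 (by omega) le_rfl
      have h2 : max ((Nat.clog 2 n : ℤ) - L) (-1) = -1 := by
        have : Nat.clog 2 n + 1 ≤ L := by
          rw [hL]
          unfold blk
          nlinarith
        omega
      rw [Function.iterate_add_apply, hcheck]
      rw [h2] at h1
      simpa using h1
    have hsim := sim_step_start (n := n) r.1 (decide (r.2.1 ≠ 0)) (decide (r.2.2 ≠ 0)) a b L r.2.1 r.2.2
    rw [← hback, ← Function.iterate_succ_apply' ((machine D).step n)] at hsim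
    have hsim2 := hsim.iterate rfl n (c * (Nat.size n + 1))
    rw [← Function.iterate_add_apply] at hsim2
    obtain ⟨hn, hacc⟩ := hS (D.out r.1) n r.2.1 r.2.2
    have hnext := hsim2.next rfl n
    rw [hn, Option.map_none] at hnext
    have hfin := hT _ _ rfl hnext (by nlinarith)
    rw [hfin]
    refine ⟨hnext, ?_⟩
    rw [← hacc]
    rw [and_iff_right hab.1, and_iff_right hab.2]
    rw [mem_accepting, hsim2.state]
    constructor
    · rintro ⟨i, s, h1, h2⟩
      simp only [Sum.inr.injEq, Sigma.mk.injEq] at h1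
      obtain ⟨rfl, h1⟩ := h1
      rw [heq_eq_eq] at h1
      rw [h1]
      exact h2
    · intro h
      exact ⟨_, _, rfl, h⟩
  · have hnone := next_check_none (D := D) (n := n) (Nat.clog 2 n) (trail (Nat.clog 2 n + 1)) a b L hab
    have hfin := hT L _ hphase hnone (by nlinarith)
    rw [hfin]
    refine ⟨hnone, ?_⟩
    constructor
    · rintro ⟨i, s, h1, -⟩
      simp [conf] at h1
    · rintro ⟨h1, h2, -⟩
      exact absurd ⟨h1, h2⟩ hab

end ScanMachine

/-- Relations that are decided by scanning the arguments and then calling one of finitely many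
relations on the emitted numbers. -/
theorem DLogTime.scan {ι Q : Type} [Finite ι] [Finite Q] {S : ι → ℕ → ℕ → ℕ → Prop}
    (hS : ∀ i, DLogTime (S i)) (tr : Q → Bool → Bool → Q × Option Bool × Option Bool) (q0 : Q)
    (out : Q → ι) (K : ℕ) (hK : 2 ≤ K) (extra : ℕ) (useB : Bool) :
    DLogTime fun n a b => a < 2 ^ (K * blk n + extra) ∧ (useB = true → b < 2 ^ (K * blk n + extra)) ∧
      S (out (bitScan tr a b (K * blk n + extra) (q0, 0, 0)).1) n
        (bitScan tr a b (K * blk n + extra) (q0, 0, 0)).2.1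
        (bitScan tr a b (K * blk n + extra) (q0, 0, 0)).2.2 := by
  choose M c hM using hS
  obtain ⟨w, hw⟩ : ∃ w, ∀ i, (M i).numWork + 2 ≤ w := by
    obtain ⟨w, hw⟩ := (Set.finite_range fun i => (M i).numWork + 2).bddAbove
    exact ⟨w, fun i => hw ⟨i, rfl⟩⟩
  obtain ⟨C, hC⟩ : ∃ C, ∀ i, c i ≤ C := by
    obtain ⟨w, hw⟩ := (Set.finite_range c).bddAbove
    exact ⟨w, fun i => hw ⟨i, rfl⟩⟩
  let D : ScanMachine.Data := ⟨ι, inferInstance, M, Q, inferInstance, q0, tr, out, K, hK, extra, useB,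
    w, hw⟩
  refine ⟨ScanMachine.machine D, _, fun n a b => ScanMachine.machine_decides (D := D) S C ?_ n a b⟩
  intro i n a b
  obtain ⟨h1, h2⟩ := hM i n a b
  have : ((M i).step n)^[C * (Nat.size n + 1)] ((M i).init a b) =
      ((M i).step n)^[c i * (Nat.size n + 1)] ((M i).init a b) := by
    obtain ⟨s, hs⟩ := Nat.exists_eq_add_of_le (Nat.mul_le_mul_right (Nat.size n + 1) (hC i))
    rw [hs, add_comm, Function.iterate_add_apply, ScanMachine.iterate_step_of_next_none h1]
  change (M i).next n (((M i).step n)^[C * (Nat.size n + 1)] ((M i).init a b)) = none ∧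
    ((((M i).step n)^[C * (Nat.size n + 1)] ((M i).init a b)).state ∈ (M i).accepting ↔ S i n a b)
  rw [this]
  exact ⟨h1, h2⟩

/-! ### Complements and constant relations -/

/-- A machine with a different set of accepting states. -/
abbrev RandomAccessTM.withAccepting (M : RandomAccessTM) (A : Set M.State) : RandomAccessTM :=
  { M with accepting := A }

theorem RandomAccessTM.iterate_step_withAccepting (M : RandomAccessTM) (A : Set M.State) (n t : ℕ) :
    ∀ c : M.Cfg, ((M.withAccepting A).step n)^[t] ⟨c.state, c.head, c.cell⟩ =
      ⟨((M.step n)^[t] c).state, ((M.step n)^[t] c).head, ((M.step n)^[t] c).cell⟩ := by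
  induction t with
  | zero => intro c; rfl
  | succ t ih =>
    intro c
    have h : (M.withAccepting A).step n ⟨c.state, c.head, c.cell⟩ =
        ⟨(M.step n c).state, (M.step n c).head, (M.step n c).cell⟩ := by
      have h1 : (M.withAccepting A).next n ⟨c.state, c.head, c.cell⟩ = M.next n c := rfl
      unfold RandomAccessTM.step
      rw [h1]
      rcases M.next n c with _ | _ <;> rfl
    rw [Function.iterate_succ_apply, h, ih]
    rfl

/-- Every run halts within the time bound, whatever the answer is, so complementing the set of
accepting states complements the relation. -/
theorem DLogTime.not {R : ℕ → ℕ → ℕ → Prop} (h : DLogTime R) : DLogTime fun n a b => ¬ R n a b := by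
  obtain ⟨M, c, hM⟩ := h
  refine ⟨M.withAccepting M.acceptingᶜ, c, fun n a b => ?_⟩
  obtain ⟨h1, h2⟩ := hM n a b
  have h3 := M.iterate_step_withAccepting M.acceptingᶜ n (c * (Nat.size n + 1)) (M.init a b)
  have h4 : (M.withAccepting M.acceptingᶜ).init a b =
      ⟨(M.init a b).state, (M.init a b).head, (M.init a b).cell⟩ := by
    apply ScanMachine.cfg_ext
    · rfl
    · intro t; rfl
    · rintro (_ | (_ | _) | w) <;> rfl
  rw [h4, h3]
  exact ⟨h1, not_congr h2⟩

theorem mod_two_pow_succ (x k : ℕ) : x % 2 ^ (k + 1) = x % 2 ^ k + 2 ^ k * (x.testBit k).toNat := by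
  rw [Nat.mod_pow_succ, Nat.toNat_testBit]

theorem DLogTime.congr {R R' : ℕ → ℕ → ℕ → Prop} (h : DLogTime R) (hR : ∀ n a b, R n a b ↔ R' n a b) :
    DLogTime R' := by
  have : R = R' := by
    funext n a b
    exact propext (hR n a b)
  exact this ▸ h

theorem DLogTime.true : DLogTime fun _ _ _ => True := by
  let M : RandomAccessTM :=
    { State := Unit
      Symbol := Option Bool
      finiteState := inferInstance
      finiteSymbol := inferInstance
      numWork := 0
      start := ()
      accepting := Set.univ
      blank := none
      bit := some
      bit_injective := Option.some_injective _
      bit_ne_blank := fun _ => Option.some_ne_none _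
      trans := fun _ _ _ => none }
  exact ⟨M, 0, fun n a b => ⟨rfl, by simp [M]⟩⟩

theorem DLogTime.false : DLogTime fun _ _ _ => False :=
  DLogTime.true.not.congr fun _ _ _ => by simp

/-- Trivial relations to be called after a scan whose final state already determines the answer. -/
theorem DLogTime.const (p : Prop) : DLogTime fun _ _ _ => p := by
  by_cases h : p
  · exact DLogTime.true.congr fun _ _ _ => by simp [h]
  · exact DLogTime.false.congr fun _ _ _ => by simp [h]

/-! ### Comparison of two arguments with each other and with `n` -/

namespace EqLtMachine

/-- The states of the machine: comparing digits, testing whether the number read so far with an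
additional leading digit is below the length of the random access tape, and accepting. -/
inductive St
  | loop | test | yes

instance : Finite St := Finite.of_injective (β := Fin 3)
  (fun s => match s with | .loop => 0 | .test => 1 | .yes => 2)
  (by intro a b; cases a <;> cases b <;> simp)

/-- A machine that decides whether the arguments are equal and less than the length of the random
access tape. -/
abbrev machine : RandomAccessTM where
  State := St
  Symbol := Option Bool
  finiteState := inferInstance
  finiteSymbol := inferInstance
  numWork := 0
  start := St.loop
  accepting := {St.yes}
  blank := none
  bit := some
  bit_injective := Option.some_injective _
  bit_ne_blank := fun _ => Option.some_ne_none _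
  trans := fun q r s => match q with
    | .loop =>
      if s (some (Sum.inl false)) = none then
        if s (some (Sum.inl true)) = none ∧ r = true then some (.yes, fun t => (s t, 0)) else none
      else if s (some (Sum.inl false)) = s (some (Sum.inl true)) then
        some (.test, fun t => match t with
          | none => (some true, 0)
          | some t => (s (some t), 0))
      else none
    | .test =>
      if r = true then
        some (.loop, fun t => match t with
          | none => (s (some (Sum.inl false)), 1)
          | some t => (s (some t), 1))
      else none
    | .yes => none

/-- The address tape holds the lowest `k` digits of `a`. -/
def low (a k : ℕ) (z : ℤ) : Option Bool :=
  if 0 ≤ z ∧ z < k then some (a.testBit z.toNat) else none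

def conf (q : St) (a b : ℕ) (k : ℕ) (A : ℤ → Option Bool) : machine.Cfg where
  state := q
  head := fun _ => k
  cell := fun t => match t with
    | none => A
    | some (Sum.inl false) => machine.binaryTape a
    | some (Sum.inl true) => machine.binaryTape b
    | some (Sum.inr w) => w.elim0

theorem sum_testBit (a k : ℕ) :
    ∑ i ∈ Finset.range k, (if a.testBit i = true then 2 ^ i else 0) = a % 2 ^ k := by
  induction k with
  | zero => simp [Nat.mod_one]
  | succ k ih =>
    rw [Finset.sum_range_succ, ih, mod_two_pow_succ]
    cases a.testBit k <;> simp

theorem address_low (q : St) (a b k : ℕ) : machine.address (conf q a b k (low a k)) = a % 2 ^ k := by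
  rw [← sum_testBit]
  unfold RandomAccessTM.address
  rw [finsum_eq_sum_of_support_subset (s := Finset.range k)]
  · refine Finset.sum_congr rfl fun i hi => ?_
    rw [Finset.mem_range] at hi
    simp [conf, low, machine, hi]
  · intro i hi
    by_contra h
    refine hi (if_neg ?_)
    simp only [Finset.coe_range, Set.mem_Iio] at h
    simp [conf, low, h]

theorem address_update (q : St) (a b k : ℕ) :
    machine.address (conf q a b k (Function.update (low a k) k (some true))) = a % 2 ^ k + 2 ^ k := by
  rw [← sum_testBit]
  unfold RandomAccessTM.address
  rw [finsum_eq_sum_of_support_subset (s := Finset.range (k + 1)), Finset.sum_range_succ]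
  · congr 1
    · refine Finset.sum_congr rfl fun i hi => ?_
      rw [Finset.mem_range] at hi
      have : i ≠ k := by omega
      simp [conf, low, machine, hi, this]
    · simp [conf, machine]
  · intro i hi
    by_contra h
    have h1 : i ≠ k := by
      rintro rfl
      simp at h
    refine hi (if_neg ?_)
    simp only [Finset.coe_range, Set.mem_Iio] at h
    simp [conf, low, h1]
    omega

theorem binaryTape_nat (a k : ℕ) :
    machine.binaryTape a (k : ℤ) = if k < Nat.size a then some (a.testBit k) else none := by
  simp [RandomAccessTM.binaryTape, machine]

theorem init_eq (a b : ℕ) : machine.init a b = conf .loop a b 0 (low a 0) := by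
  apply ScanMachine.cfg_ext
  · rfl
  · intro t; rfl
  · rintro (_ | (_ | _) | w)
    · funext z
      have : ¬ (0 ≤ z ∧ z < (0 : ℕ)) := by omega
      simp only [conf, low, if_neg this]
      rfl
    · rfl
    · rfl
    · exact w.elim0

theorem mod_succ_eq {a b k : ℕ} (h : a % 2 ^ k = b % 2 ^ k) (h1 : a.testBit k = b.testBit k) :
    a % 2 ^ (k + 1) = b % 2 ^ (k + 1) := by
  rw [mod_two_pow_succ, mod_two_pow_succ, h, h1]

/-- The address tape collects the digits of `a`, and before digit `k` is accepted the address `a % 2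
^ k + 2 ^ k` is tested. This bounds the number of rounds by `Nat.clog 2 n`, however long `a` is.
When both numbers are exhausted the address is `a` itself, and the random access tape answers
whether `a < n`. A round takes two steps. -/
theorem halts (n a b d : ℕ) : ∀ k, k + d = Nat.clog 2 n → k ≤ Nat.size a → a % 2 ^ k = b % 2 ^ k →
    ∃ t ≤ 2 * d + 2, machine.next n ((machine.step n)^[t] (conf .loop a b k (low a k))) = none ∧
      (((machine.step n)^[t] (conf .loop a b k (low a k))).state = .yes ↔ a < n ∧ a = b) := by
  induction d using Nat.strong_induction_on with
  | _ d ih =>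
  intro k hk hka hab
  have hnext : machine.next n (conf .loop a b k (low a k)) = machine.trans .loop
      (decide (a % 2 ^ k < n)) (fun t => (conf .loop a b k (low a k)).cell t k) := by
    unfold RandomAccessTM.next
    rw [address_low]
    rfl
  have hA : (conf .loop a b k (low a k)).cell (some (Sum.inl false)) k =
    if k < Nat.size a then some (a.testBit k) else none := binaryTape_nat a k
  have hB : (conf .loop a b k (low a k)).cell (some (Sum.inl true)) k =
    if k < Nat.size b then some (b.testBit k) else none := binaryTape_nat b k
  by_cases h1 : k < Nat.size a
  · rw [if_pos h1] at hA
    by_cases h2 : k < Nat.size b ∧ a.testBit k = b.testBit k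
    · rw [if_pos h2.1, ← h2.2] at hB
      have h3 : machine.step n (conf .loop a b k (low a k)) =
          conf .test a b k (Function.update (low a k) k (some true)) := by
        have h4 : machine.next n (conf .loop a b k (low a k)) = some (.test, fun t => match t with
          | none => (some true, 0)
          | some t => ((conf .loop a b k (low a k)).cell (some t) k, 0)) := by
          rw [hnext]
          simp only [machine]
          erw [hA, hB]
          rw [if_neg (by simp), if_pos rfl]
          congr 2
        apply ScanMachine.cfg_ext
        · simp only [RandomAccessTM.step, h4]
          rfl
        · intro t
          simp only [RandomAccessTM.step, h4]
          rcases t with _ | _ <;> simp [conf]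
        · intro t
          simp only [RandomAccessTM.step, h4]
          rcases t with _ | (_ | _) | w
          · simp [conf]
          · exact Function.update_eq_self _ _
          · exact Function.update_eq_self _ _
          · exact w.elim0
      have hnext2 : machine.next n (conf .test a b k (Function.update (low a k) k (some true))) =
          machine.trans .test (decide (a % 2 ^ k + 2 ^ k < n)) (fun t =>
            (conf .test a b k (Function.update (low a k) k (some true))).cell t k) := by
        unfold RandomAccessTM.next
        rw [address_update]
        rfl
      by_cases h5 : a % 2 ^ k + 2 ^ k < n
      · have h6 : machine.step n (conf .test a b k (Function.update (low a k) k (some true))) =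
            conf .loop a b (k + 1) (low a (k + 1)) := by
          have h4 : machine.next n (conf .test a b k (Function.update (low a k) k (some true))) =
            some (.loop, fun t => match t with
            | none => (some (a.testBit k), 1)
            | some t => ((conf .loop a b k (low a k)).cell (some t) k, 1)) := by
            rw [hnext2]
            simp only [machine, h5, decide_true, if_true]
            rw [← hA]
            congr 2
            funext t
            rcases t with _ | (_ | _) | w
            · rfl
            · rfl
            · rfl
            · exact w.elim0
          apply ScanMachine.cfg_ext
          · simp only [RandomAccessTM.step, h4]
            rfl
          · intro t
            simp only [RandomAccessTM.step, h4]
            rcases t with _ | _ <;> simp [conf]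
          · intro t
            simp only [RandomAccessTM.step, h4]
            rcases t with _ | (_ | _) | w
            · simp only [conf, Function.update_idem]
              funext z
              by_cases hz : z = k
              · subst hz
                simp [low]
              · rw [Function.update_of_ne hz]
                unfold low
                congr 1
                simp only [eq_iff_iff]
                push_cast
                omega
            · exact Function.update_eq_self _ _
            · exact Function.update_eq_self _ _
            · exact w.elim0
        have h7 : k < Nat.clog 2 n := by
          rw [Nat.lt_clog_iff_pow_lt one_lt_two]
          omega
        obtain ⟨t, ht, h8, h9⟩ := ih (d - 1) (by omega) (k + 1) (by omega) h1 (mod_succ_eq hab h2.2)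
        refine ⟨t + 2, by omega, ?_⟩
        rw [Function.iterate_add_apply]
        have : (machine.step n)^[2] (conf .loop a b k (low a k)) =
          conf .loop a b (k + 1) (low a (k + 1)) := by
          rw [← h6, ← h3]
          rfl
        rw [this]
        exact ⟨h8, h9⟩
      · refine ⟨1, by omega, ?_⟩
        rw [Function.iterate_one, h3, hnext2]
        constructor
        · simp [machine, h5]
        · constructor
          · intro h; cases h
          · intro h
            -- Since `a` still has a digit at position `k` or above, `a ≥ a % 2 ^ k + 2 ^ k ≥ n`.
            have h6 : 1 ≤ a / 2 ^ k := by
              rw [Nat.le_div_iff_mul_le (by positivity), one_mul]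
              by_contra h7
              rw [not_le, ← Nat.size_le] at h7
              omega
            have h7 := Nat.mod_add_div a (2 ^ k)
            nlinarith [Nat.two_pow_pos k]
    · have hne : ¬ a = b := by
        rintro rfl
        exact h2 ⟨h1, rfl⟩
      refine ⟨0, by omega, ?_⟩
      rw [Function.iterate_zero, id, hnext]
      constructor
      · simp only [machine]
        erw [hA, hB]
        rw [if_neg (by simp), if_neg]
        split_ifs with h3
        · intro h4
          exact h2 ⟨h3, by simpa using h4⟩
        · simp
      · constructor
        · intro h; cases h
        · intro h; exact absurd h.2 hne
  · rw [if_neg h1] at hA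
    have hk' : k = Nat.size a := by omega
    have ha : a % 2 ^ k = a := Nat.mod_eq_of_lt (Nat.size_le.1 (by omega))
    rw [ha] at hnext
    by_cases h2 : k < Nat.size b
    · rw [if_pos h2] at hB
      refine ⟨0, by omega, ?_⟩
      rw [Function.iterate_zero, id, hnext]
      constructor
      · simp only [machine]
        erw [hA, hB]
        simp
      · constructor
        · intro h; cases h
        · rintro ⟨-, rfl⟩
          omega
    · rw [if_neg h2] at hB
      have hb : b % 2 ^ k = b := Nat.mod_eq_of_lt (Nat.size_le.1 (by omega))
      have hab' : a = b := by rw [← ha, hab, hb]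
      by_cases h3 : a < n
      · have h4 : machine.next n (conf .loop a b k (low a k)) = some (.yes, fun t =>
            ((conf .loop a b k (low a k)).cell t k, 0)) := by
          rw [hnext]
          simp only [machine]
          erw [hA, hB]
          simp [h3]
        refine ⟨1, by omega, ?_⟩
        rw [Function.iterate_one]
        have h5 : (machine.step n (conf .loop a b k (low a k))).state = .yes := by
          simp only [RandomAccessTM.step, h4]
        constructor
        · unfold RandomAccessTM.next
          rw [h5]
        · simp only [h5, true_iff]
          exact ⟨h3, hab'⟩
      · refine ⟨0, by omega, ?_⟩
        rw [Function.iterate_zero, id, hnext]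
        constructor
        · simp only [machine]
          erw [hA, hB]
          simp [h3]
        · constructor
          · intro h; cases h
          · intro h; exact absurd h.1 h3

end EqLtMachine

/-- This is needed for the input gates: finite automata cannot compare a number with `n` itself,
which is accessible only through the random access tape. -/
theorem DLogTime.lt_and_eq : DLogTime fun n a b => a < n ∧ a = b := by
  refine ⟨EqLtMachine.machine, 2, fun n a b => ?_⟩
  obtain ⟨t, ht, h1, h2⟩ := EqLtMachine.halts n a b (Nat.clog 2 n) 0 (zero_add _) (Nat.zero_le _)
    (by simp [Nat.mod_one])
  rw [← EqLtMachine.init_eq] at h1 h2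
  have h3 : Nat.clog 2 n ≤ Nat.size n := Nat.clog_le_of_le_pow (Nat.lt_size_self n).le
  obtain ⟨s, hs⟩ := Nat.exists_eq_add_of_le (show t ≤ 2 * (Nat.size n + 1) by omega)
  rw [hs, add_comm, Function.iterate_add_apply, ScanMachine.iterate_step_of_next_none h1]
  exact ⟨h1, h2⟩

theorem bit_testBit_div (x i : ℕ) : Nat.bit (x.testBit i) (x / 2 ^ (i + 1)) = x / 2 ^ i := by
  rw [pow_succ, ← Nat.div_div_eq_div_mul]
  conv_rhs => rw [← Nat.bit_bodd_div2 (x / 2 ^ i)]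
  rw [Nat.div2_val]
  congr 1
  rw [Nat.testBit_eq_decide_div_mod_eq, Nat.bodd_eq_one_and_ne_zero]
  exact Bool.eq_iff_iff.2 (by simp)

/-- Relations between numbers of logarithmic length that a finite automaton decides, reading the digits
in lockstep. -/
theorem DLogTime.automaton {Q : Type} [Finite Q] (Φ : ℕ → ℕ → Q) (δ : Q → Bool → Bool → Q)
    (hΦ : ∀ a b x y, Φ (Nat.bit x a) (Nat.bit y b) = δ (Φ a b) x y) (A : Q → Prop) {K : ℕ}
    (hK : 2 ≤ K) :
    DLogTime fun n a b => a < 2 ^ (K * blk n) ∧ b < 2 ^ (K * blk n) ∧ A (Φ a b) := by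
  have h := DLogTime.scan (ι := Prop) (S := fun p _ _ _ => p) DLogTime.const
    (fun q x y => (δ q x y, none, none)) (Φ 0 0) A K hK 0 Bool.true
  refine h.congr fun n a b => ?_
  -- Invariant: when the `m` lowest bits are still unread, the state is the value of `Φ` at the
  -- leading parts `a / 2 ^ m` and `b / 2 ^ m`.
  have key : ∀ m x y, bitScan (fun q x y => (δ q x y, none, none)) a b m
      (Φ (a / 2 ^ m) (b / 2 ^ m), x, y) = (Φ a b, x, y) := by
    intro m
    induction m with
    | zero => intro x y; simp [bitScan]
    | succ m ih =>
      intro x y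
      simp only [bitScan, emitBit]
      rw [← hΦ, bit_testBit_div, bit_testBit_div, ih]
  simp only [add_zero, forall_const]
  refine and_congr_right fun ha => and_congr_right fun hb => ?_
  have := key (K * blk n) 0 0
  rw [Nat.div_eq_of_lt ha, Nat.div_eq_of_lt hb] at this
  rw [this]

/-! ### Names of nodes: a tag and interleaved numbers -/

/-- The number formed by the `j`-th of `R` interleaved sequences of `W` bits. -/
def track (R W a j : ℕ) : ℕ :=
  if j < R then Nat.ofBits fun i : Fin W => a.testBit (i * R + j) else 0

/-- The part of a name above the interleaved bits. -/
def tag (R W a : ℕ) : ℕ := a / 2 ^ (R * W)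

/-- The name with a given tag and given tracks. -/
def mkName (R W t : ℕ) (v : ℕ → ℕ) : ℕ :=
  2 ^ (R * W) * t + Nat.ofBits fun i : Fin (R * W) => (v (i % R)).testBit (i / R)

theorem track_of_le {R W a j : ℕ} (h : R ≤ j) : track R W a j = 0 := if_neg (by omega)

theorem track_lt (R W a j : ℕ) : track R W a j < 2 ^ W := by
  unfold track
  split_ifs
  · exact Nat.ofBits_lt_two_pow _
  · positivity

theorem testBit_track {R W a j i : ℕ} (hj : j < R) (hi : i < W) :
    (track R W a j).testBit i = a.testBit (i * R + j) := by
  rw [track, if_pos hj, Nat.testBit_ofBits_lt _ _ hi]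

theorem tag_mkName (R W t : ℕ) (v : ℕ → ℕ) : tag R W (mkName R W t v) = t := by
  rw [tag, mkName, Nat.mul_add_div (by positivity), Nat.div_eq_of_lt (Nat.ofBits_lt_two_pow _),
    add_zero]

theorem track_mkName {R W t j : ℕ} {v : ℕ → ℕ} (hj : j < R) (hv : v j < 2 ^ W) :
    track R W (mkName R W t v) j = v j := by
  apply Nat.eq_of_testBit_eq
  intro i
  by_cases hi : i < W
  · have h1 : i * R + j < R * W := by
      calc i * R + j < i * R + R := by omega
        _ = R * (i + 1) := by ring
        _ ≤ R * W := Nat.mul_le_mul_left _ hi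
    rw [testBit_track hj hi, mkName, Nat.testBit_two_pow_mul_add _ (Nat.ofBits_lt_two_pow _),
      if_pos h1, Nat.testBit_ofBits_lt _ _ h1]
    have h2 : (i * R + j) % R = j := by rw [add_comm, Nat.add_mul_mod_self_right, Nat.mod_eq_of_lt hj]
    have h3 : (i * R + j) / R = i := by
      rw [add_comm, Nat.add_mul_div_right _ _ (by omega), Nat.div_eq_of_lt hj, zero_add]
    simp [h2, h3]
  · have h1 := Nat.pow_le_pow_right (n := 2) (by norm_num) (not_lt.1 hi)
    rw [Nat.testBit_lt_two_pow ((track_lt _ _ _ _).trans_le h1),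
      Nat.testBit_lt_two_pow (hv.trans_le h1)]

theorem mkName_lt {R W t k : ℕ} {v : ℕ → ℕ} (ht : t < 2 ^ k) : mkName R W t v < 2 ^ (R * W + k) := by
  have h1 : (Nat.ofBits fun i : Fin (R * W) => (v (i % R)).testBit (i / R)) < 2 ^ (R * W) :=
    Nat.ofBits_lt_two_pow _
  rw [mkName, pow_add]
  calc _ < 2 ^ (R * W) * t + 2 ^ (R * W) := by omega
    _ = 2 ^ (R * W) * (t + 1) := by ring
    _ ≤ _ := Nat.mul_le_mul_left _ ht

theorem name_ext {R W a b : ℕ} (h : tag R W a = tag R W b)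
    (h' : ∀ j < R, track R W a j = track R W b j) : a = b := by
  rw [← Nat.div_add_mod a (2 ^ (R * W)), ← Nat.div_add_mod b (2 ^ (R * W))]
  unfold tag at h
  rw [h]
  congr 1
  apply Nat.eq_of_testBit_eq
  intro i
  rw [Nat.testBit_mod_two_pow, Nat.testBit_mod_two_pow]
  by_cases hi : i < R * W
  · have hR : 0 < R := Nat.pos_of_mul_pos_right (show 0 < R * W by omega)
    have h1 : i / R < W := Nat.div_lt_of_lt_mul hi
    have h2 := Nat.mod_lt i hR
    have h3 := congrArg (fun x => x.testBit (i / R)) (h' (i % R) h2)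
    simp only [testBit_track h2 h1] at h3
    rw [mul_comm, Nat.div_add_mod] at h3
    rw [h3]
  · simp [hi]

/-- The numbers that can be extracted from a pair of names. -/
inductive Source
  | zero | fstTrack (j : ℕ) | sndTrack (j : ℕ) | fst | snd

/-- The value of a source, leaving out the bits at the positions below `m`. -/
def Source.val (R W a b m : ℕ) : Source → ℕ
  | zero => 0
  -- The exponent is the number of positions below `min m (R * W)` that are congruent to `j` modulo
  -- `R`, that is, the number of bits of the track not yet read.
  | fstTrack j => track R W a j / 2 ^ ((min m (R * W) + R - 1 - j) / R)
  | sndTrack j => track R W b j / 2 ^ ((min m (R * W) + R - 1 - j) / R)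
  | fst => a % 2 ^ (R * W) / 2 ^ min m (R * W)
  | snd => b % 2 ^ (R * W) / 2 ^ min m (R * W)

/-! ### The transducer that unpacks a pair of names -/

namespace NameScan

/-- The bit that a source emits at a position congruent to `p`. -/
def emission (p : ℕ) (x y : Bool) : Source → Option Bool
  | .zero => none
  | .fstTrack j => if p = j then some x else none
  | .sndTrack j => if p = j then some y else none
  | .fst => some x
  | .snd => some y

variable (R k : ℕ)

/-- The states of the transducer: the number of bits of the tags that are still to be read, the tags
read so far, the position modulo the number of tracks, and the sets of tracks that agree and that
vanish so far. -/
abbrev St : Type := Fin (k + 1) × Fin (2 ^ k) × Fin (2 ^ k) × Fin R × (Fin R → Prop) × (Fin R → Prop)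

variable {R k}

instance : NeZero (2 ^ k) := ⟨by positivity⟩

/-- The transducer. -/
def tr [NeZero R] (sx sy : ℕ → ℕ → Source) (q : St R k) (x y : Bool) :
    St R k × Option Bool × Option Bool :=
  if (q.1 : ℕ) ≠ 0 then
    ((Fin.ofNat _ (q.1 - 1), Fin.ofNat _ (Nat.bit x q.2.1), Fin.ofNat _ (Nat.bit y q.2.2.1), q.2.2.2),
      none, none)
  else
    ((q.1, q.2.1, q.2.2.1, Fin.ofNat _ (q.2.2.2.1 + R - 1),
        (fun j => q.2.2.2.2.1 j ∧ (j = q.2.2.2.1 → x = y)),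
        (fun j => q.2.2.2.2.2 j ∧ (j = q.2.2.2.1 → y = false))),
      emission q.2.2.2.1 x y (sx q.2.1 q.2.2.1), emission q.2.2.2.1 x y (sy q.2.1 q.2.2.1))

/-- The state of the transducer when the bits at the positions below `m` are still to be read. -/
def stateAt [NeZero R] (W a b m : ℕ) : St R k :=
  (Fin.ofNat _ (m - R * W), Fin.ofNat _ (a / 2 ^ max m (R * W)), Fin.ofNat _ (b / 2 ^ max m (R * W)),
    Fin.ofNat _ (min m (R * W) + R - 1),
    (fun j => ∀ i < R * W, m ≤ i → i % R = j → a.testBit i = b.testBit i),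
    (fun j => ∀ i < R * W, m ≤ i → i % R = j → b.testBit i = false))

/-- For `m < R * W`, the exponent in `Source.val` of a track drops between `m + 1` and `m` exactly
if `m` is congruent to `j` modulo `R`, which is when a bit of that track is emitted. This is why
tracks are interleaved: a counter modulo `R` recognizes them, although their length grows with `n`.
-/
theorem emit_val {W a b m : ℕ} (hm : m < R * W) (s : Source) (hs : ∀ j, s = .fstTrack j ∨ s = .sndTrack j → j < R) :
    emitBit (emission (m % R) (a.testBit m) (b.testBit m) s) (s.val R W a b (m + 1)) =
      s.val R W a b m := by
  have hR : 0 < R := Nat.pos_of_mul_pos_right (show 0 < R * W by omega)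
  have h1 : min (m + 1) (R * W) = m + 1 := by omega
  have h2 : min m (R * W) = m := by omega
  have h3 : m / R < W := Nat.div_lt_of_lt_mul hm
  have hmod := Nat.mod_lt m hR
  have key : ∀ c j, j < R → emitBit (if m % R = j then some (c.testBit m) else none)
      (track R W c j / 2 ^ ((m + 1 + R - 1 - j) / R)) = track R W c j / 2 ^ ((m + R - 1 - j) / R) := by
    intro c j hj
    have hd := Nat.div_add_mod m R
    split_ifs with h
    · have e1 : (m + 1 + R - 1 - j) / R = m / R + 1 := by
        have : m + 1 + R - 1 - j = R * (m / R + 1) := by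
          rw [mul_add]; omega
        rw [this, Nat.mul_div_cancel_left _ hR]
      have e2 : (m + R - 1 - j) / R = m / R := by
        have : m + R - 1 - j = (R - 1) + R * (m / R) := by omega
        rw [this, Nat.add_mul_div_left _ _ hR, Nat.div_eq_of_lt (by omega), zero_add]
      have e3 : c.testBit m = (track R W c j).testBit (m / R) := by
        rw [testBit_track hj h3, ← h, mul_comm, hd]
      rw [e1, e2, e3, emitBit, bit_testBit_div]
    · have e1 : (m + 1 + R - 1 - j) / R = (m + R - 1 - j) / R := by
        have : m + 1 + R - 1 - j = (m + R - 1 - j) + 1 := by omega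
        rw [this, Nat.succ_div, if_neg, add_zero]
        rintro ⟨e, he⟩
        have he2 : m + R = j + R * e := by omega
        apply h
        have := congrArg (· % R) he2
        simpa [Nat.mod_eq_of_lt hj] using this
      rw [e1]
      rfl
  have key2 : ∀ c : ℕ, emitBit (some (c.testBit m)) (c % 2 ^ (R * W) / 2 ^ (m + 1)) =
      c % 2 ^ (R * W) / 2 ^ m := by
    intro c
    have : c.testBit m = (c % 2 ^ (R * W)).testBit m := by
      rw [Nat.testBit_mod_two_pow]; simp [hm]
    rw [this, emitBit, bit_testBit_div]
  cases s with
  | zero => rfl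
  | fstTrack j => simpa only [Source.val, emission, h1, h2] using key a j (hs j (Or.inl rfl))
  | sndTrack j => simpa only [Source.val, emission, h1, h2] using key b j (hs j (Or.inr rfl))
  | fst => simpa only [Source.val, emission, h1, h2] using key2 a
  | snd => simpa only [Source.val, emission, h1, h2] using key2 b

theorem tr_tag [NeZero R] {W a b m : ℕ} (ha : a < 2 ^ (R * W + k)) (hb : b < 2 ^ (R * W + k))
    (sx sy : ℕ → ℕ → Source) (h1 : R * W ≤ m) (h2 : m < R * W + k) :
    tr sx sy (stateAt W a b (m + 1) : St R k) (a.testBit m) (b.testBit m) =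
      (stateAt W a b m, none, none) := by
  have hlt : ∀ c < 2 ^ (R * W + k), ∀ i, R * W ≤ i → c / 2 ^ i < 2 ^ k := by
    intro c hc i hi
    rw [Nat.div_lt_iff_lt_mul (by positivity), ← pow_add]
    exact hc.trans_le (Nat.pow_le_pow_right (by norm_num) (by omega))
  have e1 : m + 1 - R * W < k + 1 := by omega
  have e2 : max (m + 1) (R * W) = m + 1 := by omega
  have e3 : max m (R * W) = m := by omega
  have e4 : min (m + 1) (R * W) = R * W := by omega
  have e5 : min m (R * W) = R * W := by omega
  rw [tr, if_pos]
  · simp only [stateAt, e2, e3, e4, e5, Fin.val_ofNat, Nat.mod_eq_of_lt e1,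
      Nat.mod_eq_of_lt (hlt a ha (m + 1) (by omega)), Nat.mod_eq_of_lt (hlt b hb (m + 1) (by omega)),
      bit_testBit_div]
    have e6 : m + 1 - R * W - 1 = m - R * W := by omega
    rw [e6]
    refine Prod.ext (Prod.ext rfl (Prod.ext rfl (Prod.ext rfl (Prod.ext rfl (Prod.ext ?_ ?_))))) rfl
    · funext j
      refine propext (forall_congr' fun i => forall_congr' fun hi => ?_)
      exact ⟨fun h h3 => absurd hi (by omega), fun h h3 => absurd hi (by omega)⟩
    · funext j
      refine propext (forall_congr' fun i => forall_congr' fun hi => ?_)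
      exact ⟨fun h h3 => absurd hi (by omega), fun h h3 => absurd hi (by omega)⟩
  · simp only [stateAt, Fin.val_ofNat, Nat.mod_eq_of_lt e1]
    omega

theorem tr_tracks [NeZero R] {W a b m : ℕ} (ha : a < 2 ^ (R * W + k)) (hb : b < 2 ^ (R * W + k))
    (sx sy : ℕ → ℕ → Source) (h1 : m < R * W) :
    tr sx sy (stateAt W a b (m + 1) : St R k) (a.testBit m) (b.testBit m) =
      (stateAt W a b m, emission (m % R) (a.testBit m) (b.testBit m) (sx (tag R W a) (tag R W b)),
        emission (m % R) (a.testBit m) (b.testBit m) (sy (tag R W a) (tag R W b))) := by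
  have hR : 0 < R := Nat.pos_of_mul_pos_right (show 0 < R * W by omega)
  have hlt : ∀ c < 2 ^ (R * W + k), c / 2 ^ (R * W) < 2 ^ k := by
    intro c hc
    rw [Nat.div_lt_iff_lt_mul (by positivity), ← pow_add]
    exact hc.trans_le (Nat.pow_le_pow_right (by norm_num) (by omega))
  have e1 : m + 1 - R * W = 0 := by omega
  have e1' : m - R * W = 0 := by omega
  have e2 : max (m + 1) (R * W) = R * W := by omega
  have e3 : max m (R * W) = R * W := by omega
  have e4 : min (m + 1) (R * W) = m + 1 := by omega
  have e5 : min m (R * W) = m := by omega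
  have e6 : (m + 1 + R - 1) % R = m % R := by
    have : m + 1 + R - 1 = m + R := by omega
    rw [this, Nat.add_mod_right]
  have e7 : (m % R + R - 1) % R = (m + R - 1) % R := by
    rw [Nat.add_sub_assoc hR, Nat.add_sub_assoc hR, Nat.mod_add_mod]
  have hmod := Nat.mod_lt m hR
  rw [tr, if_neg]
  · simp only [stateAt, e1, e1', e2, e3, e4, e5, Fin.val_ofNat, Nat.mod_eq_of_lt (hlt a ha),
      Nat.mod_eq_of_lt (hlt b hb), e6, tag]
    have hj : ∀ j : Fin R, j = Fin.ofNat R (m + 1 + R - 1) ↔ m % R = j := by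
      intro j
      rw [Fin.ext_iff, Fin.val_ofNat, e6, eq_comm]
    have hm : ∀ i, m ≤ i ↔ m + 1 ≤ i ∨ i = m := by omega
    refine Prod.ext (Prod.ext rfl (Prod.ext rfl (Prod.ext rfl (Prod.ext ?_ (Prod.ext ?_ ?_))))) rfl
    · refine Fin.ext ?_
      simp only [Fin.val_ofNat]
      exact e7
    · funext j
      simp only [hj]
      refine propext ⟨fun h i hi hmi hij => ?_, fun h => ⟨fun i hi hmi hij => ?_, fun h2 => ?_⟩⟩
      · rcases (hm i).1 hmi with h3 | rfl
        · exact h.1 i hi h3 hij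
        · exact h.2 hij
      · exact h i hi (by omega) hij
      · exact h m h1 le_rfl h2
    · funext j
      simp only [hj]
      refine propext ⟨fun h i hi hmi hij => ?_, fun h => ⟨fun i hi hmi hij => ?_, fun h2 => ?_⟩⟩
      · rcases (hm i).1 hmi with h3 | rfl
        · exact h.1 i hi h3 hij
        · exact h.2 hij
      · exact h i hi (by omega) hij
      · exact h m h1 le_rfl h2
  · simp [stateAt, e1]

/-- The tags are the leading bits, so they are fully known before the first track bit is read and
can decide which tracks are emitted. -/
theorem bitScan_eq [NeZero R] {W a b : ℕ} (ha : a < 2 ^ (R * W + k)) (hb : b < 2 ^ (R * W + k))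
    (sx sy : ℕ → ℕ → Source)
    (hs : ∀ s t j, (sx s t = .fstTrack j ∨ sx s t = .sndTrack j) ∨
      (sy s t = .fstTrack j ∨ sy s t = .sndTrack j) → j < R) (m : ℕ) (hm : m ≤ R * W + k) :
    bitScan (tr sx sy) a b m ((stateAt W a b m : St R k),
      (sx (tag R W a) (tag R W b)).val R W a b m, (sy (tag R W a) (tag R W b)).val R W a b m) =
      ((stateAt W a b 0 : St R k), (sx (tag R W a) (tag R W b)).val R W a b 0,
        (sy (tag R W a) (tag R W b)).val R W a b 0) := by
  induction m with
  | zero => rfl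
  | succ m ih =>
    rw [← ih (by omega)]
    rw [bitScan]
    by_cases h : R * W ≤ m
    · rw [tr_tag ha hb sx sy h (by omega)]
      have : ∀ s : Source, s.val R W a b (m + 1) = s.val R W a b m := by
        intro s
        have e4 : min (m + 1) (R * W) = R * W := by omega
        have e5 : min m (R * W) = R * W := by omega
        cases s <;> simp only [Source.val, e4, e5]
      simp only [emitBit, this]
    · rw [not_le] at h
      rw [tr_tracks ha hb sx sy h]
      simp only
      rw [emit_val h _ fun j hj => hs _ _ j (Or.inl hj), emit_val h _ fun j hj => hs _ _ j (Or.inr hj)]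

end NameScan

/-- Bits above the scanned range are never looked at; this covers the relations whose second
argument is irrelevant and hence unbounded. -/
theorem bitScan_mod {Q : Type} (tr : Q → Bool → Bool → Q × Option Bool × Option Bool) (a b L m : ℕ)
    (hm : m ≤ L) (s : Q × ℕ × ℕ) : bitScan tr a (b % 2 ^ L) m s = bitScan tr a b m s := by
  induction m generalizing s with
  | zero => rfl
  | succ m ih =>
    obtain ⟨q, x, y⟩ := s
    have : (b % 2 ^ L).testBit m = b.testBit m := by
      rw [Nat.testBit_mod_two_pow]; simp; omega
    rw [bitScan, bitScan, this, ih (by omega)]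

theorem eq_iff_forall_testBit_track {R W a b j : ℕ} (hj : j < R) :
    (∀ i < R * W, i % R = j → a.testBit i = b.testBit i) ↔ track R W a j = track R W b j := by
  constructor
  · intro h
    apply Nat.eq_of_testBit_eq
    intro i
    by_cases hi : i < W
    · rw [testBit_track hj hi, testBit_track hj hi]
      apply h
      · calc i * R + j < i * R + R := by omega
          _ = R * (i + 1) := by ring
          _ ≤ R * W := Nat.mul_le_mul_left _ hi
      · rw [add_comm, Nat.add_mul_mod_self_right, Nat.mod_eq_of_lt hj]
    · have h1 := Nat.pow_le_pow_right (n := 2) (by norm_num) (not_lt.1 hi)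
      rw [Nat.testBit_lt_two_pow ((track_lt _ _ _ _).trans_le h1),
        Nat.testBit_lt_two_pow ((track_lt _ _ _ _).trans_le h1)]
  · intro h i hi hij
    have h1 : i / R < W := Nat.div_lt_of_lt_mul hi
    have h3 := congrArg (fun x => x.testBit (i / R)) h
    simp only [testBit_track hj h1] at h3
    rwa [← hij, mul_comm, Nat.div_add_mod] at h3

/-- Relations on names that are decided by calling one of finitely many relations on extracted numbers;
the relation that is called may depend on the tags and on the sets of tracks that agree or vanish. -/
theorem DLogTime.names {ι : Type} [Finite ι] {S : ι → ℕ → ℕ → ℕ → Prop} (hS : ∀ i, DLogTime (S i))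
    (R c k : ℕ) (hR : 2 ≤ R) (hc : 1 ≤ c) (useB : Bool) (sx sy : ℕ → ℕ → Source)
    (hs : ∀ s t j, (sx s t = .fstTrack j ∨ sx s t = .sndTrack j) ∨
      (sy s t = .fstTrack j ∨ sy s t = .sndTrack j) → j < R)
    (out : ℕ → ℕ → (Fin R → Prop) → (Fin R → Prop) → ι) :
    DLogTime fun n a b => a < 2 ^ (R * (c * blk n) + k) ∧
      (useB = Bool.true → b < 2 ^ (R * (c * blk n) + k)) ∧
      let b' := b % 2 ^ (R * (c * blk n) + k)
      let s := tag R (c * blk n) a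
      let t := tag R (c * blk n) b'
      S (out s t (fun j => track R (c * blk n) a j = track R (c * blk n) b' j)
          (fun j => track R (c * blk n) b' j = 0)) n
        ((sx s t).val R (c * blk n) a b' 0) ((sy s t).val R (c * blk n) a b' 0) := by
  have : NeZero R := ⟨by omega⟩
  have h := DLogTime.scan hS (NameScan.tr (R := R) (k := k) sx sy)
    (Fin.ofNat _ k, 0, 0, Fin.ofNat _ (R - 1), fun _ => True, fun _ => True)
    (fun q => out q.2.1 q.2.2.1 q.2.2.2.2.1 q.2.2.2.2.2) (R * c) (by nlinarith) k useB
  refine h.congr fun n a b => ?_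
  rw [mul_assoc]
  set W := c * blk n
  refine and_congr_right fun ha => and_congr_right fun _ => ?_
  set b' := b % 2 ^ (R * W + k) with hb'
  have hb : b' < 2 ^ (R * W + k) := Nat.mod_lt _ (by positivity)
  have key := NameScan.bitScan_eq ha hb sx sy hs (R * W + k) le_rfl
  have hval : ∀ s : Source, (∀ j, s = .fstTrack j ∨ s = .sndTrack j → j < R) →
      s.val R W a b' (R * W + k) = 0 := by
    intro s hs
    have h1 : min (R * W + k) (R * W) = R * W := by omega
    have h2 : ∀ j < R, ∀ c, track R W c j / 2 ^ ((R * W + R - 1 - j) / R) = 0 := by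
      intro j hj c
      have : R * W + R - 1 - j = (R - 1 - j) + R * W := by omega
      rw [this, Nat.add_mul_div_left _ _ (by omega), Nat.div_eq_of_lt (a := R - 1 - j) (by omega),
        zero_add]
      exact Nat.div_eq_of_lt (track_lt _ _ _ _)
    cases s with
    | zero => rfl
    | fstTrack j => simpa only [Source.val, h1] using h2 j (hs j (Or.inl rfl)) a
    | sndTrack j => simpa only [Source.val, h1] using h2 j (hs j (Or.inr rfl)) b'
    | fst => simpa only [Source.val, h1] using Nat.div_eq_of_lt (Nat.mod_lt _ (by positivity))
    | snd => simpa only [Source.val, h1] using Nat.div_eq_of_lt (Nat.mod_lt _ (by positivity))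
  have hstart : (NameScan.stateAt W a b' (R * W + k) : NameScan.St R k) =
      (Fin.ofNat _ k, 0, 0, Fin.ofNat _ (R - 1), fun _ => True, fun _ => True) := by
    have h1 : R * W + k - R * W = k := by omega
    have h2 : max (R * W + k) (R * W) = R * W + k := by omega
    have h3 : min (R * W + k) (R * W) = R * W := by omega
    have h4 : Fin.ofNat R (R * W + R - 1) = Fin.ofNat R (R - 1) := by
      ext
      rw [Fin.val_ofNat, Fin.val_ofNat, Nat.add_sub_assoc (by omega), Nat.mul_add_mod]
    simp only [NameScan.stateAt, h1, h2, h3, h4, Nat.div_eq_of_lt ha, Nat.div_eq_of_lt hb]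
    refine Prod.ext rfl (Prod.ext rfl (Prod.ext rfl (Prod.ext rfl (Prod.ext ?_ ?_))))
    · funext j
      exact eq_true fun i hi h _ => absurd hi (by omega)
    · funext j
      exact eq_true fun i hi h _ => absurd hi (by omega)
  rw [hval _ fun j hj => hs _ _ j (Or.inl hj), hval _ fun j hj => hs _ _ j (Or.inr hj), hstart,
    hb', bitScan_mod _ _ _ _ _ le_rfl, ← hb'] at key
  rw [key]
  have htag : ∀ c < 2 ^ (R * W + k), (Fin.ofNat (2 ^ k) (c / 2 ^ max 0 (R * W)) : ℕ) = tag R W c := by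
    intro c hc
    rw [Fin.val_ofNat, Nat.mod_eq_of_lt]
    · simp [tag]
    · rw [Nat.zero_max, Nat.div_lt_iff_lt_mul (by positivity), ← pow_add, add_comm]
      exact hc
  have hE : (NameScan.stateAt W a b' 0 : NameScan.St R k).2.2.2.2.1 =
      fun j : Fin R => track R W a j = track R W b' j := by
    funext j
    rw [← eq_iff_forall_testBit_track j.2]
    simp [NameScan.stateAt]
  have hZ : (NameScan.stateAt W a b' 0 : NameScan.St R k).2.2.2.2.2 =
      fun j : Fin R => track R W b' j = 0 := by
    funext j
    have h0 : track R W 0 j = 0 := by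
      apply Nat.eq_of_testBit_eq
      intro i
      by_cases hi : i < W
      · rw [testBit_track j.2 hi, Nat.zero_testBit, Nat.zero_testBit]
      · rw [Nat.zero_testBit]
        exact Nat.testBit_lt_two_pow ((track_lt _ _ _ _).trans_le
          (Nat.pow_le_pow_right (by norm_num) (not_lt.1 hi)))
    have h1 := eq_iff_forall_testBit_track (W := W) (a := b') (b := 0) j.2
    rw [h0] at h1
    rw [← h1]
    simp [NameScan.stateAt]
  simp only [hE, hZ]
  rw [show ((NameScan.stateAt W a b' 0 : NameScan.St R k).2.1 : ℕ) = tag R W a from htag a ha,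
    show ((NameScan.stateAt W a b' 0 : NameScan.St R k).2.2.1 : ℕ) = tag R W b' from htag b' hb]

theorem Source.val_fstTrack {R W a b j : ℕ} (hj : j < R) :
    (Source.fstTrack j).val R W a b 0 = track R W a j := by
  rw [Source.val, Nat.zero_min, zero_add, Nat.div_eq_of_lt (a := R - 1 - j) (by omega), pow_zero,
    Nat.div_one]

theorem Source.val_sndTrack {R W a b j : ℕ} (hj : j < R) :
    (Source.sndTrack j).val R W a b 0 = track R W b j := by
  rw [Source.val, Nat.zero_min, zero_add, Nat.div_eq_of_lt (a := R - 1 - j) (by omega), pow_zero,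
    Nat.div_one]

theorem Source.val_fst {R W a b : ℕ} (h : tag R W a = 0) : Source.fst.val R W a b 0 = a := by
  rw [Source.val, Nat.zero_min, pow_zero, Nat.div_one]
  have := Nat.div_add_mod a (2 ^ (R * W))
  rw [← tag, h] at this
  simpa using this

theorem Source.val_snd {R W a b : ℕ} (h : tag R W b = 0) : Source.snd.val R W a b 0 = b := by
  rw [Source.val, Nat.zero_min, pow_zero, Nat.div_one]
  have := Nat.div_add_mod b (2 ^ (R * W))
  rw [← tag, h] at this
  simpa using this

/-! ### Straight-line programs and their circuits -/

/-- The bound on the values of the variables of a formula. -/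
def bd (c n : ℕ) : ℕ := 2 ^ (c * blk n)

/-- The length bound `n`, the inputs, and the values of the variables. -/
structure Env (k : ℕ) where
  n : ℕ
  x : Fin k → ℕ
  v : ℕ → ℕ

/-- Change the values of the variables `i` and `i + 1`. -/
def Env.upd {k : ℕ} (e : Env k) (i z w : ℕ) : Env k :=
  { e with v := Function.update (Function.update e.v i z) (i + 1) w }

/-- The instructions of straight-line programs: input bits, relations between variables, negations, and
majority votes over the values of two variables in two of the previous instructions. -/
inductive Instr (k : ℕ)
  | inp (j : Fin k) (i : ℕ)
  | orc (S : ℕ → ℕ → ℕ → Prop) (i j : ℕ)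
  | not (s : ℕ)
  | maj (i s s' : ℕ)

open Classical in
/-- The number of pairs of values below `B` with a given property. -/
noncomputable def pairCount (B : ℕ) (p : ℕ → ℕ → Prop) : ℕ :=
  ((Finset.range B ×ˢ Finset.range B).filter fun z => p z.1 z.2).card

variable {k : ℕ}

namespace Instr

/-- The truth value of an instruction, given the truth values of the other instructions. -/
def sem (c : ℕ) (f : ℕ → Env k → Prop) (e : Env k) : Instr k → Prop
  | inp j i => (e.x j).testBit (e.v i) = true
  | orc S i j => S e.n (e.v i) (e.v j)
  | not s => ¬ f s e
  | maj i s s' => bd c e.n * bd c e.n <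
      pairCount (bd c e.n) (fun z w => f s (e.upd i z w)) +
        pairCount (bd c e.n) (fun z w => f s' (e.upd i z w))

/-- The instruction at position `t` uses only variables below `R` and previous instructions. -/
def Ok (R t : ℕ) : Instr k → Prop
  | inp _ i => i < R
  | orc S i j => DLogTime S ∧ i < R ∧ j < R
  | not s => s < t
  -- Predecessors form a set, so the two groups of votes add up only if their instructions differ.
  | maj i s s' => i + 1 < R ∧ s < t ∧ s' < t ∧ s ≠ s'

end Instr

/-- The truth values of the instructions of a program. -/
def progSem (c : ℕ) (l : List (Instr k)) (t : ℕ) (e : Env k) : Prop :=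
  match l[t]? with
  | none => False
  -- The guard `s < t` is there for termination; in a well-formed program it holds for every
  -- reference.
  | some i => i.sem c (fun s e' => ∃ _ : s < t, progSem c l s e') e
termination_by t

/-- All instructions of a program are well-formed. -/
def ProgOk (R : ℕ) (l : List (Instr k)) : Prop :=
  ∀ (t : ℕ) (i : Instr k), l[t]? = some i → i.Ok R t

theorem Instr.sem_congr {c R t : ℕ} {i : Instr k} (hi : i.Ok R t) {f g : ℕ → Env k → Prop}
    (h : ∀ s < t, ∀ e, f s e ↔ g s e) (e : Env k) : i.sem c f e ↔ i.sem c g e := by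
  cases i with
  | inp j i => rfl
  | orc S i j => rfl
  | not s => exact not_congr (h s hi _)
  | maj i s s' =>
    simp only [Instr.sem]
    have h1 : (fun z w => f s (e.upd i z w)) = fun z w => g s (e.upd i z w) := by
      funext z w; exact propext (h s hi.2.1 _)
    have h2 : (fun z w => f s' (e.upd i z w)) = fun z w => g s' (e.upd i z w) := by
      funext z w; exact propext (h s' hi.2.2.1 _)
    rw [h1, h2]

theorem progSem_some {c R : ℕ} {l : List (Instr k)} (hl : ProgOk R l) {t : ℕ} {i : Instr k}
    (hi : l[t]? = some i) (e : Env k) : progSem c l t e ↔ i.sem c (progSem c l) e := by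
  rw [progSem, hi]
  exact Instr.sem_congr (hl t i hi) (fun s hs e => by simp [hs]) e

theorem progSem_none {c : ℕ} {l : List (Instr k)} {t : ℕ} (hi : l[t]? = none) (e : Env k) :
    ¬ progSem c l t e := by
  rw [progSem, hi]
  exact id

theorem progSem_append {c R : ℕ} {l l' : List (Instr k)} (hl : ProgOk R l) (hl' : ProgOk R (l ++ l')) (t : ℕ) :
    t < l.length → ∀ e, progSem c (l ++ l') t e ↔ progSem c l t e := by
  induction t using Nat.strong_induction_on with
  | _ t ih =>
    intro ht e
    have h1 : l[t]? = some l[t] := List.getElem?_eq_getElem ht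
    have h2 : (l ++ l')[t]? = some l[t] := by rw [List.getElem?_append_left ht, h1]
    rw [progSem_some hl h1, progSem_some hl' h2]
    exact Instr.sem_congr (hl t _ h1) (fun s hs e => ih s hs (hs.trans ht) e) e

/-! ### The circuit of a program -/

namespace ProgCircuit

/-- A well-formed program with `R` variables below `bd c n`, with the position of the instruction that
yields the bits of the output. -/
structure Data (k : ℕ) where
  l : List (Instr k)
  R : ℕ
  hR : 2 ≤ R
  hl : ProgOk R l
  c : ℕ
  hc : 1 ≤ c
  width : ℕ
  hwidth : l.length ≤ 2 ^ width
  o : ℕ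
  ho : o < l.length
  cOut : ℕ
  hcOut : 2 ≤ cOut
  hcOut' : cOut ≤ c

variable (D : Data k)

namespace Data

/-- The number of bits of a variable. -/
def W (n : ℕ) : ℕ := D.c * blk n

def size (n : ℕ) : ℕ := 2 ^ (D.R * D.W n + D.width)

def trk (n a j : ℕ) : ℕ := track D.R (D.W n) a j

def tg (n a : ℕ) : ℕ := tag D.R (D.W n) a

def name (n t : ℕ) (v : ℕ → ℕ) : ℕ := mkName D.R (D.W n) t v

open Classical in
/-- The label of a node. -/
noncomputable def kind (n : ℕ) (a : ℕ) : GateKind k n :=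
  match D.l[D.tg n a]? with
  -- Gates without predecessors serve as constants: `or` is false, `and` is true.
  | none => .op .or
  | some (.inp j i) => if h : D.trk n a i < n then .input j ⟨D.trk n a i, h⟩ else .op .or
  | some (.orc S i j) => if S n (D.trk n a i) (D.trk n a j) then .op .and else .op .or
  | some (.not _) => .op .not
  | some (.maj _ _ _) => .op .maj

/-- The condition for an edge, in terms of the instruction of its target, the tag of its source and the
set of variables that agree. -/
def pattern (R : ℕ) (i : Option (Instr k)) (t : ℕ) (E : Fin R → Prop) : Prop :=
  match i with
  | some (.not s) => t = s ∧ ∀ j, E j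
  | some (.maj i s s') => (t = s ∨ t = s') ∧ ∀ j : Fin R, (j : ℕ) ≠ i → (j : ℕ) ≠ i + 1 → E j
  | _ => False

/-- There is an edge from `b` to `a`. -/
def edge (n a b : ℕ) : Prop :=
  pattern D.R D.l[D.tg n a]? (D.tg n b) fun j => D.trk n a j = D.trk n b j

variable {D}

/-- Instructions refer to earlier ones only. This gives acyclicity, and a depth bound independent of
`n`. -/
theorem tg_lt_of_edge {n a b : ℕ} (h : D.edge n a b) : D.tg n b < D.tg n a := by
  unfold edge pattern at h
  rcases h1 : D.l[D.tg n a]? with _ | i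
  · simp [h1] at h
  · have h2 := D.hl _ _ h1
    cases i with
    | inp j i => simp [h1] at h
    | orc S i j => simp [h1] at h
    | not s =>
      simp only [h1] at h
      rw [h.1]
      exact h2
    | maj i s s' =>
      simp only [h1] at h
      obtain ⟨_, h3, h4, _⟩ := h2
      rcases h.1 with h | h <;> rw [h] <;> assumption

theorem trk_lt (n a j : ℕ) : D.trk n a j < bd D.c n := track_lt _ _ _ _

theorem trk_of_le {n a j : ℕ} (h : D.R ≤ j) : D.trk n a j = 0 := track_of_le h

theorem tg_name (n t : ℕ) (v : ℕ → ℕ) : D.tg n (D.name n t v) = t := tag_mkName _ _ _ _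

theorem trk_name {n t j : ℕ} {v : ℕ → ℕ} (hj : j < D.R) (hv : v j < bd D.c n) :
    D.trk n (D.name n t v) j = v j := track_mkName hj hv

theorem name_lt {n t : ℕ} {v : ℕ → ℕ} (ht : t < D.l.length) : D.name n t v < D.size n :=
  mkName_lt (ht.trans_le D.hwidth)

theorem eq_of_trk {n a b : ℕ} (h : D.tg n a = D.tg n b) (h' : ∀ j < D.R, D.trk n a j = D.trk n b j) :
    a = b := name_ext h h'

variable (D)

open Classical in
/-- The circuit of a program. -/
noncomputable abbrev circuit (n : ℕ) : Circuit k n where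
  size := D.size n
  kind := fun a => D.kind n a
  preds := fun a => Finset.univ.filter fun b => D.edge n a b
  numOut := bd D.cOut n
  out := fun i => ⟨D.name n D.o fun j => if j = 0 then i else 0, name_lt D.ho⟩
  acyclic := by
    refine Subrelation.wf (r := InvImage (· < ·) fun a : Fin (D.size n) => D.tg n a) ?_
      (InvImage.wf _ wellFounded_lt)
    intro a b h
    exact tg_lt_of_edge (by simpa using h)
  input_fanIn := by
    intro a j i h
    refine Finset.filter_eq_empty_iff.2 fun b _ hb => ?_
    unfold kind at h
    unfold edge pattern at hb
    rcases h1 : D.l[D.tg n a]? with _ | (_ | _ | _ | _)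
    all_goals simp [h1] at h hb
  not_fanIn := by
    intro a h
    unfold kind at h
    rcases h1 : D.l[D.tg n a]? with _ | (_ | _ | s | _)
    · simp [h1] at h
    · simp only [h1] at h
      split_ifs at h
      simp at h
    · simp only [h1] at h
      split_ifs at h
      · simp at h
      · simp at h
    · have hs : s < D.l.length := by
        have h2 : s < D.tg n a := D.hl _ _ h1
        exact h2.trans (List.getElem?_eq_some_iff.1 h1).1
      refine Finset.card_eq_one.2 ⟨⟨D.name n s (D.trk n a), name_lt hs⟩, ?_⟩
      ext b
      simp only [Finset.mem_filter, Finset.mem_univ, true_and, Finset.mem_singleton, edge, pattern, h1]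
      constructor
      · rintro ⟨h2, h3⟩
        refine Fin.ext (eq_of_trk (D := D) (n := n) ?_ ?_)
        · rw [h2, tg_name]
        · intro j hj
          rw [trk_name hj (trk_lt _ _ _)]
          exact (h3 ⟨j, hj⟩).symm
      · rintro rfl
        refine ⟨tg_name _ _ _, fun j => ?_⟩
        rw [trk_name j.2 (trk_lt _ _ _)]
    · simp [h1] at h

end Data

variable {D}

theorem mem_preds {n : ℕ} (a b : Fin (D.size n)) :
    b ∈ (D.circuit n).preds a ↔ D.edge n a b := by
  simp [Data.circuit]

-- The predecessors with tag `s` of a majority gate differ from it only in the variables `i` and `i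
-- + 1`; writing the values of these two variables into a name is a bijection from pairs of values
-- to predecessors.
open Classical in
theorem pairCount_eq {n s i : ℕ} {a : Fin (D.size n)} (hs : s < D.l.length) (hi : i + 1 < D.R)
    (p : Fin (D.size n) → Prop) (q : Env k → Prop) (x : Fin k → ℕ)
    (hpq : ∀ b : Fin (D.size n), D.tg n b = s → (p b ↔ q ⟨n, x, D.trk n b⟩)) :
    (Finset.univ.filter fun b : Fin (D.size n) => (D.tg n b = s ∧ ∀ j : Fin D.R, (j : ℕ) ≠ i →
      (j : ℕ) ≠ i + 1 → D.trk n a j = D.trk n b j) ∧ p b).card =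
      pairCount (bd D.c n) fun z w => q (Env.upd ⟨n, x, D.trk n a⟩ i z w) := by
  have hupd : ∀ z < bd D.c n, ∀ w < bd D.c n, D.trk n (D.name n s
      (Env.upd (⟨n, x, D.trk n a⟩ : Env k) i z w).v) = (Env.upd (⟨n, x, D.trk n a⟩ : Env k) i z w).v := by
    intro z hz w hw
    funext j
    by_cases hj : j < D.R
    · refine Data.trk_name hj ?_
      simp only [Env.upd, Function.update_apply]
      split_ifs
      · exact hw
      · exact hz
      · exact Data.trk_lt _ _ _
    · rw [Data.trk_of_le (by omega)]
      simp only [Env.upd, Function.update_apply]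
      rw [if_neg (by omega), if_neg (by omega), Data.trk_of_le (by omega)]
  unfold pairCount
  symm
  refine Finset.card_bij (fun z _ => ⟨D.name n s (Env.upd (⟨n, x, D.trk n a⟩ : Env k) i z.1 z.2).v,
    Data.name_lt hs⟩) ?_ ?_ ?_
  · rintro ⟨z, w⟩ h
    simp only [Finset.mem_filter, Finset.mem_product, Finset.mem_range, Finset.mem_univ, true_and] at h ⊢
    refine ⟨⟨Data.tg_name _ _ _, fun j h1 h2 => ?_⟩, ?_⟩
    · rw [hupd z h.1.1 w h.1.2]
      simp [Env.upd, h1, h2]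
    · rw [hpq _ (Data.tg_name _ _ _), hupd z h.1.1 w h.1.2]
      exact h.2
  · rintro ⟨z, w⟩ h ⟨z', w'⟩ h' heq
    simp only [Finset.mem_filter, Finset.mem_product, Finset.mem_range] at h h'
    have h1 : D.name n s (Env.upd (⟨n, x, D.trk n a⟩ : Env k) i z w).v =
      D.name n s (Env.upd (⟨n, x, D.trk n a⟩ : Env k) i z' w').v := Fin.mk.inj heq
    have h2 := congrArg (D.trk n) h1
    rw [hupd z h.1.1 w h.1.2, hupd z' h'.1.1 w' h'.1.2] at h2
    have h3 := congrFun h2 i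
    have h4 := congrFun h2 (i + 1)
    simp [Env.upd] at h3 h4
    rw [h3, h4]
  · intro b h
    simp only [Finset.mem_filter, Finset.mem_univ, true_and] at h
    obtain ⟨⟨h1, h2⟩, h3⟩ := h
    have h4 : (Env.upd (⟨n, x, D.trk n a⟩ : Env k) i (D.trk n b i) (D.trk n b (i + 1))).v = D.trk n b := by
      funext j
      simp only [Env.upd, Function.update_apply]
      split_ifs with h5 h6
      · rw [h5]
      · rw [h6]
      · by_cases hj : j < D.R
        · exact h2 ⟨j, hj⟩ h6 h5
        · rw [Data.trk_of_le (by omega), Data.trk_of_le (by omega)]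
    refine ⟨(D.trk n b i, D.trk n b (i + 1)), ?_, ?_⟩
    · simp only [Finset.mem_filter, Finset.mem_product, Finset.mem_range]
      refine ⟨⟨Data.trk_lt _ _ _, Data.trk_lt _ _ _⟩, ?_⟩
      have h5 : Env.upd (⟨n, x, D.trk n a⟩ : Env k) i (D.trk n b i) (D.trk n b (i + 1)) =
        ⟨n, x, D.trk n b⟩ := congrArg (Env.mk n x) h4
      rw [h5, ← hpq b h1]
      exact h3
    · refine Fin.ext (Data.eq_of_trk (D := D) (n := n) ?_ ?_)
      · rw [Data.tg_name, h1]
      · intro j _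
        simp only [h4]
        exact Data.trk_name ‹_› (Data.trk_lt _ _ _)

theorem pairCount_true (B : ℕ) : pairCount B (fun _ _ => True) = B * B := by
  simp [pairCount]

theorem eval_circuit (n : ℕ) (x : Fin k → ℕ) (hx : ∀ j, Nat.size (x j) ≤ n) (t : ℕ) :
    ∀ a : Fin (D.size n), D.tg n a = t →
      ((D.circuit n).eval x a = true ↔ progSem D.c D.l t ⟨n, x, D.trk n a⟩) := by
  classical
  induction t using Nat.strong_induction_on with
  | _ t ih =>
  intro a ha
  have hk : (D.circuit n).kind a = D.kind n a := rfl
  unfold Data.kind at hk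
  have hpre : ∀ b, b ∈ (D.circuit n).preds a ↔ D.edge n a b := mem_preds a
  unfold Data.edge Data.pattern at hpre
  rw [Circuit.eval_eq]
  rw [ha] at hk hpre
  rcases h1 : D.l[t]? with _ | i
  · simp only [h1] at hk hpre
    simp [hk, hpre, progSem_none h1]
  · rw [progSem_some D.hl h1]
    have hok := D.hl _ _ h1
    have hlen : t < D.l.length := (List.getElem?_eq_some_iff.1 h1).1
    cases i with
    | inp j i =>
      simp only [h1] at hk hpre
      simp only [Instr.sem]
      by_cases h : D.trk n a i < n
      · rw [dif_pos h] at hk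
        simp [hk]
      · rw [dif_neg h] at hk
        -- There is no input gate for a bit position `≥ n`, but such a bit vanishes because the
        -- input has length at most `n`, in agreement with the empty `or` gate.
        have h2 : (x j).testBit (D.trk n a i) = false := by
          apply Nat.testBit_lt_two_pow
          exact (Nat.size_le.1 (hx j)).trans_le (Nat.pow_le_pow_right (by norm_num) (not_lt.1 h))
        simp [hk, hpre, h2]
    | orc S i j =>
      simp only [h1] at hk hpre
      simp only [Instr.sem]
      by_cases h : S n (D.trk n a i) (D.trk n a j)
      · rw [if_pos h] at hk
        simp [hk, hpre, h]
      · rw [if_neg h] at hk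
        simp [hk, hpre, h]
    | not s =>
      simp only [h1] at hk hpre
      have hs : s < t := hok
      simp only [hk, Instr.sem]
      rw [decide_eq_true_iff]
      let b : Fin (D.size n) := ⟨D.name n s (D.trk n a), Data.name_lt (hs.trans hlen)⟩
      have htr : D.trk n b = D.trk n a := by
        funext j
        by_cases hj : j < D.R
        · exact Data.trk_name hj (Data.trk_lt _ _ _)
        · rw [Data.trk_of_le (by omega), Data.trk_of_le (by omega)]
      have hb : ∀ b', b' ∈ (D.circuit n).preds a ↔ b' = b := by
        intro b'
        rw [hpre]
        constructor
        · rintro ⟨h2, h3⟩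
          refine Fin.ext (Data.eq_of_trk (D := D) (n := n) ?_ ?_)
          · rw [h2]
            exact (Data.tg_name _ _ _).symm
          · intro j hj
            rw [htr]
            exact (h3 ⟨j, hj⟩).symm
        · rintro rfl
          refine ⟨Data.tg_name _ _ _, fun j => ?_⟩
          rw [htr]
      have h2 := ih s hs b (Data.tg_name _ _ _)
      rw [htr] at h2
      rw [← h2]
      simp [hb]
    | maj i s s' =>
      simp only [h1] at hk hpre
      obtain ⟨hi, hs, hs', hne⟩ := hok
      simp only [hk, Instr.sem]
      rw [decide_eq_true_iff]
      have hP : (D.circuit n).preds a = Finset.univ.filter fun b : Fin (D.size n) =>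
          (D.tg n b = s ∨ D.tg n b = s') ∧
            ∀ j : Fin D.R, (j : ℕ) ≠ i → (j : ℕ) ≠ i + 1 → D.trk n a j = D.trk n b j := by
        ext b
        rw [hpre]
        simp
      have hsplit : ∀ p : Fin (D.size n) → Prop, ((D.circuit n).preds a |>.filter p).card =
          (Finset.univ.filter fun b : Fin (D.size n) => (D.tg n b = s ∧ ∀ j : Fin D.R, (j : ℕ) ≠ i →
            (j : ℕ) ≠ i + 1 → D.trk n a j = D.trk n b j) ∧ p b).card +
          (Finset.univ.filter fun b : Fin (D.size n) => (D.tg n b = s' ∧ ∀ j : Fin D.R, (j : ℕ) ≠ i →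
            (j : ℕ) ≠ i + 1 → D.trk n a j = D.trk n b j) ∧ p b).card := by
        intro p
        rw [← Finset.card_union_of_disjoint]
        · congr 1
          ext b
          have hb := hpre b
          simp only [Finset.mem_filter, Finset.mem_univ, true_and, Finset.mem_union] at hb ⊢
          rw [hb]
          tauto
        · rw [Finset.disjoint_left]
          intro b hb hb'
          simp only [Finset.mem_filter, Finset.mem_univ, true_and] at hb hb'
          exact hne (hb.1.1.symm.trans hb'.1.1)
      -- Each of the two instructions contributes `bd D.c n * bd D.c n` predecessors, so a majority
      -- of them means more than that number of true values.
      have hfull : ((D.circuit n).preds a).card = bd D.c n * bd D.c n + bd D.c n * bd D.c n := by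
        rw [← pairCount_true]
        have h2 := hsplit fun _ => True
        rw [pairCount_eq (hs.trans hlen) hi _ (fun _ => True) x (by simp),
          pairCount_eq (hs'.trans hlen) hi _ (fun _ => True) x (by simp)] at h2
        simpa using h2
      have htrue := hsplit fun b => (D.circuit n).eval x b = true
      rw [pairCount_eq (hs.trans hlen) hi _ (progSem D.c D.l s) x (fun b hb => ih s hs b hb),
        pairCount_eq (hs'.trans hlen) hi _ (progSem D.c D.l s') x (fun b hb => ih s' hs' b hb)] at htrue
      have key : ∀ N, N = (pairCount (bd D.c n) fun z w => progSem D.c D.l s (Env.upd ⟨n, x, D.trk n a⟩ i z w)) +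
            pairCount (bd D.c n) (fun z w => progSem D.c D.l s' (Env.upd ⟨n, x, D.trk n a⟩ i z w)) →
          (((D.circuit n).preds a).card < 2 * N ↔ bd D.c n * bd D.c n <
            (pairCount (bd D.c n) fun z w => progSem D.c D.l s (Env.upd ⟨n, x, D.trk n a⟩ i z w)) +
            pairCount (bd D.c n) fun z w => progSem D.c D.l s' (Env.upd ⟨n, x, D.trk n a⟩ i z w)) := by
        intro N hN
        rw [hN, hfull]
        omega
      refine key _ ?_
      convert htrue

end ProgCircuit

/-! ### Uniformity, depth and size of the circuit -/

namespace ProgCircuit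

variable {D : Data k}

/-- The relation that decides, for a node with instruction `i` and for the values of its variables,
whether it is labelled with the operation `t`. -/
def opRel (t : GateOp) (i : Option (Instr k)) (n a b : ℕ) : Prop :=
  match t, i with
  | .or, none => True
  | .or, some (.inp _ _) => ¬ (a < n ∧ a = b)
  | .or, some (.orc S _ _) => ¬ S n a b
  | .and, some (.orc S _ _) => S n a b
  | .not, some (.not _) => True
  | .maj, some (.maj _ _ _) => True
  | _, _ => False

/-- The relation that decides whether a node is labelled with a bit of the `j`-th input. -/
def inpRel (j : Fin k) (i : Option (Instr k)) (n a b : ℕ) : Prop :=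
  match i with
  | some (.inp j' _) => j' = j ∧ a < n ∧ a = b
  | _ => False

theorem dLogTime_opRel {R t' : ℕ} (t : GateOp) (i : Option (Instr k))
    (hi : ∀ i', i = some i' → i'.Ok R t') : DLogTime (opRel t i) := by
  rcases i with _ | (_ | ⟨S, _, _⟩ | _ | _)
  · cases t
    exacts [DLogTime.false, DLogTime.true, DLogTime.false, DLogTime.false]
  · cases t
    exacts [DLogTime.false, DLogTime.lt_and_eq.not, DLogTime.false, DLogTime.false]
  · have hS : DLogTime S := (hi _ rfl).1
    cases t
    exacts [hS, hS.not, DLogTime.false, DLogTime.false]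
  · cases t
    exacts [DLogTime.false, DLogTime.false, DLogTime.true, DLogTime.false]
  · cases t
    exacts [DLogTime.false, DLogTime.false, DLogTime.false, DLogTime.true]

theorem dLogTime_inpRel (j : Fin k) (i : Option (Instr k)) : DLogTime (inpRel j i) := by
  rcases i with _ | (⟨j', _⟩ | _ | _ | _)
  · exact DLogTime.false
  · by_cases h : j' = j
    · exact DLogTime.lt_and_eq.congr fun n a b => by simp [inpRel, h]
    · exact DLogTime.false.congr fun n a b => by simp [inpRel, h]
  · exact DLogTime.false
  · exact DLogTime.false
  · exact DLogTime.false

/-- The first and the second variable of an instruction. -/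
def src1 (i : Option (Instr k)) : Source :=
  match i with
  | some (.inp _ v) => .fstTrack v
  | some (.orc _ v _) => .fstTrack v
  | _ => .zero

def src2 (i : Option (Instr k)) : Source :=
  match i with
  | some (.inp _ v) => .fstTrack v
  | some (.orc _ _ w) => .fstTrack w
  | _ => .zero

theorem src1_lt {s j : ℕ} (h : src1 D.l[s]? = .fstTrack j ∨ src1 D.l[s]? = .sndTrack j) : j < D.R := by
  unfold src1 at h
  rcases h1 : D.l[s]? with _ | (_ | _ | _ | _) <;> simp [h1] at h
  · rw [← h]; exact D.hl _ _ h1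
  · rw [← h]; exact (D.hl _ _ h1).2.1

theorem src2_lt {s j : ℕ} (h : src2 D.l[s]? = .fstTrack j ∨ src2 D.l[s]? = .sndTrack j) : j < D.R := by
  unfold src2 at h
  rcases h1 : D.l[s]? with _ | (_ | _ | _ | _) <;> simp [h1] at h
  · rw [← h]; exact D.hl _ _ h1
  · rw [← h]; exact (D.hl _ _ h1).2.2

theorem kind_eq_op_iff (n a b : ℕ) (t : GateOp) : D.kind n a = .op t ↔
    opRel t D.l[D.tg n a]? n ((src1 D.l[D.tg n a]?).val D.R (D.W n) a b 0)
      ((src2 D.l[D.tg n a]?).val D.R (D.W n) a b 0) := by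
  classical
  unfold Data.kind
  rcases h1 : D.l[D.tg n a]? with _ | (⟨j, i⟩ | ⟨S, i, j⟩ | _ | _)
  · cases t <;> simp [opRel]
  · have hi : i < D.R := D.hl _ _ h1
    simp only [src1, src2, Source.val_fstTrack hi]
    change dite (D.trk n a i < n) _ _ = _ ↔ _
    by_cases h : D.trk n a i < n
    · rw [dif_pos h]
      cases t <;> (simp [opRel]; try exact h)
    · rw [dif_neg h]
      cases t <;> (simp [opRel]; try exact not_lt.1 h)
  · obtain ⟨-, hi, hj⟩ := D.hl _ _ h1
    simp only [src1, src2, Source.val_fstTrack hi, Source.val_fstTrack hj]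
    by_cases h : S n (D.trk n a i) (D.trk n a j)
    · rw [if_pos h]
      cases t <;> (simp [opRel]; try exact h)
    · rw [if_neg h]
      cases t <;> (simp [opRel]; try exact h)
  · cases t <;> simp [opRel]
  · cases t <;> simp [opRel]

theorem dLogTime_op (t : GateOp) : DLogTime fun n a _ =>
    ∃ ha : a < (D.circuit n).size, (D.circuit n).kind ⟨a, ha⟩ = GateKind.op t := by
  -- The tag selects the relation to call. All tags beyond the program share the last index, at
  -- which the list lookup gives `none`.
  have h := DLogTime.names (ι := Fin (D.l.length + 1)) (S := fun i => opRel t D.l[(i : ℕ)]?)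
    (fun i => dLogTime_opRel (R := D.R) (t' := i) t _ fun i' hi => D.hl _ _ hi) D.R D.c D.width D.hR D.hc
    false (fun s _ => src1 D.l[s]?) (fun s _ => src2 D.l[s]?)
    (fun s t j h => h.elim src1_lt src2_lt) (fun s _ _ _ => Fin.ofNat _ (min s D.l.length))
  refine h.congr fun n a b => ?_
  have hget : ∀ s : ℕ, D.l[(Fin.ofNat (D.l.length + 1) (min s D.l.length) : ℕ)]? = D.l[s]? := by
    intro s
    rw [Fin.val_ofNat, Nat.mod_eq_of_lt (by omega)]
    rcases le_total s D.l.length with h | h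
    · rw [min_eq_left h]
    · rw [min_eq_right h, List.getElem?_eq_none le_rfl, List.getElem?_eq_none h]
  simp only [hget, Bool.false_eq_true, false_implies, true_and]
  constructor
  · rintro ⟨h1, h2⟩
    exact ⟨h1, (kind_eq_op_iff n a _ t).2 h2⟩
  · rintro ⟨h1, h2⟩
    exact ⟨h1, (kind_eq_op_iff n a _ t).1 h2⟩

theorem lt_two_pow_blk (n : ℕ) : n < 2 ^ blk n := by
  unfold blk
  have h1 := Nat.le_pow_clog one_lt_two n
  rw [pow_succ]
  have := Nat.two_pow_pos (Nat.clog 2 n)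
  omega

theorem dLogTime_input (j : Fin k) : DLogTime fun n a i =>
    ∃ (ha : a < (D.circuit n).size) (hi : i < n),
      (D.circuit n).kind ⟨a, ha⟩ = GateKind.input j ⟨i, hi⟩ := by
  -- The second argument is a plain bit index here, not a name. An index below `n` has tag `0` and
  -- is then recovered as the whole second number; any other tag leads to rejection.
  have h := DLogTime.names (ι := Option (Fin (D.l.length + 1)))
    (S := fun i => inpRel j (i.bind fun i => D.l[(i : ℕ)]?))
    (fun i => dLogTime_inpRel j _) D.R D.c D.width D.hR D.hc
    true (fun s _ => src1 D.l[s]?) (fun _ _ => .snd)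
    (fun s t j h => h.elim src1_lt (by simp))
    (fun s t _ _ => if t = 0 then some (Fin.ofNat _ (min s D.l.length)) else none)
  refine h.congr fun n a b => ?_
  have hget : ∀ s : ℕ, D.l[(Fin.ofNat (D.l.length + 1) (min s D.l.length) : ℕ)]? = D.l[s]? := by
    intro s
    rw [Fin.val_ofNat, Nat.mod_eq_of_lt (by omega)]
    rcases le_total s D.l.length with h | h
    · rw [min_eq_left h]
    · rw [min_eq_right h, List.getElem?_eq_none le_rfl, List.getElem?_eq_none h]
  have hkind : (∃ hi : b < n, D.kind n a = GateKind.input j ⟨b, hi⟩) ↔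
      ∃ i, D.l[D.tg n a]? = some (.inp j i) ∧ D.trk n a i < n ∧ D.trk n a i = b := by
    classical
    unfold Data.kind
    rcases h1 : D.l[D.tg n a]? with _ | (⟨j', i⟩ | ⟨S, i, j⟩ | _ | _)
    · simp
    · simp only [Option.some.injEq, Instr.inp.injEq]
      by_cases h : D.trk n a i < n
      · simp only [dif_pos h, GateKind.input.injEq, Fin.mk.injEq]
        constructor
        · rintro ⟨h2, h3, h4⟩
          exact ⟨i, ⟨h3, rfl⟩, h, h4⟩
        · rintro ⟨i', ⟨h2, rfl⟩, h3, h4⟩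
          exact ⟨h4 ▸ h3, h2, h4⟩
      · simp only [dif_neg h]
        constructor
        · rintro ⟨_, ⟨⟩⟩
        · rintro ⟨i', ⟨h2, rfl⟩, h3, h4⟩
          exact absurd h3 h
    · constructor
      · rintro ⟨_, h2⟩
        simp only at h2
        split_ifs at h2
      · rintro ⟨_, ⟨⟩, _⟩
    · simp
    · simp
  change _ ↔ ∃ (_ : a < 2 ^ (D.R * (D.c * blk n) + D.width)) (hi : b < n),
    D.kind n a = GateKind.input j ⟨b, hi⟩
  refine (and_congr_right fun ha => ?_).trans exists_prop.symm
  rw [hkind]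
  set L := D.R * (D.c * blk n) + D.width with hL
  have hnlt : n < 2 ^ (D.R * (D.c * blk n)) := by
    refine (lt_two_pow_blk n).trans_le (Nat.pow_le_pow_right (by norm_num) ?_)
    have := D.hR
    have := D.hc
    calc blk n = 1 * (1 * blk n) := by ring
      _ ≤ _ := Nat.mul_le_mul (by omega) (Nat.mul_le_mul_right _ this)
  have htag0 : ∀ i < n, tag D.R (D.c * blk n) i = 0 := by
    intro i hi
    exact Nat.div_eq_of_lt (hi.trans hnlt)
  have hLle : 2 ^ (D.R * (D.c * blk n)) ≤ 2 ^ L := Nat.pow_le_pow_right (by norm_num) (by omega)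
  constructor
  · rintro ⟨hb, h2⟩
    have hb' : b % 2 ^ L = b := Nat.mod_eq_of_lt (hb rfl)
    rw [hb'] at h2
    by_cases ht : tag D.R (D.c * blk n) b = 0
    · simp only [ht, if_true, Option.bind_some, hget, Source.val_snd ht] at h2
      unfold inpRel at h2
      change match D.l[D.tg n a]? with
        | some (.inp j' _) => _
        | _ => _ at h2
      rcases h1 : D.l[D.tg n a]? with _ | (⟨j', i⟩ | ⟨S, i, j⟩ | _ | _)
      all_goals simp only [h1] at h2
      obtain ⟨rfl, h2, h3⟩ := h2
      refine ⟨i, rfl, ?_⟩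
      have h1' : D.l[tag D.R (D.c * blk n) a]? = some (.inp j' i) := h1
      rw [h1'] at h2 h3
      simp only [src1, Source.val_fstTrack (show i < D.R from D.hl _ _ h1)] at h2 h3
      exact ⟨h2, h3⟩
    · simp only [ht, if_false, Option.bind_none, inpRel] at h2
  · rintro ⟨i, h1, h2, h3⟩
    have hbn : b < n := h3 ▸ h2
    have hb : b < 2 ^ L := hbn.trans (hnlt.trans_le hLle)
    refine ⟨fun _ => hb, ?_⟩
    have hb' : b % 2 ^ L = b := Nat.mod_eq_of_lt hb
    have h1' : D.l[tag D.R (D.c * blk n) a]? = some (.inp j i) := h1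
    simp only [hb', htag0 b hbn, if_true, Option.bind_some, hget, Source.val_snd (htag0 b hbn), h1', inpRel,
      true_and, src1, Source.val_fstTrack (show i < D.R from D.hl _ _ h1)]
    exact ⟨h2, h3⟩

/-- Edges depend only on the two tags and on the set of tracks that agree. The scan leaves both in
its final state, so no further computation is called. -/
theorem dLogTime_edge : DLogTime fun n a b =>
    ∃ (ha : a < (D.circuit n).size) (hb : b < (D.circuit n).size),
      (⟨b, hb⟩ : Fin (D.circuit n).size) ∈ (D.circuit n).preds ⟨a, ha⟩ := by
  have h := DLogTime.names (ι := Prop) (S := fun p _ _ _ => p) DLogTime.const D.R D.c D.width D.hR D.hc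
    true (fun _ _ => .zero) (fun _ _ => .zero) (by simp)
    (fun s t E _ => Data.pattern D.R D.l[s]? t E)
  refine h.congr fun n a b => ?_
  have h1 : ∀ (ha : a < D.size n) (hb : b < D.size n), ((⟨b, hb⟩ : Fin (D.circuit n).size) ∈
      (D.circuit n).preds ⟨a, ha⟩) = D.edge n a b := fun ha hb => propext (mem_preds _ _)
  simp only [h1]
  change _ ↔ ∃ (_ : a < 2 ^ (D.R * (D.c * blk n) + D.width))
    (_ : b < 2 ^ (D.R * (D.c * blk n) + D.width)), D.edge n a b
  refine (and_congr_right fun ha => ?_).trans exists_prop.symm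
  simp only [forall_const]
  refine (and_congr_right fun hb => ?_).trans exists_prop.symm
  rw [Nat.mod_eq_of_lt hb]
  rfl

theorem dLogTime_out : DLogTime fun n i a => ∃ hi : i < (D.circuit n).numOut,
    ((D.circuit n).out ⟨i, hi⟩ : ℕ) = a := by
  -- The output index is the whole first argument and has to equal track `0` of the second; `p`
  -- carries the conditions on tags and vanishing tracks that the scan has checked.
  have hS : ∀ p : Prop, DLogTime fun n x y => p ∧ x < bd D.cOut n ∧ y < bd D.cOut n ∧ x = y := by
    intro p
    by_cases hp : p
    · refine (DLogTime.automaton (fun a b => decide (a = b)) (fun q x y => q && (x == y)) ?_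
        (fun q => q = true) D.hcOut).congr fun n a b => ?_
      · intro a b x y
        rw [Bool.eq_iff_iff]
        cases x <;> cases y <;> simp [Nat.bit_val] <;> omega
      · simp [hp, bd]
    · exact DLogTime.false.congr fun n a b => by simp [hp]
  have h := DLogTime.names hS D.R D.c D.width D.hR D.hc true (fun _ _ => .fst) (fun _ _ => .sndTrack 0)
    (by have := D.hR; simp; omega)
    (fun s t _ Z => s = 0 ∧ t = D.o ∧ ∀ j : Fin D.R, (j : ℕ) ≠ 0 → Z j)
  refine h.congr fun n i a => ?_
  change _ ↔ ∃ _ : i < bd D.cOut n, D.name n D.o (fun j => if j = 0 then i else 0) = a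
  have hR0 : 0 < D.R := by have := D.hR; omega
  have hbd : bd D.cOut n ≤ 2 ^ (D.R * (D.c * blk n)) := by
    refine Nat.pow_le_pow_right (by norm_num) ?_
    have := D.hcOut'
    calc D.cOut * blk n = 1 * (D.cOut * blk n) := by ring
      _ ≤ _ := Nat.mul_le_mul (by omega) (Nat.mul_le_mul_right _ this)
  have hbd' : bd D.cOut n ≤ bd D.c n :=
    Nat.pow_le_pow_right (by norm_num) (Nat.mul_le_mul_right _ D.hcOut')
  have hL : 2 ^ (D.R * (D.c * blk n)) ≤ 2 ^ (D.R * (D.c * blk n) + D.width) :=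
    Nat.pow_le_pow_right (by norm_num) (by omega)
  constructor
  · rintro ⟨h1, h2, ⟨h3, h4, h5⟩, h6, h7, h8⟩
    simp only [Nat.mod_eq_of_lt (h2 rfl)] at h4 h5 h6 h7 h8
    rw [Source.val_fst h3] at h6 h8
    rw [Source.val_sndTrack hR0] at h7 h8
    refine ⟨h6, ?_⟩
    refine Data.eq_of_trk (D := D) (n := n) ?_ ?_
    · rw [Data.tg_name]
      exact h4.symm
    · intro j hj
      rw [Data.trk_name hj]
      · split_ifs with h9
        · rw [h9, h8]
          rfl
        · exact (h5 ⟨j, hj⟩ h9).symm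
      · split_ifs
        · exact h6.trans_le hbd'
        · exact Nat.two_pow_pos _
  · rintro ⟨h1, ha⟩
    have hi0 : tag D.R (D.c * blk n) i = 0 := Nat.div_eq_of_lt (h1.trans_le hbd)
    have hlt : a < 2 ^ (D.R * (D.c * blk n) + D.width) := ha ▸ Data.name_lt D.ho
    have htrk : ∀ j < D.R, D.trk n a j = if j = 0 then i else 0 := by
      intro j hj
      rw [← ha]
      refine Data.trk_name hj ?_
      split_ifs
      · exact h1.trans_le hbd'
      · exact Nat.two_pow_pos _
    have h2 : track D.R (D.c * blk n) a 0 = i := htrk 0 hR0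
    have h3 : tag D.R (D.c * blk n) a = D.o := by
      have := Data.tg_name (D := D) n D.o (fun j => if j = 0 then i else 0)
      rwa [ha] at this
    simp only [Nat.mod_eq_of_lt hlt]
    rw [Source.val_fst hi0, Source.val_sndTrack hR0, h2]
    exact ⟨h1.trans_le (hbd.trans hL), fun _ => hlt,
      ⟨hi0, h3, fun j hj => (htrk j j.2).trans (if_neg hj)⟩, h1, h1, rfl⟩

theorem uniform : DLogTimeUniform D.circuit :=
  ⟨dLogTime_op, dLogTime_input, dLogTime_edge, dLogTime_out⟩

/-- Tags increase strictly along a path and stay below `2 ^ D.width`. -/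
theorem depth_le (n : ℕ) : (D.circuit n).DepthLE (2 ^ D.width) := by
  intro m path h
  have h1 : ∀ i : ℕ, ∀ hi : i < m + 1, i ≤ D.tg n (path ⟨i, hi⟩) := by
    intro i
    induction i with
    | zero => intro _; exact Nat.zero_le _
    | succ i ih =>
      intro hi
      have h2 := ih (by omega)
      have h3 := Data.tg_lt_of_edge ((mem_preds _ _).1 (h ⟨i, by omega⟩))
      have h4 : D.tg n (path ⟨i, by omega⟩) < D.tg n (path ⟨i + 1, hi⟩) := h3
      omega
  have h2 : D.tg n (path ⟨m, by omega⟩) < 2 ^ D.width := by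
    have h3 : (path ⟨m, by omega⟩ : ℕ) < 2 ^ (D.R * D.W n + D.width) := (path ⟨m, by omega⟩).2
    rw [pow_add, mul_comm] at h3
    exact (Nat.div_lt_iff_lt_mul (by positivity)).2 h3
  have := h1 m (by omega)
  omega

/-- Names have a constant multiple of `blk n` bits plus a constant, so this linear bound makes the
size polynomial. -/
theorem two_pow_blk_le (n : ℕ) : 2 ^ blk n ≤ 4 * (n + 1) := by
  rcases Nat.eq_zero_or_pos (n - 1) with h | h
  · have : n = 0 ∨ n = 1 := by omega
    rcases this with rfl | rfl <;> simp [blk]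
  · have h1 := Nat.pow_pred_clog_lt_self one_lt_two (x := n) (by omega)
    have h2 : 0 < Nat.clog 2 n := Nat.clog_pos one_lt_two (by omega)
    have h3 : blk n = (Nat.clog 2 n).pred + 2 := by
      unfold blk
      have := Nat.succ_pred_eq_of_pos h2
      omega
    rw [h3, pow_add]
    omega

theorem size_le : ∃ p : Polynomial ℕ, ∀ n, (D.circuit n).numNodes ≤ p.eval n := by
  refine ⟨(4 * (Polynomial.X + 1)) ^ (D.R * D.c) * 2 ^ D.width + (4 * (Polynomial.X + 1)) ^ D.cOut, fun n => ?_⟩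
  have h : ∀ c, 2 ^ (c * blk n) ≤ (4 * (n + 1)) ^ c := by
    intro c
    rw [mul_comm, pow_mul]
    exact Nat.pow_le_pow_left (two_pow_blk_le n) c
  change 2 ^ (D.R * (D.c * blk n) + D.width) + 2 ^ (D.cOut * blk n) ≤ _
  rw [pow_add, ← mul_assoc]
  simpa using Nat.add_le_add (Nat.mul_le_mul_right (2 ^ D.width) (h (D.R * D.c))) (h D.cOut)

open Classical in
theorem output_circuit (n : ℕ) (x : Fin k → ℕ) (hx : ∀ j, Nat.size (x j) ≤ n) : (D.circuit n).output x =
    ∑ i ∈ Finset.range (bd D.cOut n),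
      if progSem D.c D.l D.o ⟨n, x, fun j => if j = 0 then i else 0⟩ then 2 ^ i else 0 := by
  have hbd' : bd D.cOut n ≤ bd D.c n :=
    Nat.pow_le_pow_right (by norm_num) (Nat.mul_le_mul_right _ D.hcOut')
  have h1 : ∀ i : Fin (D.circuit n).numOut, ((D.circuit n).eval x ((D.circuit n).out i) = true ↔
      progSem D.c D.l D.o ⟨n, x, fun j => if j = 0 then (i : ℕ) else 0⟩) := by
    intro i
    obtain ⟨i, hi⟩ := i
    have h0 := Data.tg_name (D := D) n D.o fun j => if j = 0 then i else 0
    have hlt : (D.name n D.o fun j => if j = 0 then i else 0) < D.size n := Data.name_lt D.ho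
    have h3 := eval_circuit n x hx D.o ⟨_, hlt⟩ h0
    have hi : i < bd D.cOut n := hi
    have h4 : D.trk n (D.name n D.o fun j => if j = 0 then i else 0) = fun j => if j = 0 then i else 0 := by
      funext j
      by_cases hj : j < D.R
      · refine Data.trk_name hj ?_
        split_ifs
        · exact hi.trans_le hbd'
        · exact Nat.two_pow_pos _
      · rw [Data.trk_of_le (by omega), if_neg]
        have := D.hR
        omega
    rw [h4] at h3
    exact h3
  unfold Circuit.output
  simp only [h1]
  exact Fin.sum_univ_eq_sum_range (fun i => if progSem D.c D.l D.o ⟨n, x, fun j => if j = 0 then i else 0⟩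
    then 2 ^ i else 0) (bd D.cOut n)

/-- A function whose bits are computed by a program is in `FTC⁰`. -/
theorem inFTC0 (D : Data k) (F : (Fin k → ℕ) → ℕ)
    (h : ∀ n x, (∀ j, Nat.size (x j) ≤ n) → F x < 2 ^ bd D.cOut n ∧
      ∀ i < bd D.cOut n, ((F x).testBit i = true ↔
        progSem D.c D.l D.o ⟨n, x, fun j => if j = 0 then i else 0⟩)) : InFTC0 F := by
  refine ⟨D.circuit, uniform, size_le, ⟨2 ^ D.width, depth_le⟩, fun n x hx => ?_⟩
  obtain ⟨h1, h2⟩ := h n x hx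
  rw [output_circuit n x hx]
  refine Eq.trans ?_ (Nat.mod_eq_of_lt h1)
  rw [← EqLtMachine.sum_testBit]
  refine Finset.sum_congr rfl fun i hi => ?_
  simp only [← h2 i (Finset.mem_range.1 hi)]

end ProgCircuit

/-! ### Formulas with majority quantifiers -/

theorem one_le_blk (n : ℕ) : 1 ≤ blk n := Nat.le_add_left _ _

theorem bd_pos (c n : ℕ) : 0 < bd c n := Nat.two_pow_pos _

theorem bd_mono {c d : ℕ} (h : c ≤ d) (n : ℕ) : bd c n ≤ bd d n :=
  Nat.pow_le_pow_right (by norm_num) (Nat.mul_le_mul_right _ h)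

theorem bd_add (c d n : ℕ) : bd (c + d) n = bd c n * bd d n := by
  rw [bd, add_mul, pow_add]
  rfl

theorem lt_bd (c n : ℕ) : c < bd c n :=
  Nat.lt_two_pow_self.trans_le (Nat.pow_le_pow_right (by norm_num) (Nat.le_mul_of_pos_right _ (one_le_blk n)))

namespace Env

/-- Add a variable `0` and shift the other variables. -/
def push (e : Env k) (z : ℕ) : Env k :=
  ⟨e.n, e.x, fun i => match i with
    | 0 => z
    | i + 1 => e.v i⟩

/-- Remove the variable `0` and shift the other variables. -/
def pop (e : Env k) : Env k := ⟨e.n, e.x, fun i => e.v (i + 1)⟩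

/-- Rename the variables. -/
def map (σ : ℕ → ℕ) (e : Env k) : Env k := ⟨e.n, e.x, fun i => e.v (σ i)⟩

theorem push_pop (e : Env k) : e.pop.push (e.v 0) = e := by
  refine congrArg (Env.mk e.n e.x) ?_
  funext i
  cases i <;> rfl

/-- The inputs have length at most `n` and the variables are below `bd c n`. -/
def Ok (c : ℕ) (e : Env k) : Prop := (∀ j, Nat.size (e.x j) ≤ e.n) ∧ ∀ i, e.v i < bd c e.n

theorem Ok.mono {c d : ℕ} {e : Env k} (h : e.Ok c) (hd : c ≤ d) : e.Ok d :=
  ⟨h.1, fun i => (h.2 i).trans_le (bd_mono hd _)⟩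

theorem Ok.map {c : ℕ} {e : Env k} (h : e.Ok c) (σ : ℕ → ℕ) : (e.map σ).Ok c :=
  ⟨h.1, fun i => h.2 (σ i)⟩

theorem Ok.pop {c : ℕ} {e : Env k} (h : e.Ok c) : e.pop.Ok c := h.map _

theorem Ok.push {c z : ℕ} {e : Env k} (h : e.Ok c) (hz : z < bd c e.n) : (e.push z).Ok c :=
  ⟨h.1, fun i => by
    cases i with
    | zero => exact hz
    | succ i => exact h.2 i⟩

end Env

/-- The predicates that are given by formulas over input bits and relations decidable in logarithmic
time, with negation and majority quantification over pairs of numbers below `bd c n`. -/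
inductive Base (c : ℕ) : (Env k → Prop) → Prop
  | inp (j : Fin k) (i : ℕ) : Base c fun e => (e.x j).testBit (e.v i) = true
  | orc (S : ℕ → ℕ → ℕ → Prop) (hS : DLogTime S) (i j : ℕ) : Base c fun e => S e.n (e.v i) (e.v j)
  | not {P : Env k → Prop} (hP : Base c P) : Base c fun e => ¬ P e
  | maj {P Q : Env k → Prop} (hP : Base c P) (hQ : Base c Q) : Base c fun e =>
      bd c e.n * bd c e.n < pairCount (bd c e.n) (fun z w => P ((e.push z).push w)) +
        pairCount (bd c e.n) (fun z w => Q ((e.push z).push w))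

theorem Instr.Ok.mono {R R' t : ℕ} {i : Instr k} (h : i.Ok R t) (hR : R ≤ R') : i.Ok R' t := by
  cases i with
  | inp j i => exact lt_of_lt_of_le (show i < R from h) hR
  | orc S i j => exact ⟨h.1, h.2.1.trans_le hR, h.2.2.trans_le hR⟩
  | not s => exact h
  | maj i s s' => exact ⟨h.1.trans_le hR, h.2⟩

theorem ProgOk.mono {R R' : ℕ} {l : List (Instr k)} (h : ProgOk R l) (hR : R ≤ R') : ProgOk R' l :=
  fun t i hi => (h t i hi).mono hR

theorem ProgOk.concat {R : ℕ} {l : List (Instr k)} (h : ProgOk R l) {i : Instr k} (hi : i.Ok R l.length) :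
    ProgOk R (l ++ [i]) := by
  intro t i' ht
  rw [List.getElem?_append] at ht
  split_ifs at ht with h1
  · exact h t i' ht
  · have h2 := (List.getElem?_eq_some_iff.1 ht).1
    have h3 : t = l.length := by simp at h2; omega
    subst h3
    simp at ht
    exact ht ▸ hi

/-! ### Compilation of formulas, and connectives obtained from majority -/

namespace Base

variable {c : ℕ} {P Q : Env k → Prop}

/-- Every formula is equivalent to a program. -/
theorem compile (h : Base c P) : ∀ (l : List (Instr k)) (R : ℕ), ProgOk R l → ∀ (M : ℕ) (σ : ℕ → ℕ),
    (∀ i, σ i < M) → ∃ (l' : List (Instr k)) (R' t : ℕ), R ≤ R' ∧ ProgOk R' (l ++ l') ∧ l.length ≤ t ∧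
      t < (l ++ l').length ∧ ∀ e, progSem c (l ++ l') t e ↔ P (e.map σ) := by
  have hlast : ∀ (l : List (Instr k)) (i : Instr k), (l ++ [i])[l.length]? = some i := by simp
  induction h with
  | inp j i =>
    intro l R hl M σ hσ
    have h1 : ProgOk (max R M) (l ++ [.inp j (σ i)]) := (hl.mono (le_max_left R M)).concat
      ((hσ i).trans_le (le_max_right R M))
    refine ⟨_, _, l.length, le_max_left R M, h1, le_rfl, by simp, fun e => ?_⟩
    rw [progSem_some h1 (hlast _ _)]
    rfl
  | orc S hS i j =>
    intro l R hl M σ hσ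
    have h1 : ProgOk (max R M) (l ++ [.orc S (σ i) (σ j)]) := (hl.mono (le_max_left R M)).concat
      ⟨hS, (hσ i).trans_le (le_max_right R M), (hσ j).trans_le (le_max_right R M)⟩
    refine ⟨_, _, l.length, le_max_left R M, h1, le_rfl, by simp, fun e => ?_⟩
    rw [progSem_some h1 (hlast _ _)]
    rfl
  | @not P hP ih =>
    intro l R hl M σ hσ
    obtain ⟨l1, R1, t1, hR1, hl1, h1, h2, h3⟩ := ih l R hl M σ hσ
    have h4 : ProgOk R1 ((l ++ l1) ++ [.not t1]) := hl1.concat h2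
    refine ⟨l1 ++ [.not t1], R1, (l ++ l1).length, hR1, ?_, ?_, ?_, fun e => ?_⟩
    · rwa [← List.append_assoc]
    · simp
    · simp
    · rw [← List.append_assoc, progSem_some h4 (hlast _ _)]
      exact not_congr ((progSem_append hl1 h4 t1 h2 e).trans (h3 e))
  | @maj P Q hP hQ ih1 ih2 =>
    intro l R hl M σ hσ
    -- The quantified pair is stored in the variables `M` and `M + 1`, which are fresh because `σ`
    -- stays below `M`. The component pushed last is variable `0` of the formula and sits in `M +
    -- 1`.
    let τ : ℕ → ℕ := fun i => match i with
      | 0 => M + 1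
      | 1 => M
      | i + 2 => σ i
    have hτ : ∀ i, τ i < M + 2 := by
      intro i
      rcases i with _ | _ | i
      · exact Nat.lt_succ_self _
      · exact Nat.lt_add_of_pos_right (by norm_num)
      · exact (hσ i).trans (by omega)
    obtain ⟨l1, R1, t1, hR1, hl1, h1, h2, h3⟩ := ih1 l R hl (M + 2) τ hτ
    obtain ⟨l2, R2, t2, hR2, hl2, h4, h5, h6⟩ := ih2 (l ++ l1) R1 hl1 (M + 2) τ hτ
    have h2' : t1 < (l ++ l1 ++ l2).length := h2.trans_le (by simp)
    have h7 : ProgOk (max R2 (M + 2)) (((l ++ l1) ++ l2) ++ [.maj M t1 t2]) :=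
      (hl2.mono (le_max_left R2 (M + 2))).concat
        ⟨lt_of_lt_of_le (by omega) (le_max_right R2 (M + 2)), h2', h5, (h2.trans_le h4).ne⟩
    refine ⟨l1 ++ l2 ++ [.maj M t1 t2], max R2 (M + 2), ((l ++ l1) ++ l2).length,
      (hR1.trans hR2).trans (le_max_left R2 (M + 2)), ?_, ?_, ?_, fun e => ?_⟩
    · simpa only [List.append_assoc] using h7
    · simp
    · simp
    · rw [show l ++ (l1 ++ l2 ++ [.maj M t1 t2]) = ((l ++ l1) ++ l2) ++ [.maj M t1 t2] by
        simp only [List.append_assoc], progSem_some h7 (hlast _ _)]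
      have hmap : ∀ z w, (e.upd M z w).map τ = ((e.map σ).push z).push w := by
        intro z w
        refine congrArg (Env.mk e.n e.x) ?_
        funext i
        rcases i with _ | _ | i
        · simp [Env.upd, τ]
        · simp [Env.upd, τ]
          rfl
        · have := hσ i
          simp only [Env.upd, τ, Env.push, Function.update_apply, Env.map]
          rw [if_neg (by omega), if_neg (by omega)]
      have h8 : ∀ e, progSem c (((l ++ l1) ++ l2) ++ [.maj M t1 t2]) t1 e ↔ P (e.map τ) := fun e =>
        ((progSem_append (hl2.mono (le_max_left R2 (M + 2))) h7 t1 h2' e).trans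
          (progSem_append (hl1.mono hR2) hl2 t1 h2 e)).trans (h3 e)
      have h9 : ∀ e, progSem c (((l ++ l1) ++ l2) ++ [.maj M t1 t2]) t2 e ↔ Q (e.map τ) := fun e =>
        (progSem_append (hl2.mono (le_max_left R2 (M + 2))) h7 t2 h5 e).trans (h6 e)
      simp only [Instr.sem, h8, h9, hmap]
      rfl

theorem rename (h : Base c P) : ∀ σ : ℕ → ℕ, Base c fun e => P (e.map σ) := by
  induction h with
  | inp j i => exact fun σ => .inp j (σ i)
  | orc S hS i j => exact fun σ => .orc S hS (σ i) (σ j)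
  | not hP ih => exact fun σ => .not (ih σ)
  | @maj P Q hP hQ ih1 ih2 =>
    intro σ
    let τ : ℕ → ℕ := fun i => match i with
      | 0 => 0
      | 1 => 1
      | i + 2 => σ i + 2
    have hmap : ∀ (e : Env k) z w, (((e.map σ).push z).push w) = ((e.push z).push w).map τ := by
      intro e z w
      refine congrArg (Env.mk e.n e.x) ?_
      funext i
      rcases i with _ | _ | i <;> rfl
    simp only [hmap]
    exact .maj (ih1 τ) (ih2 τ)

theorem pairCount_false (B : ℕ) : pairCount B (fun _ _ => False) = 0 := by
  simp [pairCount]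

theorem pairCount_not (B : ℕ) (p : ℕ → ℕ → Prop) :
    pairCount B p + pairCount B (fun z w => ¬ p z w) = B * B := by
  classical
  have := Finset.card_filter_add_card_filter_not (s := Finset.range B ×ˢ Finset.range B)
    (fun z : ℕ × ℕ => p z.1 z.2)
  rw [Finset.card_product, Finset.card_range] at this
  rw [← this]
  unfold pairCount
  congr!

theorem const (p : Prop) : Base (k := k) c fun _ => p :=
  .orc (fun _ _ _ => p) (DLogTime.const p) 0 0

/-- Voting with `P` and `¬ Q`: the sum of the two counts exceeds the number of all pairs exactly if
`P` has more solutions than `Q`. -/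
theorem card_lt (hP : Base c P) (hQ : Base c Q) : Base c fun e =>
    pairCount (bd c e.n) (fun z w => Q ((e.push z).push w)) <
      pairCount (bd c e.n) (fun z w => P ((e.push z).push w)) := by
  have h := Base.maj hP hQ.not
  refine cast (congrArg _ (funext fun e => propext ?_)) h
  have := pairCount_not (bd c e.n) fun z w => Q ((e.push z).push w)
  omega

-- If the votes do not depend on the quantified pair, each count is zero or the number of all pairs,
-- and the sum exceeds the latter only if both predicates hold.
open Classical in
theorem and (hP : Base c P) (hQ : Base c Q) : Base c fun e => P e ∧ Q e := by
  have h := Base.maj (hP.rename (· + 2)) (hQ.rename (· + 2))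
  refine cast (congrArg _ (funext fun e => propext ?_)) h
  have h1 : ∀ p : Prop, pairCount (bd c e.n) (fun _ _ => p) = if p then bd c e.n * bd c e.n else 0 := by
    intro p
    by_cases hp : p
    · simp [hp, ProgCircuit.pairCount_true]
    · simp [hp, pairCount_false]
  have h2 := Nat.mul_pos (bd_pos c e.n) (bd_pos c e.n)
  have h3 : ∀ (z w : ℕ), Env.map (· + 2) ((e.push z).push w) = e := fun _ _ => rfl
  simp only [h3]
  rw [h1, h1]
  by_cases hp : P e <;> by_cases hq : Q e <;> simp only [hp, hq, if_true, if_false, and_true,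
    and_false, iff_true, iff_false] <;> omega

end Base

/-! ### Definable predicates and definable small numbers -/

/-- A predicate is definable if it is given by a formula, as long as the variables are bounded. -/
def DefP (P : Env k → Prop) : Prop :=
  -- All quantifiers of a formula share one range `bd C n`. Allowing every large `C` makes it
  -- possible to combine definable predicates after raising `C` to a common value.
  ∀ c, ∃ C₀, ∀ C ≥ C₀, ∃ P', Base C P' ∧ ∀ e, Env.Ok c e → (P e ↔ P' e)

/-- The values are polynomially bounded. -/
def PolyBdd (t : Env k → ℕ) : Prop := ∀ c, ∃ d, ∀ e, Env.Ok c e → t e < bd d e.n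

/-- The values are polynomially bounded, and the graph is definable. -/
def DefN (t : Env k → ℕ) : Prop := PolyBdd t ∧ DefP fun e => t e.pop = e.v 0

namespace PolyBdd

variable {s t : Env k → ℕ}

theorem of_le (ht : PolyBdd t) (h : ∀ c e, Env.Ok c e → s e ≤ t e) : PolyBdd s := by
  intro c
  obtain ⟨d, hd⟩ := ht c
  exact ⟨d, fun e he => (h c e he).trans_lt (hd e he)⟩

theorem const (m : ℕ) : PolyBdd (k := k) fun _ => m := fun _ => ⟨m, fun _ _ => lt_bd _ _⟩

theorem var (i : ℕ) : PolyBdd (k := k) fun e => e.v i := fun c => ⟨c, fun _ he => he.2 i⟩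

theorem length : PolyBdd (k := k) fun e => e.n := fun _ =>
  ⟨1, fun e _ => by simpa [bd] using ProgCircuit.lt_two_pow_blk e.n⟩

theorem add_mul (hs : PolyBdd s) (ht : PolyBdd t) : PolyBdd fun e => s e + t e + s e * t e := by
  intro c
  obtain ⟨d, hd⟩ := hs c
  obtain ⟨d', hd'⟩ := ht c
  refine ⟨d + d', fun e he => ?_⟩
  have h : (s e + 1) * (t e + 1) ≤ bd d e.n * bd d' e.n := Nat.mul_le_mul (hd e he) (hd' e he)
  rw [bd_add]
  nlinarith

theorem add (hs : PolyBdd s) (ht : PolyBdd t) : PolyBdd fun e => s e + t e :=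
  (hs.add_mul ht).of_le fun _ _ _ => Nat.le_add_right _ _

theorem mul (hs : PolyBdd s) (ht : PolyBdd t) : PolyBdd fun e => s e * t e :=
  (hs.add_mul ht).of_le fun _ _ _ => Nat.le_add_left _ _

theorem map (ht : PolyBdd t) (σ : ℕ → ℕ) : PolyBdd fun e => t (e.map σ) := by
  intro c
  obtain ⟨d, hd⟩ := ht c
  exact ⟨d, fun e he => hd _ (he.map σ)⟩

theorem subst (hs : PolyBdd s) (ht : PolyBdd t) : PolyBdd fun e => s (e.push (t e)) := by
  intro c
  obtain ⟨d, hd⟩ := ht c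
  obtain ⟨d', hd'⟩ := hs (max c d)
  exact ⟨d', fun e he => hd' (e.push (t e)) ((he.mono (le_max_left _ _)).push
    ((hd e he).trans_le (bd_mono (le_max_right _ _) _)))⟩

end PolyBdd

namespace DefP

variable {P Q : Env k → Prop}

theorem congr (hP : DefP P) (h : ∀ c e, Env.Ok c e → (P e ↔ Q e)) : DefP Q := by
  intro c
  obtain ⟨C, hC⟩ := hP c
  refine ⟨C, fun C' hC' => ?_⟩
  obtain ⟨P', h1, h2⟩ := hC C' hC'
  exact ⟨P', h1, fun e he => (h c e he).symm.trans (h2 e he)⟩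

theorem const (p : Prop) : DefP (k := k) fun _ => p :=
  fun _ => ⟨0, fun _ _ => ⟨_, Base.const p, fun _ _ => Iff.rfl⟩⟩

theorem inp (j : Fin k) (i : ℕ) : DefP fun e : Env k => (e.x j).testBit (e.v i) = true :=
  fun _ => ⟨0, fun _ _ => ⟨_, Base.inp j i, fun _ _ => Iff.rfl⟩⟩

theorem orc {S : ℕ → ℕ → ℕ → Prop} (hS : DLogTime S) (i j : ℕ) :
    DefP fun e : Env k => S e.n (e.v i) (e.v j) :=
  fun _ => ⟨0, fun _ _ => ⟨_, Base.orc S hS i j, fun _ _ => Iff.rfl⟩⟩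

theorem not (hP : DefP P) : DefP fun e => ¬ P e := by
  intro c
  obtain ⟨C, hC⟩ := hP c
  refine ⟨C, fun C' hC' => ?_⟩
  obtain ⟨P', h1, h2⟩ := hC C' hC'
  exact ⟨_, h1.not, fun e he => not_congr (h2 e he)⟩

theorem and (hP : DefP P) (hQ : DefP Q) : DefP fun e => P e ∧ Q e := by
  intro c
  obtain ⟨C, hC⟩ := hP c
  obtain ⟨D, hD⟩ := hQ c
  refine ⟨max C D, fun C' hC' => ?_⟩
  obtain ⟨P', h1, h2⟩ := hC C' ((le_max_left _ _).trans hC')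
  obtain ⟨Q', h3, h4⟩ := hD C' ((le_max_right _ _).trans hC')
  exact ⟨_, h1.and h3, fun e he => and_congr (h2 e he) (h4 e he)⟩

theorem or (hP : DefP P) (hQ : DefP Q) : DefP fun e => P e ∨ Q e :=
  (hP.not.and hQ.not).not.congr fun _ _ _ => by tauto

theorem imp (hP : DefP P) (hQ : DefP Q) : DefP fun e => P e → Q e :=
  (hP.and hQ.not).not.congr fun _ _ _ => by tauto

theorem iff (hP : DefP P) (hQ : DefP Q) : DefP fun e => P e ↔ Q e :=
  ((hP.imp hQ).and (hQ.imp hP)).congr fun _ _ _ => by tauto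

theorem map (hP : DefP P) (σ : ℕ → ℕ) : DefP fun e => P (e.map σ) := by
  intro c
  obtain ⟨C, hC⟩ := hP c
  refine ⟨C, fun C' hC' => ?_⟩
  obtain ⟨P', h1, h2⟩ := hC C' hC'
  exact ⟨_, h1.rename σ, fun e he => h2 _ (he.map σ)⟩

theorem pop (hP : DefP P) : DefP fun e => P e.pop := hP.map (· + 1)

theorem congr_cast {P Q : Env k → Prop} (hP : DefP P) (h : ∀ e, P e ↔ Q e) : DefP Q :=
  hP.congr fun _ e _ => h e

end DefP

/-- The guard restricts quantification over a range `bd C n` to a smaller range `bd d n`. -/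
theorem dLogTime_guard {d : ℕ} (hd : 2 ≤ d) : DLogTime fun n a b => a < bd d n ∧ b < bd d n :=
  (DLogTime.automaton (fun _ _ => ()) (fun _ _ _ => ()) (fun _ _ _ _ => rfl) (fun _ => True) hd).congr
    fun n a b => by simp [bd]

/-- A definable relation between pairs of small numbers. -/
structure DefR (P : Env k → ℕ → ℕ → Prop) : Prop where
  bdd : ∀ c, ∃ d, ∀ e, Env.Ok c e → ∀ z w, P e z w → z < bd d e.n ∧ w < bd d e.n
  def' : DefP fun e => P e.pop.pop (e.v 1) (e.v 0)

/-- All solutions lie below a bound `bd d n`. With the guard added, counting over any larger range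
gives the same number, and the guarded values satisfy the bound under which the formula is correct.
-/
theorem DefR.exists_base {P : Env k → ℕ → ℕ → Prop} (hP : DefR P) (c : ℕ) : ∃ C₀, ∀ C ≥ C₀,
    ∃ P', Base C P' ∧ ∀ e, Env.Ok c e → pairCount (bd C e.n) (fun z w => P' ((e.push z).push w)) =
      {p : ℕ × ℕ | P e p.1 p.2}.ncard := by
  obtain ⟨d, hd⟩ := hP.bdd c
  obtain ⟨C, hC⟩ := hP.def' (max (max c d) 2)
  refine ⟨max C (max (max c d) 2), fun C' hC' => ?_⟩
  obtain ⟨P', h1, h2⟩ := hC C' ((le_max_left _ _).trans hC')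
  refine ⟨_, (Base.orc _ (dLogTime_guard (le_max_right (max c d) 2)) 1 0).and h1, fun e he => ?_⟩
  unfold pairCount
  rw [← Set.ncard_coe_finset]
  congr 1
  ext ⟨z, w⟩
  simp only [Finset.coe_filter, Finset.mem_product, Finset.mem_range, Set.mem_ofPred_eq]
  have hmono : bd (max (max c d) 2) e.n ≤ bd C' e.n := bd_mono ((le_max_right _ _).trans hC') _
  have hmono' : bd d e.n ≤ bd (max (max c d) 2) e.n :=
    bd_mono ((le_max_right c d).trans (le_max_left _ _)) _
  have key : z < bd (max (max c d) 2) e.n → w < bd (max (max c d) 2) e.n →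
      (P e z w ↔ P' ((e.push z).push w)) := by
    intro hz hw
    refine h2 ((e.push z).push w) (((he.mono ?_).push hz).push hw)
    exact (le_max_left c d).trans (le_max_left _ _)
  constructor
  · rintro ⟨-, ⟨h3, h4⟩, h5⟩
    exact (key h3 h4).2 h5
  · intro h
    obtain ⟨h3, h4⟩ := hd e he z w h
    have h3' := h3.trans_le hmono'
    have h4' := h4.trans_le hmono'
    exact ⟨⟨h3'.trans_le hmono, h4'.trans_le hmono⟩, ⟨h3', h4'⟩, (key h3' h4').1 h⟩

theorem DefR.finite {P : Env k → ℕ → ℕ → Prop} (hP : DefR P) {c : ℕ} {e : Env k} (he : e.Ok c) :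
    {p : ℕ × ℕ | P e p.1 p.2}.Finite := by
  obtain ⟨d, hd⟩ := hP.bdd c
  refine ((Finset.range (bd d e.n) ×ˢ Finset.range (bd d e.n)).finite_toSet).subset ?_
  rintro ⟨z, w⟩ h
  simpa using hd e he z w h

namespace DefP

theorem ncard_lt {P Q : Env k → ℕ → ℕ → Prop} (hP : DefR P) (hQ : DefR Q) :
    DefP fun e => {p : ℕ × ℕ | P e p.1 p.2}.ncard < {p : ℕ × ℕ | Q e p.1 p.2}.ncard := by
  intro c
  obtain ⟨C, hC⟩ := hP.exists_base c
  obtain ⟨D, hD⟩ := hQ.exists_base c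
  refine ⟨max C D, fun C' hC' => ?_⟩
  obtain ⟨P', h1, h2⟩ := hC C' ((le_max_left _ _).trans hC')
  obtain ⟨Q', h3, h4⟩ := hD C' ((le_max_right _ _).trans hC')
  refine ⟨_, h3.card_lt h1, fun e he => ?_⟩
  rw [h2 e he, h4 e he]

/-- Existential quantification over pairs of small numbers. -/
theorem ex_pair {P : Env k → ℕ → ℕ → Prop} (hP : DefR P) : DefP fun e => ∃ z w, P e z w := by
  have hF : DefR fun (_ : Env k) _ _ => False := ⟨fun _ => ⟨0, by simp⟩, const _⟩
  refine (ncard_lt hF hP).congr fun c e he => ?_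
  simp only [Set.ofPred_false, Set.ncard_empty]
  rw [Set.ncard_pos (hP.finite he)]
  exact ⟨fun ⟨⟨z, w⟩, h⟩ => ⟨z, w, h⟩, fun ⟨z, w, h⟩ => ⟨⟨z, w⟩, h⟩⟩

/-- Relations between the variables that are recognized by a finite automaton. -/
theorem automaton {Q : Type} [Finite Q] (Φ : ℕ → ℕ → Q) (δ : Q → Bool → Bool → Q)
    (hΦ : ∀ a b x y, Φ (Nat.bit x a) (Nat.bit y b) = δ (Φ a b) x y) (A : Q → Prop) (i j : ℕ) :
    DefP fun e : Env k => A (Φ (e.v i) (e.v j)) := by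
  intro c
  refine ⟨0, fun C _ => ⟨_, Base.orc _ (DLogTime.automaton Φ δ hΦ A (le_max_right c 2)) i j, ?_⟩⟩
  intro e he
  have h1 := (he.mono (le_max_left c 2)).2
  exact ⟨fun h => ⟨h1 i, h1 j, h⟩, fun h => h.2.2⟩

/-- Digits are read most significant first, so a strict comparison of the leading parts is final and
later digits count only after a tie: the three outcomes of `compare` suffice as states. -/
theorem var_lt (i j : ℕ) : DefP fun e : Env k => e.v i < e.v j := by
  refine (automaton (fun a b => compare a b) (fun o x y => o.then (compare x y)) ?_
    (fun o => o = .lt) i j).congr_cast fun e => compare_lt_iff_lt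
  intro a b x y
  rcases lt_trichotomy a b with h | h | h
  · rw [compare_lt_iff_lt.2 h, compare_lt_iff_lt.2]
    · rfl
    · cases x <;> cases y <;> simp [Nat.bit_val] <;> omega
  · subst h
    rw [compare_eq_iff_eq.2 rfl]
    cases x <;> cases y
    · simp
    · exact compare_lt_iff_lt.2 (by simp [Nat.bit_val])
    · exact compare_gt_iff_gt.2 (by simp [Nat.bit_val])
    · simp
  · rw [compare_gt_iff_gt.2 h, compare_gt_iff_gt.2]
    · rfl
    · cases x <;> cases y <;> simp [Nat.bit_val] <;> omega

theorem var_eq (i j : ℕ) : DefP fun e : Env k => e.v i = e.v j :=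
  ((var_lt i j).or (var_lt j i)).not.congr_cast fun e => by omega

/-- When one argument is a power of two this tests a single bit; that is its use in `DefP.testBit`.
-/
theorem var_land (i j : ℕ) : DefP fun e : Env k => e.v i &&& e.v j ≠ 0 := by
  refine (automaton (fun a b => decide (a &&& b ≠ 0)) (fun o x y => o || (x && y)) ?_
    (fun o => o = true) i j).congr_cast fun e => by simp
  intro a b x y
  have : Nat.bit x a &&& Nat.bit y b = Nat.bit (x && y) (a &&& b) := Nat.land_bit _ _ _ _
  rw [this, Bool.eq_iff_iff]
  cases x <;> cases y <;> simp [Nat.bit_val]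

theorem var_isPow (i : ℕ) : DefP fun e : Env k => ∃ m, e.v i = 2 ^ m := by
  classical
  refine (automaton (fun a _ => (decide (a = 0), decide (∃ m, a = 2 ^ m)))
    (fun o x _ => (o.1 && !x, (x && o.1) || (!x && o.2))) ?_
    (fun o => o.2 = true) i i).congr_cast fun e => by simp
  intro a b x y
  have h : (∃ m, Nat.bit x a = 2 ^ m) ↔ (x = true ∧ a = 0) ∨ (x = false ∧ ∃ m, a = 2 ^ m) := by
    constructor
    · rintro ⟨m, hm⟩
      cases m with
      | zero => cases x <;> simp [Nat.bit_val] at hm ⊢ <;> omega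
      | succ m =>
        rw [pow_succ] at hm
        cases x
        · exact Or.inr ⟨rfl, m, by simp [Nat.bit_val] at hm; omega⟩
        · simp [Nat.bit_val] at hm; omega
    · rintro (⟨rfl, rfl⟩ | ⟨rfl, m, rfl⟩)
      · exact ⟨0, rfl⟩
      · exact ⟨m + 1, by simp [Nat.bit_val, pow_succ, mul_comm]⟩
  refine Prod.ext ?_ ?_
  · rw [Bool.eq_iff_iff]
    cases x <;> simp [Nat.bit_val]
  · rw [Bool.eq_iff_iff]
    simp only [decide_eq_true_eq, h]
    cases x <;> simp

theorem var_lt_length (i : ℕ) : DefP fun e : Env k => e.v i < e.n :=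
  (orc DLogTime.lt_and_eq i i).congr_cast fun e => by simp

end DefP

/-! ### Arithmetic of small numbers -/

theorem DefN.map {t : Env k → ℕ} (ht : DefN t) (σ : ℕ → ℕ) : DefN fun e => t (e.map σ) := by
  refine ⟨ht.1.map σ, ?_⟩
  exact ht.2.map fun i => match i with
    | 0 => 0
    | i + 1 => σ i + 1

theorem DefN.pop {t : Env k → ℕ} (ht : DefN t) : DefN fun e => t e.pop := ht.map (· + 1)

theorem DefN.congr {s t : Env k → ℕ} (hs : DefN s) (h : ∀ c e, Env.Ok c e → s e = t e) : DefN t := by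
  refine ⟨hs.1.of_le fun c e he => (h c e he).ge, hs.2.congr fun c e he => ?_⟩
  rw [h c e.pop he.pop]

namespace DefP

/-- Existential quantification. -/
theorem ex {Q : Env k → ℕ → Prop} (hb : ∀ c, ∃ d, ∀ e, Env.Ok c e → ∀ z, Q e z → z < bd d e.n)
    (hQ : DefP fun e => Q e.pop (e.v 0)) : DefP fun e => ∃ z, Q e z := by
  have h : DefR fun (e : Env k) z w => Q e z ∧ z = w := by
    refine ⟨fun c => ?_, (hQ.map (· + 1)).and (var_eq 1 0)⟩
    obtain ⟨d, hd⟩ := hb c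
    exact ⟨d, fun e he z w h => ⟨hd e he z h.1, h.2 ▸ hd e he z h.1⟩⟩
  exact (ex_pair h).congr_cast fun e => ⟨fun ⟨z, _, h⟩ => ⟨z, h.1⟩, fun ⟨z, h⟩ => ⟨z, z, h, rfl⟩⟩

/-- Substitution of a number for the variable `0`. -/
theorem subst {P : Env k → Prop} {t : Env k → ℕ} (hP : DefP P) (ht : DefN t) :
    DefP fun e => P (e.push (t e)) := by
  have h : DefP fun (e : Env k) => ∃ z, t e = z ∧ P (e.push z) := by
    refine ex (Q := fun e z => t e = z ∧ P (e.push z)) (fun c => ?_) (ht.2.and ?_)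
    · obtain ⟨d, hd⟩ := ht.1 c
      exact ⟨d, fun e he z h => h.1 ▸ hd e he⟩
    · simpa only [Env.push_pop] using hP
  exact h.congr_cast fun e => by simp

variable {s t : Env k → ℕ}

theorem rel {R : ℕ → ℕ → Prop} (hR : DefP fun e : Env k => R (e.v 1) (e.v 0)) (hs : DefN s)
    (ht : DefN t) : DefP fun e => R (s e) (t e) :=
  (hR.subst ht.pop).subst hs

theorem lt (hs : DefN s) (ht : DefN t) : DefP fun e => s e < t e := rel (var_lt 1 0) hs ht

theorem eq (hs : DefN s) (ht : DefN t) : DefP fun e => s e = t e := rel (R := (· = ·)) (var_eq 1 0) hs ht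

theorem le (hs : DefN s) (ht : DefN t) : DefP fun e => s e ≤ t e :=
  (lt ht hs).not.congr_cast fun _ => not_lt

theorem land (hs : DefN s) (ht : DefN t) : DefP fun e => s e &&& t e ≠ 0 :=
  rel (R := fun a b => a &&& b ≠ 0) (var_land 1 0) hs ht

theorem isPow (ht : DefN t) : DefP fun e => ∃ m, t e = 2 ^ m :=
  rel (R := fun _ b => ∃ m, b = 2 ^ m) (var_isPow 0) ht ht

theorem lt_length (ht : DefN t) : DefP fun e => t e < e.n := (var_lt_length 0).subst ht

theorem ex_lt {Q : Env k → ℕ → Prop} (ht : DefN t) (hQ : DefP fun e => Q e.pop (e.v 0)) :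
    DefP fun e => ∃ z < t e, Q e z := by
  refine ex (Q := fun e z => z < t e ∧ Q e z) (fun c => ?_)
    ((rel (var_lt 1 0) ⟨PolyBdd.var 0, var_eq 1 0⟩ ht.pop).and hQ)
  obtain ⟨d, hd⟩ := ht.1 c
  exact ⟨d, fun e he z h => h.1.trans (hd e he)⟩

theorem all_lt {Q : Env k → ℕ → Prop} (ht : DefN t) (hQ : DefP fun e => Q e.pop (e.v 0)) :
    DefP fun e => ∀ z < t e, Q e z :=
  (ex_lt (Q := fun e z => ¬ Q e z) ht hQ.not).not.congr_cast fun e => by simp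

end DefP

namespace DefN

variable {s t : Env k → ℕ}

theorem var (i : ℕ) : DefN fun e : Env k => e.v i := ⟨PolyBdd.var i, DefP.var_eq (i + 1) 0⟩

/-- Only the order is available as yet: zero is the number without smaller ones, a successor is
characterized by the absence of numbers in between, and `n` is the least number not below `n`. -/
theorem zero : DefN fun _ : Env k => 0 := by
  refine ⟨PolyBdd.const 0, (DefP.ex_lt (Q := fun _ _ => True) (var 0) (DefP.const _)).not.congr_cast
    fun e => ?_⟩
  dsimp only
  constructor
  · intro h
    by_contra h'
    exact h ⟨0, by omega, trivial⟩
  · rintro h ⟨z, hz, -⟩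
    omega

theorem succ (ht : DefN t) : DefN fun e => t e + 1 := by
  refine ⟨ht.1.add (PolyBdd.const 1), ((DefP.lt ht.pop (var 0)).and (DefP.ex_lt
    (Q := fun e z => t e.pop < z) (var 0) (DefP.lt ht.pop.pop (var 0))).not).congr_cast fun e => ?_⟩
  dsimp only
  constructor
  · rintro ⟨h1, h2⟩
    by_contra h'
    exact h2 ⟨t e.pop + 1, by omega, by omega⟩
  · intro h
    refine ⟨by omega, ?_⟩
    rintro ⟨z, h1, h2⟩
    omega

theorem const (m : ℕ) : DefN fun _ : Env k => m := by
  induction m with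
  | zero => exact zero
  | succ m ih => exact ih.succ

theorem length : DefN fun e : Env k => e.n := by
  refine ⟨PolyBdd.length, ((DefP.lt_length (var 0)).not.and (DefP.all_lt (Q := fun e z => z < e.n)
    (var 0) (DefP.lt_length (var 0)))).congr_cast fun e => ?_⟩
  constructor
  · rintro ⟨h1, h2⟩
    by_contra h'
    have h3 : e.n < e.v 0 := lt_of_le_of_ne (not_lt.1 h1) h'
    exact lt_irrefl _ (h2 e.n h3)
  · intro h
    change e.n = e.v 0 at h
    exact ⟨by omega, fun z hz => by omega⟩

theorem subst (hs : DefN s) (ht : DefN t) : DefN fun e => s (e.push (t e)) := by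
  refine ⟨hs.1.subst ht.1, ?_⟩
  have h := (hs.2.map fun i => match i with
    | 0 => 1
    | 1 => 0
    | i + 2 => i + 2).subst ht.pop
  refine h.congr_cast fun e => ?_
  have h1 : (Env.map (fun i => match i with
    | 0 => 1
    | 1 => 0
    | i + 2 => i + 2) (e.push (t e.pop))).pop = e.pop.push (t e.pop) := by
    refine congrArg (Env.mk e.n e.x) ?_
    funext i
    rcases i with _ | i <;> rfl
  rw [h1]
  rfl

/-- The number of pairs in a definable relation. -/
theorem ncard {P : Env k → ℕ → ℕ → Prop} (hP : DefR P) :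
    DefN fun e => {p : ℕ × ℕ | P e p.1 p.2}.ncard := by
  -- The candidate value `e.v 0` is represented by a relation with exactly that many pairs; equality
  -- of numbers then means that neither cardinality is smaller.
  have h1 : DefR fun (e : Env k) z w => z < e.v 0 ∧ w = 0 := by
    refine ⟨fun c => ⟨c, fun e he z w h => ⟨h.1.trans (he.2 0), h.2 ▸ bd_pos _ _⟩⟩, ?_⟩
    exact (DefP.lt (var 1) (var 2)).and (DefP.eq (var 0) zero)
  have h2 : ∀ w : ℕ, {p : ℕ × ℕ | p.1 < w ∧ p.2 = 0}.ncard = w := by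
    intro w
    have h : {p : ℕ × ℕ | p.1 < w ∧ p.2 = 0} = (Finset.range w ×ˢ {0} : Finset (ℕ × ℕ)) := by
      ext ⟨a, b⟩
      simp [eq_comm (a := b)]
    rw [h, Set.ncard_coe_finset]
    simp
  have h3 : DefR fun (e : Env k) z w => P e.pop z w := by
    refine ⟨fun c => ?_, hP.def'.map fun i => match i with
      | 0 => 0
      | 1 => 1
      | i + 2 => i + 3⟩
    obtain ⟨d, hd⟩ := hP.bdd c
    exact ⟨d, fun e he => hd _ he.pop⟩
  refine ⟨fun c => ?_, ?_⟩
  · obtain ⟨d, hd⟩ := hP.bdd c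
    refine ⟨d + d + 1, fun e he => ?_⟩
    have h4 : {p : ℕ × ℕ | P e p.1 p.2} ⊆ (Finset.range (bd d e.n) ×ˢ Finset.range (bd d e.n) : Finset _) := by
      rintro ⟨z, w⟩ h
      simpa using hd e he z w h
    have h5 := Set.ncard_le_ncard h4 (Finset.finite_toSet _)
    rw [Set.ncard_coe_finset, Finset.card_product, Finset.card_range] at h5
    rw [bd_add, bd_add]
    have := lt_bd 1 e.n
    have := Nat.mul_pos (bd_pos d e.n) (bd_pos d e.n)
    nlinarith
  · refine ((DefP.ncard_lt h3 h1).or (DefP.ncard_lt h1 h3)).not.congr_cast fun e => ?_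
    dsimp only
    rw [h2]
    omega

/-- The number of elements of a definable set. -/
theorem count {Q : Env k → ℕ → Prop} (hb : ∀ c, ∃ d, ∀ e, Env.Ok c e → ∀ z, Q e z → z < bd d e.n)
    (hQ : DefP fun e => Q e.pop (e.v 0)) : DefN fun e => {z | Q e z}.ncard := by
  have h : DefR fun (e : Env k) z w => Q e z ∧ w = 0 := by
    refine ⟨fun c => ?_, (hQ.map (· + 1)).and (DefP.eq (var 0) zero)⟩
    obtain ⟨d, hd⟩ := hb c
    exact ⟨d, fun e he z w h => ⟨hd e he z h.1, h.2 ▸ bd_pos _ _⟩⟩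
  refine (ncard h).congr fun c e _ => ?_
  rw [← Set.ncard_image_of_injective {z | Q e z} (f := fun z => (z, 0)) fun a b h => congrArg Prod.fst h]
  congr 1
  ext ⟨a, b⟩
  simp [eq_comm]

/-- The number of elements below a bound with a definable property. -/
theorem count_lt {Q : Env k → ℕ → Prop} (ht : DefN t) (hQ : DefP fun e => Q e.pop (e.v 0)) :
    DefN fun e => {z | z < t e ∧ Q e z}.ncard := by
  refine count (Q := fun e z => z < t e ∧ Q e z) (fun c => ?_) ((DefP.lt (var 0) ht.pop).and hQ)
  obtain ⟨d, hd⟩ := ht.1 c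
  exact ⟨d, fun e he z h => h.1.trans (hd e he)⟩

/-- Iterated sums of small numbers. -/
theorem sum {u : Env k → ℕ → ℕ} (ht : DefN t) (hu : DefN fun e => u e.pop (e.v 0)) :
    DefN fun e => ∑ z ∈ Finset.range (t e), u e z := by
  -- The sum is the number of points under the graph of `u`.
  have h : DefR fun (e : Env k) z w => z < t e ∧ w < u e z := by
    refine ⟨fun c => ?_, (DefP.lt (var 1) ht.pop.pop).and (DefP.lt (var 0) (hu.map (· + 1)))⟩
    obtain ⟨d, hd⟩ := ht.1 c
    obtain ⟨d', hd'⟩ := hu.1 (max c d)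
    refine ⟨max d d', fun e he z w h => ⟨?_, ?_⟩⟩
    · exact (h.1.trans (hd e he)).trans_le (bd_mono (le_max_left _ _) _)
    · have h1 := hd' (e.push z) ((he.mono (le_max_left _ _)).push
        ((h.1.trans (hd e he)).trans_le (bd_mono (le_max_right _ _) _)))
      exact (h.2.trans h1).trans_le (bd_mono (le_max_right _ _) _)
  refine (ncard h).congr fun c e _ => ?_
  have h1 : {p : ℕ × ℕ | p.1 < t e ∧ p.2 < u e p.1} = ((Finset.range (t e)).sigma
      fun z => Finset.range (u e z)).map (Equiv.sigmaEquivProd ℕ ℕ).toEmbedding := by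
    ext ⟨a, b⟩
    simp [Equiv.sigmaEquivProd]
  rw [h1, Set.ncard_coe_finset, Finset.card_map, Finset.card_sigma]
  simp

theorem ite {P : Env k → Prop} [∀ e, Decidable (P e)] (hP : DefP P) (hs : DefN s) (ht : DefN t) :
    DefN fun e => if P e then s e else t e := by
  refine ⟨(hs.1.add ht.1).of_le fun c e _ => by split_ifs <;> omega,
    ((hP.pop.and hs.2).or (hP.pop.not.and ht.2)).congr_cast fun e => ?_⟩
  dsimp only
  split_ifs with h <;> simp [h]

/-- Arithmetic is counting: a sum is an iterated sum with two terms, a product one with equal terms,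
and differences and quotients are cardinalities of initial segments or intervals. -/
theorem add (hs : DefN s) (ht : DefN t) : DefN fun e => s e + t e := by
  refine (sum (u := fun e z => if z = 0 then s e else t e) (const 2)
    (ite (DefP.eq (var 0) zero) hs.pop ht.pop)).congr fun _ e _ => ?_
  simp [Finset.sum_range_succ]

theorem mul (hs : DefN s) (ht : DefN t) : DefN fun e => s e * t e :=
  (sum (u := fun e _ => t e) hs ht.pop).congr fun _ e _ => by simp

theorem sub (hs : DefN s) (ht : DefN t) : DefN fun e => s e - t e := by
  refine (count_lt (Q := fun e z => t e ≤ z) hs (DefP.le ht.pop (var 0))).congr fun _ e _ => ?_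
  have h : {z | z < s e ∧ t e ≤ z} = (Finset.Ico (t e) (s e) : Set ℕ) := by
    ext z
    simp [and_comm]
  rw [h, Set.ncard_coe_finset, Nat.card_Ico]

theorem div (hs : DefN s) (ht : DefN t) : DefN fun e => s e / t e := by
  refine (count_lt (Q := fun e z => (z + 1) * t e ≤ s e ∧ 0 < t e) hs
    ((DefP.le ((var 0).succ.mul ht.pop) hs.pop).and (DefP.lt zero ht.pop))).congr fun _ e _ => ?_
  have h : {z | z < s e ∧ (z + 1) * t e ≤ s e ∧ 0 < t e} = (Finset.range (s e / t e) : Set ℕ) := by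
    ext z
    simp only [Set.mem_ofPred_eq, Finset.coe_range, Set.mem_Iio]
    constructor
    · rintro ⟨-, h1, h2⟩
      exact (Nat.le_div_iff_mul_le h2).2 h1
    · intro h1
      have h2 : 0 < t e := by
        by_contra h2
        rw [show t e = 0 by omega, Nat.div_zero] at h1
        omega
      exact ⟨h1.trans_le (Nat.div_le_self _ _), (Nat.le_div_iff_mul_le h2).1 h1, h2⟩
  rw [h, Set.ncard_coe_finset, Finset.card_range]

theorem mod (hs : DefN s) (ht : DefN t) : DefN fun e => s e % t e :=
  (hs.sub (ht.mul (hs.div ht))).congr fun _ _ _ => (Nat.mod_eq_sub_mul_div).symm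

/-- A power `2 ^ m` is below `a` exactly if `m < Nat.size (a - 1)`. Counting powers of two, a
property that automata recognize, thus gives binary lengths. -/
theorem ncard_isPow (a : ℕ) : {z | z < a ∧ ∃ m, z = 2 ^ m}.ncard = Nat.size (a - 1) := by
  have h : {z | z < a ∧ ∃ m, z = 2 ^ m} = ((Finset.range (Nat.size (a - 1))).image (2 ^ ·) : Finset ℕ) := by
    ext z
    simp only [Set.mem_ofPred_eq, Finset.coe_image, Finset.coe_range, Set.mem_image, Set.mem_Iio,
      Nat.lt_size]
    constructor
    · rintro ⟨h1, m, rfl⟩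
      exact ⟨m, by omega, rfl⟩
    · rintro ⟨m, h, rfl⟩
      have := Nat.two_pow_pos m
      exact ⟨by omega, m, rfl⟩
  rw [h, Set.ncard_coe_finset, Finset.card_image_of_injective _ (Nat.pow_right_injective le_rfl),
    Finset.card_range]

theorem size_pred (ht : DefN t) : DefN fun e => Nat.size (t e - 1) :=
  (count_lt (Q := fun _ z => ∃ m, z = 2 ^ m) ht (DefP.isPow (var 0))).congr fun _ _ _ => ncard_isPow _

theorem size (ht : DefN t) : DefN fun e => Nat.size (t e) := ht.succ.size_pred

theorem size_two_pow_sub_one (m : ℕ) : Nat.size (2 ^ m - 1) = m := by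
  refine le_antisymm (Nat.size_le.2 (by have := Nat.two_pow_pos m; omega)) ?_
  rcases m with _ | m
  · exact Nat.zero_le _
  · refine Nat.lt_size.2 ?_
    have := Nat.two_pow_pos m
    rw [pow_succ]
    omega

/-- Exponentiation is defined through its inverse: the wanted value is a power of two, and the
length of its predecessor is the exponent. The bound has to be assumed, since exponentials of small
numbers need not be small. -/
theorem two_pow (ht : DefN t) (hb : PolyBdd fun e => 2 ^ t e) : DefN fun e => 2 ^ t e := by
  refine ⟨hb, ((DefP.isPow (var 0)).and (DefP.eq (var 0).size_pred ht.pop)).congr_cast fun e => ?_⟩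
  constructor
  · rintro ⟨⟨m, h1⟩, h2⟩
    rw [h1, size_two_pow_sub_one] at h2
    rw [h1, h2]
  · intro h
    rw [← h]
    exact ⟨⟨_, rfl⟩, size_two_pow_sub_one _⟩

end DefN

/-- A bit that is set contributes a power of two not exceeding the number, so a bounded quantifier
finds that power; its exponent is the length of its predecessor. -/
theorem DefP.testBit {s t : Env k → ℕ} (hs : DefN s) (ht : DefN t) :
    DefP fun e => (s e).testBit (t e) = true := by
  refine (DefP.ex_lt (Q := fun e y => (∃ m, y = 2 ^ m) ∧ Nat.size (y - 1) = t e ∧ s e &&& y ≠ 0) hs.succ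
    ((DefP.isPow (.var 0)).and ((DefP.eq (DefN.var 0).size_pred ht.pop).and
      (DefP.land hs.pop (.var 0))))).congr_cast fun e => ?_
  constructor
  · rintro ⟨y, -, ⟨m, rfl⟩, h1, h2⟩
    rw [DefN.size_two_pow_sub_one] at h1
    rw [← h1]
    by_contra h3
    refine h2 ?_
    rw [Nat.and_two_pow]
    simp [Bool.eq_false_iff.2 h3]
  · intro h
    refine ⟨2 ^ t e, Nat.lt_succ_of_le (Nat.ge_two_pow_of_testBit h), ⟨_, rfl⟩,
      DefN.size_two_pow_sub_one _, ?_⟩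
    rw [Nat.and_two_pow, h]
    simp

/-! ### Bits of sums and differences -/

theorem Nat.testBit_add_eq (a b i : ℕ) : (a + b).testBit i =
    (a.testBit i ^^ b.testBit i ^^ decide (2 ^ i ≤ a % 2 ^ i + b % 2 ^ i)) := by
  simp only [Nat.testBit_eq_decide_div_mod_eq, Nat.add_div (Nat.two_pow_pos i)]
  have h1 := Nat.mod_two_eq_zero_or_one (a / 2 ^ i)
  have h2 := Nat.mod_two_eq_zero_or_one (b / 2 ^ i)
  generalize a / 2 ^ i = x at *
  generalize b / 2 ^ i = y at *
  by_cases h : 2 ^ i ≤ a % 2 ^ i + b % 2 ^ i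
  · simp only [h, if_true]
    rcases h1 with h1 | h1 <;> rcases h2 with h2 | h2 <;> simp [h1, h2] <;> omega
  · simp only [h, if_false]
    rcases h1 with h1 | h1 <;> rcases h2 with h2 | h2 <;> simp [h1, h2] <;> omega

/-- Carry lookahead: a carry into position `i` is generated at some lower position and propagated by
all positions in between. In this form it takes two bounded quantifiers instead of a recursion. -/
theorem Nat.carry_iff (a b i : ℕ) : 2 ^ i ≤ a % 2 ^ i + b % 2 ^ i ↔
    ∃ j < i, (a.testBit j = true ∧ b.testBit j = true) ∧
      ∀ l < i, j < l → (a.testBit l = true ∨ b.testBit l = true) := by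
  induction i with
  | zero => simp [Nat.mod_one]
  | succ i ih =>
    have h1 : 2 ^ (i + 1) ≤ a % 2 ^ (i + 1) + b % 2 ^ (i + 1) ↔
        (a.testBit i = true ∧ b.testBit i = true) ∨
          ((a.testBit i = true ∨ b.testBit i = true) ∧ 2 ^ i ≤ a % 2 ^ i + b % 2 ^ i) := by
      rw [mod_two_pow_succ, mod_two_pow_succ, pow_succ]
      have h2 := Nat.mod_lt a (Nat.two_pow_pos i)
      have h3 := Nat.mod_lt b (Nat.two_pow_pos i)
      cases a.testBit i <;> cases b.testBit i <;> simp <;> omega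
    rw [h1, ih]
    constructor
    · rintro (h | ⟨h, j, hj, h2, h3⟩)
      · exact ⟨i, by omega, h, fun l hl hl' => by omega⟩
      · refine ⟨j, by omega, h2, fun l hl hl' => ?_⟩
        rcases Nat.lt_succ_iff_lt_or_eq.1 hl with h4 | rfl
        · exact h3 l h4 hl'
        · exact h
    · rintro ⟨j, hj, h2, h3⟩
      rcases Nat.lt_succ_iff_lt_or_eq.1 hj with h4 | rfl
      · exact Or.inr ⟨h3 i (by omega) h4, j, h4, h2, fun l hl hl' => h3 l (by omega) hl'⟩
      · exact Or.inl h2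

theorem Nat.borrow_iff (a b i : ℕ) : a % 2 ^ i < b % 2 ^ i ↔
    ∃ j < i, (¬ a.testBit j = true ∧ b.testBit j = true) ∧
      ∀ l < i, j < l → (a.testBit l = true → b.testBit l = true) := by
  induction i with
  | zero => simp [Nat.mod_one]
  | succ i ih =>
    have h1 : a % 2 ^ (i + 1) < b % 2 ^ (i + 1) ↔
        (¬ a.testBit i = true ∧ b.testBit i = true) ∨
          ((a.testBit i = true → b.testBit i = true) ∧ a % 2 ^ i < b % 2 ^ i) := by
      rw [mod_two_pow_succ, mod_two_pow_succ]
      have h2 := Nat.mod_lt a (Nat.two_pow_pos i)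
      have h3 := Nat.mod_lt b (Nat.two_pow_pos i)
      cases a.testBit i <;> cases b.testBit i <;> simp <;> omega
    rw [h1, ih]
    constructor
    · rintro (h | ⟨h, j, hj, h2, h3⟩)
      · exact ⟨i, by omega, h, fun l hl hl' => by omega⟩
      · refine ⟨j, by omega, h2, fun l hl hl' => ?_⟩
        rcases Nat.lt_succ_iff_lt_or_eq.1 hl with h4 | rfl
        · exact h3 l h4 hl'
        · exact h
    · rintro ⟨j, hj, h2, h3⟩
      rcases Nat.lt_succ_iff_lt_or_eq.1 hj with h4 | rfl
      · exact Or.inr ⟨h3 i (by omega) h4, j, h4, h2, fun l hl hl' => h3 l (by omega) hl'⟩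
      · exact Or.inl h2

/-- With `a = d + b`, the borrow in the subtraction at position `i` is the carry in the addition of
`d` and `b`. -/
theorem Nat.testBit_sub_eq {a b : ℕ} (h : b ≤ a) (i : ℕ) : (a - b).testBit i =
    (a.testBit i ^^ b.testBit i ^^ decide (a % 2 ^ i < b % 2 ^ i)) := by
  obtain ⟨d, rfl⟩ := Nat.exists_eq_add_of_le' h
  have h1 : (2 ^ i ≤ d % 2 ^ i + b % 2 ^ i) ↔ (d + b) % 2 ^ i < b % 2 ^ i := by
    have h2 := Nat.mod_lt d (Nat.two_pow_pos i)
    have h3 := Nat.mod_lt b (Nat.two_pow_pos i)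
    have h4 := Nat.add_mod d b (2 ^ i)
    rw [h4]
    generalize d % 2 ^ i = x at *
    generalize b % 2 ^ i = y at *
    by_cases h5 : 2 ^ i ≤ x + y
    · have h6 : (x + y) % 2 ^ i = x + y - 2 ^ i := by
        rw [Nat.mod_eq_sub_mod h5, Nat.mod_eq_of_lt (by omega)]
      omega
    · have h6 : (x + y) % 2 ^ i = x + y := Nat.mod_eq_of_lt (by omega)
      omega
  rw [Nat.add_sub_cancel, Nat.testBit_add_eq d b i]
  simp only [h1]
  generalize decide ((d + b) % 2 ^ i < b % 2 ^ i) = u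
  cases d.testBit i <;> cases b.testBit i <;> cases u <;> rfl

/-- This is `Nat.borrow_iff` modulo a power of two that exceeds both numbers. -/
theorem Nat.lt_iff_exists_testBit (a b : ℕ) : a < b ↔
    ∃ j, (¬ a.testBit j = true ∧ b.testBit j = true) ∧
      ¬ ∃ l, j < l ∧ a.testBit l = true ∧ ¬ b.testBit l = true := by
  constructor
  · intro h
    have h1 := Nat.borrow_iff a b b
    rw [Nat.mod_eq_of_lt (h.trans Nat.lt_two_pow_self), Nat.mod_eq_of_lt Nat.lt_two_pow_self] at h1
    obtain ⟨j, hj, h2, h3⟩ := h1.1 h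
    refine ⟨j, h2, ?_⟩
    rintro ⟨l, h4, h5, h6⟩
    refine h6 (h3 l ?_ h4 h5)
    exact (Nat.lt_two_pow_self.trans_le (Nat.ge_two_pow_of_testBit h5)).trans h
  · rintro ⟨j, h2, h3⟩
    obtain ⟨m, h4, h5, hj⟩ : ∃ m, a < 2 ^ m ∧ b < 2 ^ m ∧ j < m :=
      ⟨a + b + j + 1, Nat.lt_two_pow_self.trans_le (Nat.pow_le_pow_right (by norm_num) (by omega)),
        Nat.lt_two_pow_self.trans_le (Nat.pow_le_pow_right (by norm_num) (by omega)), by omega⟩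
    rw [← Nat.mod_eq_of_lt h4, ← Nat.mod_eq_of_lt h5, Nat.borrow_iff]
    refine ⟨j, hj, h2, fun l _ hl h6 => ?_⟩
    by_contra h7
    exact h3 ⟨l, hl, h6, h7⟩

theorem Nat.testBit_sum_mul_two_pow {w : ℕ} (hw : 0 < w) (u : ℕ → ℕ) (hu : ∀ b, u b < 2 ^ w) (N i : ℕ) :
    (∑ b ∈ Finset.range N, u b * 2 ^ (w * b)).testBit i = (decide (i / w < N) && (u (i / w)).testBit (i % w)) := by
  have hlt : ∀ N, ∑ b ∈ Finset.range N, u b * 2 ^ (w * b) < 2 ^ (w * N) := by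
    intro N
    induction N with
    | zero => simp
    | succ N ih =>
      rw [Finset.sum_range_succ, mul_add, pow_add, mul_one]
      have := Nat.mul_le_mul_right (2 ^ (w * N)) (hu N)
      rw [Nat.succ_mul, mul_comm (2 ^ w)] at this
      omega
  induction N with
  | zero => simp
  | succ N ih =>
    rw [Finset.sum_range_succ, add_comm, mul_comm, Nat.testBit_two_pow_mul_add _ (hlt N), ih]
    have h0 : i / w < N ↔ i < w * N := by rw [Nat.div_lt_iff_lt_mul hw, mul_comm]
    split_ifs with h
    · have h1 := h0.2 h
      simp [h1, h1.trans (Nat.lt_succ_self N)]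
    · by_cases h1 : i / w = N
      · have h2 : i - w * N = i % w := by
          have := Nat.div_add_mod i w
          rw [h1] at this
          omega
        simp [h1, h2]
      · have h2 : ¬ i / w < N + 1 := by
          have := mt h0.1 h
          omega
        rw [decide_eq_false h2, Bool.false_and]
        refine Nat.testBit_lt_two_pow ((hu N).trans_le (Nat.pow_le_pow_right (by norm_num) ?_))
        have h3 : w * (N + 1) ≤ i := by
          rw [mul_comm]
          exact (Nat.le_div_iff_mul_le hw).1 (by omega)
        rw [mul_add, mul_one] at h3
        omega

theorem Nat.sum_digits {w : ℕ} (a N : ℕ) :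
    ∑ b ∈ Finset.range N, a / 2 ^ (w * b) % 2 ^ w * 2 ^ (w * b) = a % 2 ^ (w * N) := by
  induction N with
  | zero => simp [Nat.mod_one]
  | succ N ih =>
    rw [Finset.sum_range_succ, ih, mul_add, pow_add, mul_one, Nat.mod_mul, mul_comm (2 ^ (w * N))]

/-! ### Definable large numbers -/

/-- The length is polynomially bounded, and the bits are definable. -/
structure DefB (F : Env k → ℕ) : Prop where
  bdd : PolyBdd fun e => Nat.size (F e)
  bit : DefP fun e => (F e.pop).testBit (e.v 0) = true

theorem Nat.lt_size_of_testBit {a i : ℕ} (h : a.testBit i = true) : i < Nat.size a :=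
  Nat.lt_size.2 (Nat.ge_two_pow_of_testBit h)

theorem DefP.ex_testBit {F : Env k → ℕ} {Q : Env k → ℕ → Prop} (hF : DefB F)
    (hQ : DefP fun e => Q e.pop (e.v 0)) : DefP fun e => ∃ z, (F e).testBit z = true ∧ Q e z := by
  refine ex (Q := fun e z => (F e).testBit z = true ∧ Q e z) (fun c => ?_) (hF.bit.and hQ)
  obtain ⟨d, hd⟩ := hF.bdd c
  exact ⟨d, fun e he z h => (Nat.lt_size_of_testBit h.1).trans (hd e he)⟩

namespace DefB

variable {F G : Env k → ℕ} {s t : Env k → ℕ}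

theorem congr (hF : DefB F) (h : ∀ c e, Env.Ok c e → F e = G e) : DefB G := by
  refine ⟨hF.bdd.of_le fun c e he => by rw [h c e he], hF.bit.congr fun c e he => ?_⟩
  rw [h c e.pop he.pop]

theorem testBit (hF : DefB F) (ht : DefN t) : DefP fun e => (F e).testBit (t e) = true :=
  hF.bit.subst ht

theorem map (hF : DefB F) (σ : ℕ → ℕ) : DefB fun e => F (e.map σ) := by
  refine ⟨hF.bdd.map σ, ?_⟩
  exact hF.bit.map fun i => match i with
    | 0 => 0
    | i + 1 => σ i + 1

theorem pop (hF : DefB F) : DefB fun e => F e.pop := hF.map (· + 1)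

theorem of_defN (ht : DefN t) : DefB t :=
  ⟨ht.1.of_le fun _ _ _ => Nat.size_le.2 Nat.lt_two_pow_self, DefP.testBit ht.pop (.var 0)⟩

theorem const (m : ℕ) : DefB fun _ : Env k => m := of_defN (.const m)

theorem input (j : Fin k) : DefB fun e : Env k => e.x j :=
  ⟨PolyBdd.length.of_le fun _ _ he => he.1 j, DefP.inp j 0⟩

theorem ite {P : Env k → Prop} [∀ e, Decidable (P e)] (hP : DefP P) (hF : DefB F) (hG : DefB G) :
    DefB fun e => if P e then F e else G e := by
  refine ⟨(hF.bdd.add hG.bdd).of_le fun c e _ => by split_ifs <;> omega,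
    ((hP.pop.and hF.bit).or (hP.pop.not.and hG.bit)).congr_cast fun e => ?_⟩
  split_ifs with h <;> simp [h]

theorem lt (hF : DefB F) (hG : DefB G) : DefP fun e => F e < G e := by
  refine (DefP.ex_testBit (Q := fun e j => (¬ (F e).testBit j = true) ∧
    ¬ ∃ l, (F e).testBit l = true ∧ j < l ∧ ¬ (G e).testBit l = true) hG ?_).congr_cast fun e => ?_
  · refine hF.bit.not.and (DefP.not ?_)
    exact DefP.ex_testBit (Q := fun e l => e.v 0 < l ∧ ¬ (G e.pop).testBit l = true) hF.pop
      ((DefP.lt (.var 1) (.var 0)).and (hG.pop.pop.testBit (.var 0)).not)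
  · rw [Nat.lt_iff_exists_testBit]
    refine exists_congr fun j => ?_
    have : (∃ l, j < l ∧ (F e).testBit l = true ∧ ¬ (G e).testBit l = true) ↔
      ∃ l, (F e).testBit l = true ∧ j < l ∧ ¬ (G e).testBit l = true :=
      exists_congr fun l => by tauto
    rw [this]
    tauto

theorem size (hF : DefB F) : DefN fun e => Nat.size (F e) := by
  refine ⟨hF.bdd, ((DefP.ex_testBit (Q := fun e l => e.v 0 ≤ l) hF.pop (DefP.le (.var 1) (.var 0))).not.and
    (DefP.all_lt (Q := fun e l => e.v 0 = l + 1 → (F e.pop).testBit l = true) (.var 0)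
      ((DefP.eq (.var 1) (DefN.var 0).succ).imp (hF.pop.pop.testBit (.var 0))))).congr_cast fun e => ?_⟩
  dsimp only
  generalize F e.pop = a
  generalize e.v 0 = w
  constructor
  · rintro ⟨h1, h2⟩
    refine le_antisymm (Nat.size_le.2 (Nat.lt_pow_two_of_testBit _ fun i hi => ?_)) ?_
    · by_contra h3
      exact h1 ⟨i, by simpa using h3, hi⟩
    · rcases w with _ | w
      · exact Nat.zero_le _
      · exact Nat.lt_size_of_testBit (h2 w (Nat.lt_succ_self w) rfl)
  · rintro rfl
    refine ⟨?_, fun l _ hl => ?_⟩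
    · rintro ⟨l, h1, h2⟩
      exact absurd (Nat.lt_size_of_testBit h1) (by omega)
    · by_contra h1
      have h2 : a < 2 ^ l := by
        refine Nat.lt_pow_two_of_testBit _ fun i hi => ?_
        rcases eq_or_lt_of_le hi with rfl | h3
        · simpa using h1
        · by_contra h4
          have := Nat.lt_size_of_testBit (by simpa using h4)
          omega
      have := Nat.size_le.2 h2
      omega

theorem add (hF : DefB F) (hG : DefB G) : DefB fun e => F e + G e := by
  have hc : DefP fun e => ∃ j < e.v 0, ((F e.pop).testBit j = true ∧ (G e.pop).testBit j = true) ∧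
      ∀ l < e.v 0, j < l → ((F e.pop).testBit l = true ∨ (G e.pop).testBit l = true) := by
    refine DefP.ex_lt (Q := fun e j => ((F e.pop).testBit j = true ∧ (G e.pop).testBit j = true) ∧
      ∀ l < e.v 0, j < l → ((F e.pop).testBit l = true ∨ (G e.pop).testBit l = true)) (.var 0) ?_
    refine ((hF.pop.pop.testBit (.var 0)).and (hG.pop.pop.testBit (.var 0))).and ?_
    exact DefP.all_lt (Q := fun e l => e.v 0 < l → ((F e.pop.pop).testBit l = true ∨
      (G e.pop.pop).testBit l = true)) (.var 1) ((DefP.lt (.var 1) (.var 0)).imp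
        ((hF.pop.pop.pop.testBit (.var 0)).or (hG.pop.pop.pop.testBit (.var 0))))
  refine ⟨((hF.bdd.add hG.bdd).add (.const 1)).of_le fun c e _ => ?_,
    ((hF.bit.iff hG.bit).iff hc).congr_cast fun e => ?_⟩
  · refine Nat.size_le.2 ?_
    have h1 := Nat.lt_size_self (F e)
    have h2 := Nat.lt_size_self (G e)
    have h3 := Nat.pow_le_pow_right (n := 2) (by norm_num) (Nat.le_add_right (Nat.size (F e)) (Nat.size (G e)))
    have h4 := Nat.pow_le_pow_right (n := 2) (by norm_num) (Nat.le_add_left (Nat.size (G e)) (Nat.size (F e)))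
    rw [pow_succ]
    omega
  · rw [Nat.testBit_add_eq, ← Nat.carry_iff]
    cases (F e.pop).testBit (e.v 0) <;> cases (G e.pop).testBit (e.v 0) <;> simp

theorem sub (hF : DefB F) (hG : DefB G) : DefB fun e => F e - G e := by
  have hc : DefP fun e => ∃ j < e.v 0, (¬ (F e.pop).testBit j = true ∧ (G e.pop).testBit j = true) ∧
      ∀ l < e.v 0, j < l → ((F e.pop).testBit l = true → (G e.pop).testBit l = true) := by
    refine DefP.ex_lt (Q := fun e j => (¬ (F e.pop).testBit j = true ∧ (G e.pop).testBit j = true) ∧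
      ∀ l < e.v 0, j < l → ((F e.pop).testBit l = true → (G e.pop).testBit l = true)) (.var 0) ?_
    refine ((hF.pop.pop.testBit (.var 0)).not.and (hG.pop.pop.testBit (.var 0))).and ?_
    exact DefP.all_lt (Q := fun e l => e.v 0 < l → ((F e.pop.pop).testBit l = true →
      (G e.pop.pop).testBit l = true)) (.var 1) ((DefP.lt (.var 1) (.var 0)).imp
        ((hF.pop.pop.pop.testBit (.var 0)).imp (hG.pop.pop.pop.testBit (.var 0))))
  refine ⟨hF.bdd.of_le fun c e _ => Nat.size_le_size (Nat.sub_le _ _),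
    ((lt hF hG).pop.not.and ((hF.bit.iff hG.bit).iff hc)).congr_cast fun e => ?_⟩
  rw [← Nat.borrow_iff]
  by_cases h : F e.pop < G e.pop
  · rw [Nat.sub_eq_zero_of_le h.le]
    simp [h]
  · rw [Nat.testBit_sub_eq (not_lt.1 h)]
    cases (F e.pop).testBit (e.v 0) <;> cases (G e.pop).testBit (e.v 0) <;> simp [h]

theorem shift (hF : DefB F) (ht : DefN t) : DefB fun e => F e * 2 ^ t e := by
  refine ⟨(hF.bdd.add ht.1).of_le fun c e _ => Nat.size_le.2 ?_,
    ((DefP.le ht.pop (.var 0)).and (hF.pop.testBit ((DefN.var 0).sub ht.pop))).congr_cast fun e => ?_⟩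
  · rw [pow_add]
    exact Nat.mul_lt_mul_of_pos_right (Nat.lt_size_self _) (Nat.two_pow_pos _)
  · rw [Nat.testBit_mul_two_pow]
    simp

theorem half (hF : DefB F) : DefB fun e => F e / 2 := by
  refine ⟨hF.bdd.of_le fun c e _ => Nat.size_le_size (Nat.div_le_self _ _),
    (hF.pop.testBit (DefN.var 0).succ).congr_cast fun e => ?_⟩
  rw [Nat.testBit_add_one]

theorem mod_two (hF : DefB F) : DefB fun e => F e % 2 :=
  (ite (hF.testBit .zero) (const 1) (const 0)).congr fun c e _ => by
    rw [Nat.testBit_zero]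
    split_ifs with h <;> simp at h <;> omega

/-- Blocks of bits are small numbers. -/
theorem digit {w b : Env k → ℕ} (hF : DefB F) (hw : DefN w) (hw' : PolyBdd fun e => 2 ^ w e) (hb : DefN b) :
    DefN fun e => F e / 2 ^ (w e * b e) % 2 ^ w e := by
  refine ⟨hw'.of_le fun c e _ => (Nat.mod_lt _ (Nat.two_pow_pos _)).le,
    ((DefP.lt (.var 0) (hw.two_pow hw').pop).and (DefP.all_lt (Q := fun e r => (e.v 0).testBit r = true ↔
      (F e.pop).testBit (w e.pop * b e.pop + r) = true) hw.pop ((DefP.testBit (.var 1) (.var 0)).iff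
        (hF.pop.pop.testBit ((hw.pop.pop.mul hb.pop.pop).add (.var 0)))))).congr_cast fun e => ?_⟩
  have h1 : ∀ r, (F e.pop / 2 ^ (w e.pop * b e.pop) % 2 ^ w e.pop).testBit r = true ↔ r < w e.pop ∧
      (F e.pop).testBit (w e.pop * b e.pop + r) = true := by
    intro r
    rw [Nat.testBit_mod_two_pow, Nat.testBit_div_two_pow, add_comm]
    simp
  constructor
  · rintro ⟨h2, h3⟩
    refine Nat.eq_of_testBit_eq fun r => Bool.eq_iff_iff.2 ?_
    rw [h1]
    constructor
    · rintro ⟨h4, h5⟩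
      exact (h3 r h4).2 h5
    · intro h4
      have h5 : r < w e.pop := by
        by_contra h5
        rw [Nat.testBit_lt_two_pow (h2.trans_le (Nat.pow_le_pow_right (by norm_num) (not_lt.1 h5)))] at h4
        cases h4
      exact ⟨h5, (h3 r h5).1 h4⟩
  · intro h2
    dsimp only at h2
    rw [← h2]
    refine ⟨Nat.mod_lt _ (Nat.two_pow_pos _), fun r hr => ?_⟩
    rw [h1]
    simp [hr]

/-- Numbers with definable blocks of bits. -/
theorem of_blocks {w N : Env k → ℕ} {u : Env k → ℕ → ℕ} (hw : DefN w) (hw0 : ∀ e, 0 < w e)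
    (hu : DefN fun e => u e.pop (e.v 0)) (hu' : ∀ e b, u e b < 2 ^ w e) (hN : ∀ e b, N e ≤ b → u e b = 0)
    (hb : PolyBdd fun e => Nat.size (∑ b ∈ Finset.range (N e), u e b * 2 ^ (w e * b))) :
    DefB fun e => ∑ b ∈ Finset.range (N e), u e b * 2 ^ (w e * b) := by
  refine ⟨hb, (DefP.testBit ((hu.map fun i => match i with
    | 0 => 0
    | i + 1 => i + 2).subst ((DefN.var 0).div hw.pop)) ((DefN.var 0).mod hw.pop)).congr_cast fun e => ?_⟩
  rw [Nat.testBit_sum_mul_two_pow (hw0 _) _ (hu' _)]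
  change (u e.pop (e.v 0 / w e.pop)).testBit (e.v 0 % w e.pop) = true ↔ _
  by_cases h : e.v 0 / w e.pop < N e.pop
  · simp [h]
  · rw [hN _ _ (not_lt.1 h)]
    simp

/-- Iterated sums of large numbers. -/
theorem sum {F : Env k → ℕ → ℕ} (ht : DefN t) (hF : DefB fun e => F e.pop (e.v 0)) :
    DefB fun e => ∑ z ∈ Finset.range (t e), F e z := by
  set S : Env k → ℕ := fun e => ∑ z ∈ Finset.range (t e), F e z with hS
  -- The numbers are added column by column in base `2 ^ w`. Since `t e < 2 ^ w e`, a column sum `T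
  -- e b` is less than `2 ^ w e * 2 ^ w e`, so it has two digits; and it is an iterated sum of small
  -- numbers. Collecting low and high digits leaves the addition of just two large numbers.
  set w : Env k → ℕ := fun e => Nat.size (t e) + 1 with hw
  set T : Env k → ℕ → ℕ := fun e b => ∑ z ∈ Finset.range (t e), F e z / 2 ^ (w e * b) % 2 ^ w e with hT
  have hwN : DefN w := ht.size.succ
  have htw : ∀ e, t e < 2 ^ w e := fun e => (Nat.lt_size_self _).trans_le
    (Nat.pow_le_pow_right (by norm_num) (Nat.le_succ _))
  have hwb : PolyBdd fun e => 2 ^ w e := by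
    refine (((PolyBdd.const 4).mul ht.1).add (.const 2)).of_le fun c e _ => ?_
    simp only [hw, pow_succ]
    rcases Nat.eq_zero_or_pos (t e) with h | h
    · simp [h]
    · have h1 : 2 ^ (Nat.size (t e) - 1) ≤ t e := Nat.lt_size.1 (by
        have := Nat.size_pos.2 h
        omega)
      have h2 : 2 ^ Nat.size (t e) = 2 * 2 ^ (Nat.size (t e) - 1) := by
        rw [← pow_succ']
        congr 1
        have := Nat.size_pos.2 h
        omega
      omega
  have hTN : DefN fun e => T e.pop (e.v 0) := by
    refine DefN.sum (u := fun e z => F e.pop z / 2 ^ (w e.pop * e.v 0) % 2 ^ w e.pop) ht.pop ?_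
    refine digit (F := fun e => F e.pop.pop (e.v 0)) (hF.map fun i => match i with
      | 0 => 0
      | i + 1 => i + 2) hwN.pop.pop (hwb.map (· + 2)) (.var 1)
  have hTlt : ∀ e b, T e b < 2 ^ w e * 2 ^ w e := by
    intro e b
    calc T e b ≤ ∑ z ∈ Finset.range (t e), 2 ^ w e :=
          Finset.sum_le_sum fun z _ => (Nat.mod_lt _ (Nat.two_pow_pos _)).le
      _ = t e * 2 ^ w e := by simp
      _ < _ := Nat.mul_lt_mul_of_pos_right (htw e) (Nat.two_pow_pos _)
  have hFS : ∀ e, ∀ z ∈ Finset.range (t e), F e z ≤ S e := fun e z hz =>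
    Finset.single_le_sum (f := F e) (fun _ _ => Nat.zero_le _) hz
  have hlt : ∀ e b, S e ≤ b → S e < 2 ^ (w e * b) := by
    intro e b hb
    calc S e ≤ b := hb
      _ < 2 ^ b := Nat.lt_two_pow_self
      _ ≤ _ := Nat.pow_le_pow_right (by norm_num) (Nat.le_mul_of_pos_left _ (Nat.succ_pos _))
  have hT0 : ∀ e b, S e ≤ b → T e b = 0 := by
    intro e b hb
    refine Finset.sum_eq_zero fun z hz => ?_
    rw [Nat.div_eq_of_lt ((hFS e z hz).trans_lt (hlt e b hb)), Nat.zero_mod]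
  -- The sum `S e` itself serves as the number of columns. This is generous, but all further columns
  -- vanish, and `of_blocks` does not require the number of blocks to be definable.
  have hST : ∀ e, S e = ∑ b ∈ Finset.range (S e), T e b * 2 ^ (w e * b) := by
    intro e
    simp only [hT, Finset.sum_mul]
    rw [Finset.sum_comm]
    refine Finset.sum_congr rfl fun z hz => ?_
    rw [Nat.sum_digits, Nat.mod_eq_of_lt ((hFS e z hz).trans_lt (hlt e _ le_rfl))]
  have hSb : PolyBdd fun e => Nat.size (S e) := by
    intro c
    obtain ⟨d, hd⟩ := ht.1 c
    obtain ⟨d', hd'⟩ := hF.bdd (max c d)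
    refine ⟨d + d' + 2, fun e he => ?_⟩
    have h1 : Nat.size (S e) ≤ bd d e.n + bd d' e.n := by
      refine Nat.size_le.2 ?_
      calc S e ≤ ∑ z ∈ Finset.range (t e), 2 ^ bd d' e.n := by
            refine Finset.sum_le_sum fun z hz => ?_
            have h2 := hd' (e.push z) ((he.mono (le_max_left _ _)).push
              (((Finset.mem_range.1 hz).trans (hd e he)).trans_le (bd_mono (le_max_right _ _) _)))
            exact (Nat.size_le.1 h2.le).le
        _ = t e * 2 ^ bd d' e.n := by simp
        _ < 2 ^ (bd d e.n + bd d' e.n) := by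
          rw [pow_add]
          exact Nat.mul_lt_mul_of_pos_right ((hd e he).trans Nat.lt_two_pow_self) (Nat.two_pow_pos _)
    rw [bd_add, bd_add]
    have h2 := lt_bd 2 e.n
    have h3 := bd_pos d e.n
    have h4 := bd_pos d' e.n
    have h5 : bd d e.n + bd d' e.n < bd d e.n * bd d' e.n * 3 := by nlinarith
    have h6 : bd d e.n * bd d' e.n * 3 ≤ bd d e.n * bd d' e.n * bd 2 e.n := Nat.mul_le_mul_left _ h2
    exact h1.trans_lt (h5.trans_le h6)
  have hD := hwN.two_pow hwb
  have hle : ∀ e (u : ℕ → ℕ), (∀ b, u b ≤ T e b) →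
      ∑ b ∈ Finset.range (S e), u b * 2 ^ (w e * b) ≤ S e := by
    intro e u hu
    conv_rhs => rw [hST e]
    exact Finset.sum_le_sum fun b _ => Nat.mul_le_mul_right _ (hu b)
  have hlo := of_blocks (N := S) (u := fun e b => T e b % 2 ^ w e) hwN (fun e => Nat.succ_pos _)
    (hTN.mod hD.pop) (fun e b => Nat.mod_lt _ (Nat.two_pow_pos _))
    (fun e b hb => by rw [hT0 e b hb, Nat.zero_mod])
    (hSb.of_le fun c e _ => Nat.size_le_size (hle e _ fun b => Nat.mod_le _ _))
  have hhi := of_blocks (N := S) (u := fun e b => T e b / 2 ^ w e) hwN (fun e => Nat.succ_pos _)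
    (hTN.div hD.pop) (fun e b => Nat.div_lt_of_lt_mul (hTlt e b))
    (fun e b hb => by rw [hT0 e b hb, Nat.zero_div])
    (hSb.of_le fun c e _ => Nat.size_le_size (hle e _ fun b => Nat.div_le_self _ _))
  refine (hlo.add (hhi.shift hwN)).congr fun c e _ => ?_
  rw [Finset.sum_mul, ← Finset.sum_add_distrib]
  refine Eq.trans (Finset.sum_congr rfl fun b _ => ?_) (hST e).symm
  conv_rhs => rw [← Nat.mod_add_div (T e b) (2 ^ w e)]
  ring

/-- Schoolbook multiplication: an iterated sum of shifted copies of one factor, selected by the bits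
of the other. -/
theorem mul (hF : DefB F) (hG : DefB G) : DefB fun e => F e * G e := by
  refine (sum (F := fun e z => if (F e).testBit z = true then G e * 2 ^ z else 0) hF.size
    (ite hF.bit (hG.pop.shift (.var 0)) (const 0))).congr fun c e _ => ?_
  have h := EqLtMachine.sum_testBit (F e) (Nat.size (F e))
  rw [Nat.mod_eq_of_lt (Nat.lt_size_self _)] at h
  conv_rhs => rw [← h, Finset.sum_mul]
  refine Finset.sum_congr rfl fun z _ => ?_
  split_ifs
  · ring
  · simp

end DefB

/-! ### Definable functions and `FTC⁰` -/

/-- Functions with definable bits are in `FTC⁰`. -/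
theorem DefB.inFTC0 {F : (Fin k → ℕ) → ℕ} {G : Env k → ℕ} (hG : DefB G)
    (h : ∀ e : Env k, (∀ j, Nat.size (e.x j) ≤ e.n) → G e = F e.x) : InFTC0 F := by
  obtain ⟨d, hd⟩ := hG.bdd 1
  obtain ⟨C₀, hC⟩ := hG.bit (max d 2)
  obtain ⟨P, h1, h2⟩ := hC (max C₀ (max d 2)) (le_max_left _ _)
  -- Compilation wants the variables to range in a finite set. Sending all variables other than `0`
  -- to `1` is harmless, since in the environment of an output node they all have the value `0`.
  obtain ⟨l, R, t, hR, hl, -, ht, h3⟩ := h1.compile [] 2 (fun t i hi => by simp at hi) 2 (fun i => min i 1)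
    (fun i => by omega)
  rw [List.nil_append] at hl ht h3
  refine ProgCircuit.inFTC0 ⟨l, R, hR, hl, max C₀ (max d 2), ?_, l.length, Nat.lt_two_pow_self.le, t, ht,
    max d 2, le_max_right _ _, le_max_right _ _⟩ F fun n x hx => ⟨?_, fun i hi => ?_⟩
  · have := le_max_right C₀ (max d 2)
    have := le_max_right d 2
    omega
  · have h4 := hd ⟨n, x, fun _ => 0⟩ ⟨hx, fun _ => bd_pos _ _⟩
    rw [← h ⟨n, x, fun _ => 0⟩ hx]
    exact (Nat.lt_size_self _).trans_le (Nat.pow_le_pow_right (by norm_num)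
      (h4.le.trans (bd_mono (le_max_left _ _) _)))
  · have h5 : Env.map (fun i => min i 1) (⟨n, x, fun j => if j = 0 then i else 0⟩ : Env k) =
        ⟨n, x, fun j => if j = 0 then i else 0⟩ := by
      refine congrArg (Env.mk n x) ?_
      funext j
      rcases j with _ | j
      · rfl
      · simp
    have h6 := h3 ⟨n, x, fun j => if j = 0 then i else 0⟩
    rw [h5] at h6
    rw [h6, ← h2]
    · dsimp only
      rw [h _ (show ∀ j, Nat.size ((Env.pop (⟨n, x, fun j => if j = 0 then i else 0⟩ : Env k)).x j) ≤ n from hx)]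
      rfl
    · refine ⟨hx, fun j => ?_⟩
      dsimp only
      split_ifs
      · exact hi
      · exact bd_pos _ _

theorem PolyBdd.eval (p : Polynomial ℕ) : PolyBdd fun e : Env k => p.eval e.n := by
  induction p using Polynomial.induction_on' with
  | add p q hp hq => simpa only [Polynomial.eval_add] using hp.add hq
  | monomial m a =>
    have h : ∀ m : ℕ, PolyBdd fun e : Env k => e.n ^ m := by
      intro m
      induction m with
      | zero => simpa only [pow_zero] using PolyBdd.const 1
      | succ m ih => simpa only [pow_succ] using ih.mul .length
    simpa only [Polynomial.eval_monomial] using (PolyBdd.const a).mul (h m)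

theorem DefP.exists_fin {q : ℕ} {P : Fin q → Env k → Prop} (h : ∀ j, DefP (P j)) :
    DefP fun e => ∃ j, P j e := by
  induction q with
  | zero => exact (DefP.const False).congr_cast fun e => by simp
  | succ q ih =>
    exact ((h 0).or (ih fun j => h j.succ)).congr_cast fun e =>
      (Fin.exists_fin_succ (P := fun j => P j e)).symm

/-! ### Evaluation of a uniform circuit family by a formula -/

namespace Circuit

variable {q : ℕ} (C : ∀ n, Circuit q n) (X : Fin q → Env k → ℕ)

/-- The node `a` is labelled with the operation `t`. -/
def opR (t : GateOp) (n a : ℕ) : Prop := ∃ ha : a < (C n).size, (C n).kind ⟨a, ha⟩ = GateKind.op t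

/-- The node `a` is labelled with the `i`-th bit of the `j`-th input. -/
def inputR (j : Fin q) (n a i : ℕ) : Prop :=
  ∃ (ha : a < (C n).size) (hi : i < n), (C n).kind ⟨a, ha⟩ = GateKind.input j ⟨i, hi⟩

/-- There is an edge from `b` to `a`. -/
def edgeR (n a b : ℕ) : Prop :=
  ∃ (ha : a < (C n).size) (hb : b < (C n).size), (⟨b, hb⟩ : Fin (C n).size) ∈ (C n).preds ⟨a, ha⟩

/-- The output node `i` is fed by `a`. -/
def outR (n i a : ℕ) : Prop := ∃ hi : i < (C n).numOut, ((C n).out ⟨i, hi⟩ : ℕ) = a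

/-- The values of the nodes of depth less than `r`, on the input `X`. -/
def level : ℕ → Env k → ℕ → Prop
  | 0, _, _ => False
  | r + 1, e, a =>
    (∃ j, ∃ i < e.n, inputR C j e.n a i ∧ (X j e).testBit i = true) ∨
    (opR C .and e.n a ∧ ¬ ∃ b, edgeR C e.n a b ∧ ¬ level r e b) ∨
    (opR C .or e.n a ∧ ∃ b, edgeR C e.n a b ∧ level r e b) ∨
    (opR C .not e.n a ∧ ¬ ∃ b, edgeR C e.n a b ∧ level r e b) ∨
    (opR C .maj e.n a ∧ {b | edgeR C e.n a b}.ncard < 2 * {b | edgeR C e.n a b ∧ level r e b}.ncard)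

variable {C X}

/-- For fixed `r` the recursion unfolds into one formula. Uniformity supplies its atomic relations,
and polynomial size bounds the node names to be quantified and counted. -/
theorem defP_level (hC : DLogTimeUniform C) {p : Polynomial ℕ} (hp : ∀ n, (C n).numNodes ≤ p.eval n)
    (hX : ∀ j, DefB (X j)) (r : ℕ) : DefP fun e => level C X r e.pop (e.v 0) := by
  induction r with
  | zero => exact DefP.const False
  | succ r ih =>
    have hb : ∀ Q : Env k → ℕ → Prop, ∀ c, ∃ d, ∀ e, Env.Ok c e → ∀ z, edgeR C e.n (e.v 0) z ∧ Q e z →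
        z < bd d e.n := by
      intro Q c
      obtain ⟨d, hd⟩ := PolyBdd.eval (k := k) p c
      refine ⟨d, fun e he z ⟨⟨_, h, _⟩, _⟩ => h.trans ((Nat.le_add_right _ _).trans_lt ((hp e.n).trans_lt ?_))⟩
      exact hd e he
    have hedge : DefP fun e : Env k => edgeR C e.n (e.v 1) (e.v 0) := DefP.orc hC.edge 1 0
    have hlev : DefP fun e : Env k => level C X r e.pop.pop (e.v 0) := ih.map fun i => match i with
      | 0 => 0
      | i + 1 => i + 2
    have hop : ∀ t, DefP fun e : Env k => opR C t e.n (e.v 0) := fun t => DefP.orc (hC.op t) 0 0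
    refine DefP.or ?_ (DefP.or ?_ (DefP.or ?_ (DefP.or ?_ ?_)))
    · refine DefP.exists_fin fun j => ?_
      exact DefP.ex_lt (Q := fun e i => inputR C j e.n (e.v 0) i ∧ (X j e.pop).testBit i = true) .length
        ((DefP.orc (hC.input j) 1 0).and ((hX j).pop.pop.testBit (.var 0)))
    · exact (hop _).and (DefP.not (DefP.ex (Q := fun e b => edgeR C e.n (e.v 0) b ∧ ¬ level C X r e.pop b)
        (hb _) (hedge.and hlev.not)))
    · exact (hop _).and (DefP.ex (Q := fun e b => edgeR C e.n (e.v 0) b ∧ level C X r e.pop b)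
        (hb _) (hedge.and hlev))
    · exact (hop _).and (DefP.not (DefP.ex (Q := fun e b => edgeR C e.n (e.v 0) b ∧ level C X r e.pop b)
        (hb _) (hedge.and hlev)))
    · refine (hop _).and (DefP.lt ?_ ((DefN.const 2).mul ?_))
      · refine (DefN.count (Q := fun e b => edgeR C e.n (e.v 0) b ∧ True) (hb _)
          (hedge.and (DefP.const _))).congr fun c e _ => by simp only [and_true]; rfl
      · exact DefN.count (Q := fun e b => edgeR C e.n (e.v 0) b ∧ level C X r e.pop b) (hb _)
          (hedge.and hlev)

theorem level_iff (r : ℕ) (e : Env k) (a : Fin (C e.n).size)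
    (hr : ∀ (m : ℕ) (path : Fin (m + 1) → Fin (C e.n).size),
      (∀ i : Fin m, path i.castSucc ∈ (C e.n).preds (path i.succ)) → path (Fin.last m) = a → m < r) :
    level C X r e a ↔ (C e.n).eval (fun j => X j e) a = true := by
  induction r generalizing a with
  | zero => exact absurd (hr 0 (fun _ => a) (fun i => i.elim0) rfl) (Nat.not_lt_zero _)
  | succ r ih =>
    have ih' : ∀ b ∈ (C e.n).preds a, (level C X r e b ↔ (C e.n).eval (fun j => X j e) b = true) := by
      intro b hb
      refine ih b fun m path h1 h2 => ?_
      -- A path ending in the predecessor `b` is prolonged by the edge to `a`, so it is shorter by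
      -- one than what is allowed at `a`.
      have h3 := hr (m + 1) (Fin.snoc (α := fun _ => Fin (C e.n).size) path a) ?_ ?_
      · omega
      · intro i
        refine Fin.lastCases ?_ (fun i => ?_) i
        · rw [Fin.succ_last, Fin.snoc_last, Fin.snoc_castSucc, h2]
          exact hb
        · rw [← Fin.castSucc_succ, Fin.snoc_castSucc, Fin.snoc_castSucc]
          exact h1 i
      · exact Fin.snoc_last _ _
    have hed : ∀ b, edgeR C e.n a b ↔ ∃ b' ∈ (C e.n).preds a, (b' : ℕ) = b := by
      intro b
      constructor
      · rintro ⟨_, hb, h⟩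
        exact ⟨⟨b, hb⟩, h, rfl⟩
      · rintro ⟨b', h, rfl⟩
        exact ⟨a.2, b'.2, h⟩
    have hop : ∀ t, opR C t e.n a ↔ (C e.n).kind a = .op t := fun t => ⟨fun ⟨_, h⟩ => h, fun h => ⟨a.2, h⟩⟩
    have hex : ∀ (P : ℕ → Prop) (Q : Fin (C e.n).size → Prop), (∀ b ∈ (C e.n).preds a, (P b ↔ Q b)) →
        ((∃ b, edgeR C e.n a b ∧ P b) ↔ ∃ b ∈ (C e.n).preds a, Q b) := by
      intro P Q hPQ
      constructor
      · rintro ⟨b, h1, h2⟩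
        obtain ⟨b', h3, rfl⟩ := (hed b).1 h1
        exact ⟨b', h3, (hPQ b' h3).1 h2⟩
      · rintro ⟨b', h3, h4⟩
        exact ⟨b', (hed b').2 ⟨b', h3, rfl⟩, (hPQ b' h3).2 h4⟩
    have hcard : {b | edgeR C e.n a b}.ncard = ((C e.n).preds a).card := by
      rw [← Finset.card_map Fin.valEmbedding, ← Set.ncard_coe_finset]
      congr 1
      ext b
      simp only [Set.mem_ofPred_eq, hed, Finset.coe_map, Set.mem_image, Finset.mem_coe]
      rfl
    have hcard' : {b | edgeR C e.n a b ∧ level C X r e b}.ncard =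
        ((C e.n).preds a |>.filter fun b => (C e.n).eval (fun j => X j e) b = true).card := by
      rw [← Finset.card_map Fin.valEmbedding, ← Set.ncard_coe_finset]
      congr 1
      ext b
      simp only [Set.mem_ofPred_eq, hed, Finset.coe_map, Set.mem_image, Finset.mem_coe, Finset.mem_filter]
      constructor
      · rintro ⟨⟨b', h1, rfl⟩, h2⟩
        exact ⟨b', ⟨h1, (ih' b' h1).1 h2⟩, rfl⟩
      · rintro ⟨b', ⟨h1, h2⟩, rfl⟩
        exact ⟨⟨b', h1, rfl⟩, (ih' b' h1).2 h2⟩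
    have hin : ∀ j i, inputR C j e.n a i ↔ ∃ hi : i < e.n, (C e.n).kind a = .input j ⟨i, hi⟩ :=
      fun j i => ⟨fun ⟨_, h⟩ => h, fun h => ⟨a.2, h⟩⟩
    rw [level, eval_eq]
    have hex' := hex (fun b => ¬ level C X r e b) (fun b => ¬ (C e.n).eval (fun j => X j e) b = true)
      fun b hb => not_congr (ih' b hb)
    simp only [hop, hin, hcard, hcard', hex _ _ ih', hex']
    rcases hk : (C e.n).kind a with ⟨j, i⟩ | t
    · simp only [reduceCtorEq, false_and, or_false, GateKind.input.injEq]
      constructor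
      · rintro ⟨j', i', -, ⟨hi, rfl, rfl⟩, h⟩
        exact h
      · intro h
        exact ⟨j, i, i.2, ⟨i.2, rfl, rfl⟩, h⟩
    · cases t <;> simp

end Circuit

/-- Composition of a function in `FTC⁰` with definable functions. -/
theorem InFTC0.defB {q : ℕ} {h : (Fin q → ℕ) → ℕ} (hh : InFTC0 h) {X : Fin q → Env k → ℕ}
    (hX : ∀ j, DefB (X j)) (hX' : ∀ c e, Env.Ok c e → ∀ j, Nat.size (X j e) ≤ e.n) :
    DefB fun e => h fun j => X j e := by
  classical
  obtain ⟨C, hC, ⟨p, hp⟩, ⟨d, hd⟩, hout⟩ := hh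
  -- Paths have at most `d` edges, hence fewer than `d + 1`, so `d + 1` levels evaluate every node.
  set P : Env k → ℕ → Prop := fun e i => ∃ a, Circuit.outR C e.n i a ∧ Circuit.level C X (d + 1) e a with hP
  have hPD : DefP fun e => P e.pop (e.v 0) := by
    have hlev : DefP fun e : Env k => Circuit.level C X (d + 1) e.pop.pop (e.v 0) :=
      (Circuit.defP_level hC hp hX (d + 1)).map fun i => match i with
        | 0 => 0
        | i + 1 => i + 2
    refine DefP.ex (Q := fun e a => Circuit.outR C e.n (e.v 0) a ∧ Circuit.level C X (d + 1) e.pop a)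
      (fun c => ?_) ((DefP.orc hC.out 1 0).and hlev)
    obtain ⟨d, hd⟩ := PolyBdd.eval (k := k) p c
    refine ⟨d, fun e he z => ?_⟩
    rintro ⟨⟨hi, rfl⟩, -⟩
    exact (Fin.is_lt _).trans ((Nat.le_add_right _ _).trans_lt ((hp e.n).trans_lt (hd e he)))
  have key : ∀ c e, Env.Ok c e → (h fun j => X j e) =
      ∑ i ∈ Finset.range (C e.n).numOut, (if P e i then 1 else 0) * 2 ^ (1 * i) := by
    intro c e he
    rw [← hout e.n _ (hX' c e he), Circuit.output]
    rw [← Fin.sum_univ_eq_sum_range (fun i => (if P e i then 1 else 0) * 2 ^ (1 * i))]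
    refine Finset.sum_congr rfl fun i _ => ?_
    have h1 : P e i ↔ (C e.n).eval (fun j => X j e) ((C e.n).out i) = true := by
      rw [← Circuit.level_iff (d + 1) e _ fun m path h1 _ => Nat.lt_succ_of_le (hd e.n m path h1)]
      constructor
      · rintro ⟨a, ⟨hi, rfl⟩, h⟩
        exact h
      · intro h
        exact ⟨_, ⟨i.2, rfl⟩, h⟩
    simp only [h1]
    split_ifs <;> simp
  have hbit : ∀ c e, Env.Ok c e → ∀ i, (h fun j => X j e).testBit i = true ↔ P e i := by
    intro c e he i
    rw [key c e he, Nat.testBit_sum_mul_two_pow one_pos _ fun b => by split_ifs <;> norm_num]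
    rw [Nat.div_one, Nat.mod_one]
    by_cases h1 : P e i
    · have h2 : i < (C e.n).numOut := by
        obtain ⟨a, ⟨hi, -⟩, -⟩ := h1
        exact hi
      simp [h1, h2]
    · simp [h1]
  refine ⟨(PolyBdd.eval p).of_le fun c e he => ?_, hPD.congr fun c e he => (hbit c e.pop he.pop _).symm⟩
  refine (Nat.size_le.2 (Nat.lt_pow_two_of_testBit _ fun i hi => ?_)).trans
    ((Nat.le_add_left _ _).trans (hp e.n))
  refine Bool.eq_false_iff.2 fun h1 => ?_
  obtain ⟨a, ⟨hi', -⟩, -⟩ := (hbit c e he i).1 h1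
  omega

/-! ### Definable integers -/

/-- An integer is definable if it is the difference of definable numbers. -/
def DefZ (F : Env k → ℤ) : Prop :=
  ∃ A B : Env k → ℕ, DefB A ∧ DefB B ∧ ∀ c e, Env.Ok c e → F e = (A e : ℤ) - B e

theorem DefB.defZ {A : Env k → ℕ} (hA : DefB A) : DefZ fun e => (A e : ℤ) :=
  ⟨A, _, hA, .const 0, fun _ _ _ => by simp⟩

namespace DefZ

variable {F G : Env k → ℤ} {t : Env k → ℕ}

theorem const (m : ℤ) : DefZ fun _ : Env k => m :=
  ⟨_, _, .const m.toNat, .const (-m).toNat, fun _ _ _ => by dsimp only; omega⟩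

theorem add (hF : DefZ F) (hG : DefZ G) : DefZ fun e => F e + G e := by
  obtain ⟨A, B, hA, hB, h⟩ := hF
  obtain ⟨A', B', hA', hB', h'⟩ := hG
  refine ⟨_, _, hA.add hA', hB.add hB', fun c e he => ?_⟩
  simp only [h c e he, h' c e he]
  push_cast
  ring

theorem sub (hF : DefZ F) (hG : DefZ G) : DefZ fun e => F e - G e := by
  obtain ⟨A, B, hA, hB, h⟩ := hF
  obtain ⟨A', B', hA', hB', h'⟩ := hG
  refine ⟨_, _, hA.add hB', hB.add hA', fun c e he => ?_⟩
  simp only [h c e he, h' c e he]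
  push_cast
  ring

theorem mul (hF : DefZ F) (hG : DefZ G) : DefZ fun e => F e * G e := by
  obtain ⟨A, B, hA, hB, h⟩ := hF
  obtain ⟨A', B', hA', hB', h'⟩ := hG
  refine ⟨_, _, (hA.mul hA').add (hB.mul hB'), (hA.mul hB').add (hB.mul hA'), fun c e he => ?_⟩
  simp only [h c e he, h' c e he]
  push_cast
  ring

theorem half (hF : DefZ F) : DefZ fun e => F e / 2 := by
  obtain ⟨A, B, hA, hB, h⟩ := hF
  -- Adding the parity of `B` to both terms keeps the difference and makes the subtrahend even; then
  -- rounding down the minuend alone gives the rounding of the difference.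
  refine ⟨_, _, (hA.add hB.mod_two).half, (hB.add hB.mod_two).half, fun c e he => ?_⟩
  simp only [h c e he]
  omega

theorem pos (hF : DefZ F) : DefP fun e => 0 < F e := by
  obtain ⟨A, B, hA, hB, h⟩ := hF
  refine (hB.lt hA).congr fun c e he => ?_
  simp only [h c e he]
  omega

theorem natAbs (hF : DefZ F) : DefB fun e => (F e).natAbs := by
  obtain ⟨A, B, hA, hB, h⟩ := hF
  -- One of the two truncated differences is zero, the other one is the absolute value.
  refine ((hA.sub hB).add (hB.sub hA)).congr fun c e he => ?_
  simp only [h c e he]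
  omega

theorem ite {P : Env k → Prop} [∀ e, Decidable (P e)] (hP : DefP P) (hF : DefZ F) (hG : DefZ G) :
    DefZ fun e => if P e then F e else G e := by
  obtain ⟨A, B, hA, hB, h⟩ := hF
  obtain ⟨A', B', hA', hB', h'⟩ := hG
  refine ⟨_, _, DefB.ite hP hA hA', DefB.ite hP hB hB', fun c e he => ?_⟩
  simp only [h c e he, h' c e he]
  split_ifs <;> rfl

theorem sum {F : Env k → ℕ → ℤ} (ht : DefN t) (hF : DefZ fun e => F e.pop (e.v 0)) :
    DefZ fun e => ∑ z ∈ Finset.range (t e), F e z := by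
  obtain ⟨A, B, hA, hB, h⟩ := hF
  refine ⟨_, _, DefB.sum (F := fun e z => A (e.push z)) ht (by simpa only [Env.push_pop] using hA),
    DefB.sum (F := fun e z => B (e.push z)) ht (by simpa only [Env.push_pop] using hB), fun c e he => ?_⟩
  push_cast
  rw [← Finset.sum_sub_distrib]
  refine Finset.sum_congr rfl fun z hz => ?_
  obtain ⟨d, hd⟩ := ht.1 c
  exact h (max c d) (e.push z) ((he.mono (le_max_left _ _)).push
    (((Finset.mem_range.1 hz).trans (hd e he)).trans_le (bd_mono (le_max_right _ _) _)))

end DefZ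

/-- A number that is determined by the witnesses of a definable property. -/
theorem DefB.of_witness {F G t : Env k → ℕ} {Q : Env k → Prop} (ht : DefN t) (hQ : DefP Q) (hG : DefB G)
    (h : ∀ c e, Env.Ok c e → ∃ z < t e, Q (e.push z))
    (h' : ∀ c e, Env.Ok c e → ∀ z < t e, Q (e.push z) → G (e.push z) = F e) : DefB F := by
  have hbit : DefP fun e => ∃ z < t e.pop, Q (e.pop.push z) ∧ (G (e.pop.push z)).testBit (e.v 0) = true := by
    have hswap : ∀ e : Env k, e.map (fun i => match i with
        | 0 => 0
        | i + 1 => i + 2) = e.pop.pop.push (e.v 0) := by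
      intro e
      refine congrArg (Env.mk e.n e.x) ?_
      funext i
      rcases i with _ | i <;> rfl
    refine DefP.ex_lt (Q := fun e z => Q (e.pop.push z) ∧ (G (e.pop.push z)).testBit (e.v 0) = true) ht.pop ?_
    have h1 := hQ.map fun i => match i with
      | 0 => 0
      | i + 1 => i + 2
    have h2 := hG.map fun i => match i with
      | 0 => 0
      | i + 1 => i + 2
    simp only [hswap] at h1 h2
    exact h1.and (h2.testBit (.var 1))
  refine ⟨fun c => ?_, hbit.congr fun c e he => ?_⟩
  · obtain ⟨d, hd⟩ := ht.1 c
    obtain ⟨d', hd'⟩ := hG.bdd (max c d)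
    refine ⟨d', fun e he => ?_⟩
    obtain ⟨z, hz, hz'⟩ := h c e he
    dsimp only
    rw [← h' c e he z hz hz']
    exact hd' (e.push z) ((he.mono (le_max_left _ _)).push
      ((hz.trans (hd e he)).trans_le (bd_mono (le_max_right _ _) _)))
  · constructor
    · rintro ⟨z, hz, h1, h2⟩
      rwa [h' c e.pop he.pop z hz h1] at h2
    · intro h1
      obtain ⟨z, hz, hz'⟩ := h c e.pop he.pop
      exact ⟨z, hz, hz', by rwa [h' c e.pop he.pop z hz hz']⟩

theorem DefP.forall_mem {α : Type} {P : α → Env k → Prop} (h : ∀ a, DefP (P a)) (l : List α) :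
    DefP fun e => ∀ a ∈ l, P a e := by
  induction l with
  | nil => exact (DefP.const True).congr_cast fun e => by simp
  | cons a l ih => exact ((h a).and ih).congr_cast fun e => by simp

/-! ### Evaluation of expressions -/

namespace SgPoly

variable {X : Type}

theorem defZ_eval {ρ : X → Env k → ℤ} (hρ : ∀ v, DefZ (ρ v)) (P : SgPoly X) :
    DefZ fun e => P.eval fun v => ρ v e := by
  induction P with
  | var v => exact hρ v
  | const c => exact .const c
  | add P Q h1 h2 => exact h1.add h2
  | sub P Q h1 h2 => exact h1.sub h2
  | mul P Q h1 h2 => exact h1.mul h2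
  | half P h => exact h.half
  | sg P h => exact .ite h.pos (.const 1) (.const 0)

/-- The arguments of the outermost sign functions. -/
def topSg : SgPoly X → List (SgPoly X)
  | var _ => []
  | const _ => []
  | add P Q => P.topSg ++ Q.topSg
  | sub P Q => P.topSg ++ Q.topSg
  | mul P Q => P.topSg ++ Q.topSg
  | half P => P.topSg
  | sg P => [P]

open Classical in
/-- The value of an expression, for given signs of the arguments of the outermost sign functions. -/
noncomputable def evalTop (ρ : X → ℤ) (γ : SgPoly X → Prop) : SgPoly X → ℤ
  | var v => ρ v
  | const c => c
  | add P Q => P.evalTop ρ γ + Q.evalTop ρ γ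
  | sub P Q => P.evalTop ρ γ - Q.evalTop ρ γ
  | mul P Q => P.evalTop ρ γ * Q.evalTop ρ γ
  | half P => P.evalTop ρ γ / 2
  | sg P => if γ P then 1 else 0

theorem defZ_evalTop {ρ : X → Env k → ℤ} {γ : SgPoly X → Env k → Prop} (hρ : ∀ v, DefZ (ρ v))
    (hγ : ∀ P, DefP (γ P)) (P : SgPoly X) :
    DefZ fun e => P.evalTop (fun v => ρ v e) fun P => γ P e := by
  classical
  induction P with
  | var v => exact hρ v
  | const c => exact .const c
  | add P Q h1 h2 => exact h1.add h2
  | sub P Q h1 h2 => exact h1.sub h2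
  | mul P Q h1 h2 => exact h1.mul h2
  | half P h => exact h.half
  | sg P h => exact .ite (hγ P) (.const 1) (.const 0)

/-- Outside the outermost sign functions the variable `v` does not occur, and inside them only the
resulting signs matter. So the value given to `v` by `ρ` is irrelevant, and nested signs need not be
guessed. -/
theorem evalTop_eq_eval {ρ ρ' : X → ℤ} {γ : SgPoly X → Prop} {v : X} (hρ : ∀ w ≠ v, ρ w = ρ' w)
    (P : SgPoly X) (hP : P.OnlyUnderSg v) (hγ : ∀ Q ∈ P.topSg, (γ Q ↔ 0 < Q.eval ρ')) :
    P.evalTop ρ γ = P.eval ρ' := by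
  induction P with
  | var w => exact hρ w hP
  | const c => rfl
  | add P Q h1 h2 | sub P Q h1 h2 | mul P Q h1 h2 =>
    simp only [topSg, List.mem_append] at hγ
    simp only [evalTop, eval]
    rw [h1 hP.1 fun R hR => hγ R (Or.inl hR), h2 hP.2 fun R hR => hγ R (Or.inr hR)]
  | half P h =>
    simp only [evalTop, eval]
    rw [h hP hγ]
  | sg P h =>
    have := hγ P (List.mem_singleton.2 rfl)
    simp only [evalTop, eval, sgFun, this]

end SgPoly

/-! ### The solution of the equation -/

theorem size_succ_eq (a : ℕ) : Nat.size (a + 1) = Nat.size a ∨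
    (Nat.size (a + 1) = Nat.size a + 1 ∧ a = 2 ^ Nat.size a - 1) := by
  have h1 := Nat.lt_size_self a
  have h2 : Nat.size a ≤ Nat.size (a + 1) := Nat.size_le_size (Nat.le_succ a)
  by_cases h3 : a + 1 < 2 ^ Nat.size a
  · exact Or.inl (le_antisymm (Nat.size_le.2 h3) h2)
  · have h4 : a + 1 = 2 ^ Nat.size a := by omega
    refine Or.inr ⟨?_, by omega⟩
    conv_lhs => rw [h4, Nat.size_pow]

/-- The points before the jumps of `ℓ₂`. -/
def jump (m : ℕ) : ℕ := 2 ^ (2 ^ m - 1) - 1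

/-- For `ell2` to grow, the length of `x` and the length of that length must grow together: `x + 1`
is two to the power of the length of `x`, and that length plus one is `2 ^ ell2 x`. -/
theorem ell2_succ (x : ℕ) : ell2 (x + 1) = ell2 x ∨ (ell2 (x + 1) = ell2 x + 1 ∧ x = jump (ell2 x)) := by
  unfold ell2 jump
  rcases size_succ_eq x with h | ⟨h, h'⟩
  · rw [h]
    exact Or.inl rfl
  · rw [h]
    rcases size_succ_eq (Nat.size x) with h1 | ⟨h1, h2⟩
    · exact Or.inl h1
    · refine Or.inr ⟨h1, ?_⟩
      rw [← h2]
      exact h'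

theorem ell2_jump (m : ℕ) : ell2 (jump m) = m := by
  rw [ell2, jump, DefN.size_two_pow_sub_one, DefN.size_two_pow_sub_one]

theorem two_pow_le_size {m a : ℕ} (h : m < ell2 a) : 2 ^ m ≤ Nat.size a := Nat.lt_size.1 h

theorem jump_le {m a : ℕ} (h : m < ell2 a) : jump m ≤ a := by
  have h1 := two_pow_le_size h
  have h2 : 2 ^ m - 1 < Nat.size a := by
    have := Nat.two_pow_pos m
    omega
  have h3 := Nat.lt_size.1 h2
  unfold jump
  omega

section Solution

variable {p : ℕ} (g : (Fin p → ℕ) → ℕ) (h : (Fin (p + 1) → ℕ) → ℕ) (B : SgPoly (ODEVar p))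
  {f : (Fin (p + 1) → ℕ) → ℤ}

/-- Steps at which `ell2` is constant change nothing; the step that raises `ell2` from `m` to `m +
1` takes place at `x = jump m` and contributes the summand with index `m`. -/
theorem SolvesEll2ODE.eq_sum {g : (Fin p → ℕ) → ℕ} {h : (Fin (p + 1) → ℕ) → ℕ} {B : SgPoly (ODEVar p)}
    (hf : SolvesEll2ODE g h B f) (y : Fin p → ℕ) (x : ℕ) :
    f (Matrix.vecCons x y) = g y + ∑ m ∈ Finset.range (ell2 x), B.eval (ODEVar.val (jump m) y
      (h (Matrix.vecCons (jump m) y)) (f (Matrix.vecCons (jump m) y))) := by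
  induction x with
  | zero => simpa [ell2] using (hf y).1
  | succ x ih =>
    rw [(hf y).2 x]
    rcases ell2_succ x with h1 | ⟨h1, h2⟩
    · rw [h1, sub_self, zero_mul, add_zero, ih]
    · rw [h1, Finset.sum_range_succ, ← add_assoc, ← ih, ← h2]
      push_cast
      ring

/-- The points before the jumps of `ℓ₂` up to `a`. -/
noncomputable def jumpUpTo (a i : ℕ) : ℕ := jump (if i < ell2 a then i else 0)

theorem jumpUpTo_eq {a i : ℕ} (h : i < ell2 a) : jumpUpTo a i = jump i := by
  rw [jumpUpTo, if_pos h]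

/-- The default value in `jumpUpTo` makes this hold for all `i`, so that the arguments of `h` are
never longer than the length bound of the inputs, as `InFTC0.defB` requires. -/
theorem jumpUpTo_le (a i : ℕ) : jumpUpTo a i ≤ a := by
  unfold jumpUpTo
  split_ifs with h
  · exact jump_le h
  · exact Nat.zero_le a

open Classical in
/-- The position of the guessed sign of `P` for the `i`-th jump. -/
noncomputable def signPos (P : SgPoly (ODEVar p)) (i : ℕ) : ℕ := B.topSg.length * i + B.topSg.idxOf P

/-- The values of the terms at the `i`-th jump, for a given value of the solution. -/
noncomputable def termVal (a : ℕ) (y : Fin p → ℕ) (i : ℕ) (v : ℤ) : ODEVar p → ℤ :=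
  ODEVar.val (jumpUpTo a i) y (h (Matrix.vecCons (jumpUpTo a i) y)) v

/-- The value of the solution at the `m`-th jump, if the guessed signs are the bits of `z`. -/
noncomputable def guessVal (a : ℕ) (y : Fin p → ℕ) (z m : ℕ) : ℤ :=
  g y + ∑ i ∈ Finset.range m, B.evalTop (termVal h a y i 0) fun P => z.testBit (signPos B P i) = true

/-- The guessed signs agree with the signs that they yield. -/
def GuessOk (a : ℕ) (y : Fin p → ℕ) (z : ℕ) : Prop :=
  ∀ i < ell2 a, ∀ P ∈ B.topSg, (z.testBit (signPos B P i) = true ↔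
    0 < P.eval (termVal h a y i (guessVal g h B a y z i)))

variable {g h B}

theorem guessVal_eq (hB : B.OnlyUnderSg ODEVar.f) {a : ℕ} {y : Fin p → ℕ}
    {z m : ℕ} (hm : m ≤ ell2 a) (hz : ∀ i < m, ∀ P ∈ B.topSg, (z.testBit (signPos B P i) = true ↔
      0 < P.eval (termVal h a y i (f (Matrix.vecCons (jump i) y))))) :
    guessVal g h B a y z m = g y + ∑ i ∈ Finset.range m, B.eval (ODEVar.val (jump i) y
      (h (Matrix.vecCons (jump i) y)) (f (Matrix.vecCons (jump i) y))) := by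
  unfold guessVal
  congr 1
  refine Finset.sum_congr rfl fun i hi => ?_
  rw [Finset.mem_range] at hi
  rw [SgPoly.evalTop_eq_eval (v := ODEVar.f) (ρ' := termVal h a y i (f (Matrix.vecCons (jump i) y)))
    ?_ B hB (hz i hi), termVal, jumpUpTo_eq (hi.trans_le hm)]
  intro w hw
  cases w <;> first | rfl | exact absurd rfl hw

/-- Strong induction along the jumps: the guessed value at a jump uses only the guessed signs of
earlier jumps. These are the true ones, because consistency makes them the signs computed from
earlier guessed values, which are correct by induction. -/
theorem GuessOk.guessVal_eq_f (hB : B.OnlyUnderSg ODEVar.f) (hf : SolvesEll2ODE g h B f) {a : ℕ}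
    {y : Fin p → ℕ} {z : ℕ} (hz : GuessOk g h B a y z) :
    guessVal g h B a y z (ell2 a) = f (Matrix.vecCons a y) := by
  have h1 : ∀ m ≤ ell2 a, guessVal g h B a y z m = f (Matrix.vecCons (jump m) y) := by
    intro m
    induction m using Nat.strong_induction_on with
    | _ m ih =>
      intro hm
      rw [guessVal_eq hB hm, hf.eq_sum, ell2_jump]
      intro i hi P hP
      rw [hz i (hi.trans_le hm) P hP, ih i hi (hi.le.trans hm)]
  rw [hf.eq_sum]
  refine guessVal_eq hB le_rfl fun i hi P hP => ?_
  rw [hz i hi P hP, h1 i hi.le]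

/-- The true signs, one block of `B.topSg.length` bits for each jump, form a consistent guess: they
reproduce the true values, and hence themselves. -/
theorem exists_guessOk (hB : B.OnlyUnderSg ODEVar.f) (hf : SolvesEll2ODE g h B f) (a : ℕ) (y : Fin p → ℕ) :
    ∃ z < 2 ^ (B.topSg.length * ell2 a), GuessOk g h B a y z := by
  classical
  set s := B.topSg.length with hs
  set z := Nat.ofBits fun j : Fin (s * ell2 a) => decide (∃ P ∈ B.topSg[(j : ℕ) % s]?,
    0 < P.eval (termVal h a y (j / s) (f (Matrix.vecCons (jump (j / s)) y)))) with hz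
  have hbit : ∀ i < ell2 a, ∀ P ∈ B.topSg, (z.testBit (signPos B P i) = true ↔
      0 < P.eval (termVal h a y i (f (Matrix.vecCons (jump i) y)))) := by
    intro i hi P hP
    have h1 : B.topSg.idxOf P < s := List.idxOf_lt_length_of_mem hP
    have h2 : signPos B P i < s * ell2 a := by
      rw [signPos, ← hs]
      calc _ < s * i + s := by omega
        _ = s * (i + 1) := by ring
        _ ≤ _ := Nat.mul_le_mul_left _ hi
    have h3 : signPos B P i % s = B.topSg.idxOf P := by
      rw [signPos, ← hs, Nat.mul_add_mod, Nat.mod_eq_of_lt h1]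
    have h4 : signPos B P i / s = i := by
      rw [signPos, ← hs, Nat.mul_add_div (by omega), Nat.div_eq_of_lt h1, add_zero]
    rw [hz, Nat.testBit_ofBits_lt _ _ h2]
    simp only [h3, h4, decide_eq_true_eq]
    rw [List.getElem?_eq_getElem h1, List.getElem_idxOf h1]
    simp
  refine ⟨z, Nat.ofBits_lt_two_pow _, fun i hi P hP => ?_⟩
  rw [hbit i hi P hP, guessVal_eq hB hi.le fun j hj Q hQ => hbit j (hj.trans hi) Q hQ]
  have h5 := hf.eq_sum y (jump i)
  rw [ell2_jump] at h5
  rw [← h5]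

/-! ### Definability of the solution -/

variable {t tz : Env (p + 1) → ℕ}

theorem defN_ell2 : DefN fun e : Env (p + 1) => ell2 (e.x 0) := (DefB.input 0).size.size

theorem defB_jumpUpTo (ht : DefN t) : DefB fun e : Env (p + 1) => jumpUpTo (e.x 0) (t e) := by
  have h1 : DefN fun e : Env (p + 1) => if t e < ell2 (e.x 0) then t e else 0 :=
    .ite (DefP.lt ht defN_ell2) ht .zero
  -- For `m < ell2 a` the exponent in `jump m` is less than `2 ^ m ≤ Nat.size a`. So it is a small
  -- number, and the jump is a large number obtained by a shift.
  have h2 := h1.two_pow (((DefB.input 0).size.1.add (.const 1)).of_le fun c e _ => by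
    split_ifs with h
    · exact (two_pow_le_size h).trans (Nat.le_succ _)
    · simp)
  exact (((DefB.const 1).shift (h2.sub (.const 1))).sub (.const 1)).congr fun _ _ _ => by
    simp [jumpUpTo, jump]

theorem defZ_termVal (hh : InFTC0 h) (ht : DefN t) {F : Env (p + 1) → ℤ} (hF : DefZ F) (v : ODEVar p) :
    DefZ fun e => termVal h (e.x 0) (fun j => e.x j.succ) (t e) (F e) v := by
  cases v with
  | x => exact (defB_jumpUpTo ht).defZ
  | y j => exact (DefB.input j.succ).defZ
  | h =>
    have h1 := hh.defB (X := Fin.cons (fun e : Env (p + 1) => jumpUpTo (e.x 0) (t e)) fun j e => e.x j.succ)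
      (Fin.cases (defB_jumpUpTo ht) fun j => DefB.input j.succ)
      fun c e he j => by
        refine Fin.cases ?_ (fun j => ?_) j
        · exact (Nat.size_le_size (jumpUpTo_le _ _)).trans (he.1 0)
        · exact he.1 j.succ
    refine (h1.congr fun c e _ => ?_).defZ
    congr 1
    funext j
    refine Fin.cases ?_ (fun j => ?_) j <;> rfl
  | f => exact hF

theorem defN_signPos (P : SgPoly (ODEVar p)) (ht : DefN t) : DefN fun e => signPos B P (t e) :=
  ((DefN.const _).mul ht).add (.const _)

theorem defZ_guessVal (hg : InFTC0 g) (hh : InFTC0 h) (htz : DefN tz) (ht : DefN t) :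
    DefZ fun e => guessVal g h B (e.x 0) (fun j => e.x j.succ) (tz e) (t e) := by
  have h1 := (hg.defB (X := fun j (e : Env (p + 1)) => e.x j.succ) (fun j => .input _)
    fun c e he j => he.1 j.succ).defZ
  refine h1.add (DefZ.sum (F := fun e i => B.evalTop (termVal h (e.x 0) (fun j => e.x j.succ) i 0)
    fun P => (tz e).testBit (signPos B P i) = true) ht ?_)
  exact SgPoly.defZ_evalTop (defZ_termVal hh (.var 0) (.const 0))
    (fun P => DefP.testBit htz.pop (defN_signPos P (.var 0))) B

theorem defP_guessOk (hg : InFTC0 g) (hh : InFTC0 h) (htz : DefN tz) :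
    DefP fun e => GuessOk g h B (e.x 0) (fun j => e.x j.succ) (tz e) := by
  refine DefP.all_lt (Q := fun e i => ∀ P ∈ B.topSg, ((tz e).testBit (signPos B P i) = true ↔
    0 < P.eval (termVal h (e.x 0) (fun j => e.x j.succ) i
      (guessVal g h B (e.x 0) (fun j => e.x j.succ) (tz e) i)))) defN_ell2 ?_
  refine DefP.forall_mem (fun P => (DefP.testBit htz.pop (defN_signPos P (.var 0))).iff ?_) _
  exact (SgPoly.defZ_eval (defZ_termVal hh (.var 0) (defZ_guessVal hg hh htz.pop (.var 0))) P).pos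

/-- The power `2 ^ ell2 a` is at most `2 * Nat.size a + 1`, so there are only polynomially many
guesses. This is where differentiating along `ell2` is essential: along the length itself there
would be exponentially many. -/
theorem defN_numGuesses (s : ℕ) : DefN fun e : Env (p + 1) => 2 ^ (s * ell2 (e.x 0)) := by
  refine ((DefN.const s).mul defN_ell2).two_pow ?_
  have h1 : PolyBdd fun e : Env (p + 1) => 2 ^ ell2 (e.x 0) := by
    refine (((PolyBdd.const 2).mul (DefB.input 0).size.1).add (.const 1)).of_le fun c e _ => ?_
    rcases Nat.eq_zero_or_pos (ell2 (e.x 0)) with h | h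
    · rw [h]
      simp
    · have h2 := two_pow_le_size (m := ell2 (e.x 0) - 1) (a := e.x 0) (by omega)
      obtain ⟨m, hm⟩ := Nat.exists_eq_succ_of_ne_zero h.ne'
      rw [hm] at h2 ⊢
      rw [Nat.succ_sub_one] at h2
      rw [pow_succ]
      omega
  have h2 : ∀ s : ℕ, PolyBdd fun e : Env (p + 1) => 2 ^ (s * ell2 (e.x 0)) := by
    intro s
    induction s with
    | zero => simpa only [Nat.zero_mul, pow_zero] using PolyBdd.const 1
    | succ s ih => simpa only [Nat.succ_mul, pow_add] using ih.mul h1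
  exact h2 s

/-- The map `Φ` stands for the absolute value and for the indicator of negative numbers. All
consistent guesses yield the same value, so any witness may be used to read off its bits. -/
theorem defB_of_guess (hg : InFTC0 g) (hh : InFTC0 h) (hB : B.OnlyUnderSg ODEVar.f)
    (hf : SolvesEll2ODE g h B f) (Φ : ℤ → ℕ) (hΦ : ∀ F : Env (p + 1) → ℤ, DefZ F → DefB fun e => Φ (F e)) :
    InFTC0 fun v => Φ (f v) := by
  have h1 : DefB fun e : Env (p + 1) => Φ (f e.x) := by
    refine DefB.of_witness (defN_numGuesses B.topSg.length) (defP_guessOk (B := B) hg hh (.var 0))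
      (hΦ _ (defZ_guessVal (B := B) hg hh (.var 0) defN_ell2))
      (fun c e _ => exists_guessOk hB hf (e.x 0) fun j => e.x j.succ) fun c e _ z _ hz => ?_
    have h2 := hz.guessVal_eq_f hB hf
    have h3 : e.x = Matrix.vecCons (e.x 0) fun j => e.x j.succ := by
      funext j
      refine Fin.cases ?_ (fun j => ?_) j <;> rfl
    conv_rhs => rw [h3]
    exact congrArg Φ h2
  exact h1.inFTC0 fun e _ => rfl

end Solution

theorem mainTheorem8 (p : ℕ) (g : (Fin p → ℕ) → ℕ) (h : (Fin (p + 1) → ℕ) → ℕ)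
    (hg : InFTC0 g) (hh : InFTC0 h)
    (B : SgPoly (ODEVar p)) (hB : B.OnlyUnderSg ODEVar.f)
    (f : (Fin (p + 1) → ℕ) → ℤ) (hf : SolvesEll2ODE g h B f) :
    IntInFTC0 f := by
  refine ⟨defB_of_guess hg hh hB hf Int.natAbs fun F hF => hF.natAbs,
    defB_of_guess hg hh hB hf (fun z => if z < 0 then 1 else 0) fun F hF => ?_⟩
  refine DefB.ite (P := fun e => F e < 0) ?_ (.const 1) (.const 0)
  exact ((DefZ.const 0).sub hF).pos.congr_cast fun e => by omega
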